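/- Let $d\in\{2,3\}$ and let $\Omega\subset\mathbb R^d$ be a bounded domain (nonempty, open, connected) with polyhedral boundary, i.e. $\partial\Omega$ is contained in a finite union of hyperplanes and $\Omega$ is the interior of its closure. Let $L\ge 1$ and let the electrodes $e_1,\dots,e_L\subset\partial\Omega$ be flat measurable pieces of the boundary (each contained in a hyperplane) of positive surface measure with pairwise disjoint closures. Let $z_1,\dots,z_L>0$ be contact impedances, let $I\in\mathbb R^L_\diamond:=\{V\in\mathbb R^L:\sum_{l}V_l=0\}$ be the input current, let $U^\delta\in\mathbb R^L$, and let $0<c_0<c_1$, $\widetilde\alpha>0$. Put $W(s)=(s-c_0)^2(s-c_1)^2$ and $$\widetilde{\mathcal A}=\{\sigma\in H^1(\Omega):\ c_0\le\sigma(x)\le c_1\ \text{for a.e. }x\in\Omega\}.$$ For $\sigma\in\widetilde{\mathcal A}$ let $(u(\sigma),U(\sigma))\in H^1(\Omega)\times\mathbb R^L_\diamond$ be the weak solution of the complete electrode model, that is, $$\int_\Omega\sigma\nabla u\cdot\nabla v\,dx+\sum_{l=1}^L z_l^{-1}\int_{e_l}(u-U_l)(v-V_l)\,ds=\sum_{l=1}^L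 I_lV_l\qquad\text{for all }(v,V)\in H^1(\Omega)\times\mathbb R^L_\diamond,$$ where $u,v$ on $e_l$ denote boundary traces. Then for every $\sigma\in\widetilde{\mathcal A}$ this weak solution exists and is unique, and for every $\varepsilon>0$ the functional $$\mathcal J_\varepsilon(\sigma)=\tfrac12\|U(\sigma)-U^\delta\|^2+\tfrac{\widetilde\alpha}{2}\Big(\varepsilon\int_\Omega|\nabla\sigma|^2\,dx+\tfrac1\varepsilon\int_\Omega W(\sigma)\,dx\Big)$$ has at least one minimizer over $\widetilde{\mathcal A}$, where $\|\cdot\|$ is the Euclidean norm on $\mathbb R^L$. -/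

import Mathlib

open MeasureTheory Filter Topology
open scoped ContDiff

noncomputable section

namespace CEM

/-- A bounded domain of `ℝ^d` with polyhedral boundary: a nonempty, connected, bounded open set
whose boundary is contained in finitely many affine hyperplanes `⟪n, x⟫ = b` with `n ≠ 0`, and which
lies on one side of its boundary (`Ω` is the interior of its closure, so there are no slits). -/
structure IsPolyhedralDomain {d : ℕ} (Ω : Set (EuclideanSpace ℝ (Fin d))) : Prop where
  isOpen : IsOpen Ω
  isConnected : IsConnected Ω
  isBounded : Bornology.IsBounded Ω
  interior_closure : interior (closure Ω) = Ω
  frontier_subset : ∃ H : Finset (EuclideanSpace ℝ (Fin d) × ℝ),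
    (∀ h ∈ H, h.1 ≠ 0) ∧ frontier Ω ⊆ ⋃ h ∈ H, {x | inner ℝ h.1 x = h.2}

/-- The surface measure: the `(d-1)`-dimensional Hausdorff measure, normalized so that on
`(d-1)`-dimensional planes it is the Lebesgue measure. -/
def surfaceMeasure (d : ℕ) : Measure (EuclideanSpace ℝ (Fin d)) :=
  Measure.euclideanHausdorffMeasure (d - 1)

/-- A family of electrodes: flat measurable pieces of the boundary of `Ω` with positive surface
measure and pairwise disjoint closures. -/
structure IsElectrodeFamily {d L : ℕ} (Ω : Set (EuclideanSpace ℝ (Fin d)))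
    (e : Fin L → Set (EuclideanSpace ℝ (Fin d))) : Prop where
  measurableSet : ∀ l, MeasurableSet (e l)
  subset_frontier : ∀ l, e l ⊆ frontier Ω
  planar : ∀ l, ∃ (n : EuclideanSpace ℝ (Fin d)) (b : ℝ), n ≠ 0 ∧ ∀ x ∈ e l, inner ℝ n x = b
  measure_pos : ∀ l, 0 < surfaceMeasure d (e l)
  disjoint_closure : ∀ l k, l ≠ k → Disjoint (closure (e l)) (closure (e k))

/-- `G ∈ L²(Ω)^d` is the weak gradient of `u` on `Ω`. -/
def IsWeakGradient {d : ℕ} (Ω : Set (EuclideanSpace ℝ (Fin d)))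
    (u : EuclideanSpace ℝ (Fin d) → ℝ)
    (G : EuclideanSpace ℝ (Fin d) → EuclideanSpace ℝ (Fin d)) : Prop :=
  MemLp G 2 (volume.restrict Ω) ∧
    ∀ φ : EuclideanSpace ℝ (Fin d) → ℝ, ContDiff ℝ ∞ φ → HasCompactSupport φ → tsupport φ ⊆ Ω →
      ∀ i : Fin d, ∫ x in Ω, u x * fderiv ℝ φ x (EuclideanSpace.single i 1) =
        - ∫ x in Ω, G x i * φ x

/-- `u ∈ H¹(Ω)`. -/
def MemH1 {d : ℕ} (Ω : Set (EuclideanSpace ℝ (Fin d)))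
    (u : EuclideanSpace ℝ (Fin d) → ℝ) : Prop :=
  MemLp u 2 (volume.restrict Ω) ∧ ∃ G, IsWeakGradient Ω u G

open Classical in
/-- The weak gradient of `u ∈ H¹(Ω)` (unique up to null sets; `0` if there is none). -/
def weakGrad {d : ℕ} (Ω : Set (EuclideanSpace ℝ (Fin d)))
    (u : EuclideanSpace ℝ (Fin d) → ℝ) :
    EuclideanSpace ℝ (Fin d) → EuclideanSpace ℝ (Fin d) :=
  if h : ∃ G, IsWeakGradient Ω u G then h.choose else 0

/-- The boundary trace of `u`, at `x ∈ ∂Ω`: the limit as `r → 0⁺` of the mean value of `u` over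
`B(x, r) ∩ Ω`. For `u ∈ H¹(Ω)` on a polyhedral domain this limit exists at almost every boundary
point with respect to the surface measure. -/
def trace {d : ℕ} (Ω : Set (EuclideanSpace ℝ (Fin d)))
    (u : EuclideanSpace ℝ (Fin d) → ℝ) (x : EuclideanSpace ℝ (Fin d)) : ℝ :=
  limUnder (𝓝[>] (0 : ℝ)) fun r => ⨍ y in Metric.ball x r ∩ Ω, u y

/-- The form
`a(σ,(u,U),(v,V)) = (σ∇u,∇v)_{L²(Ω)} + ∑ₗ zₗ⁻¹ (u-Uₗ,v-Vₗ)_{L²(eₗ)}`. -/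
def form {d L : ℕ} (Ω : Set (EuclideanSpace ℝ (Fin d)))
    (e : Fin L → Set (EuclideanSpace ℝ (Fin d))) (z : Fin L → ℝ)
    (σ : EuclideanSpace ℝ (Fin d) → ℝ)
    (u : EuclideanSpace ℝ (Fin d) → ℝ) (U : EuclideanSpace ℝ (Fin L))
    (v : EuclideanSpace ℝ (Fin d) → ℝ) (V : EuclideanSpace ℝ (Fin L)) : ℝ :=
  (∫ x in Ω, σ x * inner ℝ (weakGrad Ω u x) (weakGrad Ω v x)) +
    ∑ l, (z l)⁻¹ * ∫ x in e l, (trace Ω u x - U l) * (trace Ω v x - V l) ∂(surfaceMeasure d)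

/-- `(u, U) ∈ H¹(Ω) × ℝ_⋄^L` is a weak solution of the complete electrode model with conductivity
`σ`, contact impedances `z` and input current `I`. -/
def IsSolution {d L : ℕ} (Ω : Set (EuclideanSpace ℝ (Fin d)))
    (e : Fin L → Set (EuclideanSpace ℝ (Fin d))) (z : Fin L → ℝ) (I : EuclideanSpace ℝ (Fin L))
    (σ : EuclideanSpace ℝ (Fin d) → ℝ)
    (u : EuclideanSpace ℝ (Fin d) → ℝ) (U : EuclideanSpace ℝ (Fin L)) : Prop :=
  MemH1 Ω u ∧ ∑ l, U l = 0 ∧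
    ∀ (v : EuclideanSpace ℝ (Fin d) → ℝ) (V : EuclideanSpace ℝ (Fin L)),
      MemH1 Ω v → ∑ l, V l = 0 → form Ω e z σ u U v V = inner ℝ I V

open Classical in
/-- The forward map `σ ↦ U(σ)`: the electrode voltage of the weak solution (`0` if there is none). -/
def voltage {d L : ℕ} (Ω : Set (EuclideanSpace ℝ (Fin d)))
    (e : Fin L → Set (EuclideanSpace ℝ (Fin d))) (z : Fin L → ℝ) (I : EuclideanSpace ℝ (Fin L))
    (σ : EuclideanSpace ℝ (Fin d) → ℝ) : EuclideanSpace ℝ (Fin L) :=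
  if h : ∃ U : EuclideanSpace ℝ (Fin L), ∃ u, IsSolution Ω e z I σ u U then h.choose else 0

/-- The double-well potential `W(s) = (s-c₀)²(s-c₁)²`. -/
def doubleWell (c₀ c₁ s : ℝ) : ℝ := (s - c₀) ^ 2 * (s - c₁) ^ 2

/-- The Modica-Mortola functional `ε ‖∇σ‖²_{L²(Ω)} + ε⁻¹ ∫_Ω W(σ)` for `σ ∈ H¹(Ω)`. -/
def modicaMortola {d : ℕ} (Ω : Set (EuclideanSpace ℝ (Fin d))) (c₀ c₁ ε : ℝ)
    (σ : EuclideanSpace ℝ (Fin d) → ℝ) : ℝ :=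
  ε * (∫ x in Ω, ‖weakGrad Ω σ x‖ ^ 2) + 1 / ε * ∫ x in Ω, doubleWell c₀ c₁ (σ x)

/-- The admissible set `{σ ∈ H¹(Ω) : c₀ ≤ σ ≤ c₁ a.e. in Ω}`. -/
def admissible {d : ℕ} (Ω : Set (EuclideanSpace ℝ (Fin d))) (c₀ c₁ : ℝ) :
    Set (EuclideanSpace ℝ (Fin d) → ℝ) :=
  {σ | MemH1 Ω σ ∧ ∀ᵐ x ∂(volume.restrict Ω), c₀ ≤ σ x ∧ σ x ≤ c₁}

/-- The Tikhonov functional `½‖U(σ) - U^δ‖² + (α/2) F_ε(σ)`. -/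
def tikhonov {d L : ℕ} (Ω : Set (EuclideanSpace ℝ (Fin d)))
    (e : Fin L → Set (EuclideanSpace ℝ (Fin d))) (z : Fin L → ℝ)
    (I Uδ : EuclideanSpace ℝ (Fin L)) (c₀ c₁ α ε : ℝ)
    (σ : EuclideanSpace ℝ (Fin d) → ℝ) : ℝ :=
  1 / 2 * ‖voltage Ω e z I σ - Uδ‖ ^ 2 + α / 2 * modicaMortola Ω c₀ c₁ ε σ

end CEM

end

/-!
The proof rests on a single analytic estimate, the Poincaré inequality on a convex open subset `D`
of `Ω` (`CEM.IsWeakGradient.poincare`). It follows from the representation of the increments of an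
`H¹` function as integrals of its weak gradient along segments (`CEM.IsWeakGradient.increment_eq`).
The finitely many hyperplanes that contain `∂Ω` cut `Ω`, up to a null set, into finitely many convex
cells (`CEM.innerCells`), and everything else is obtained by applying the estimate to convex sets.

*Global Poincaré inequality.* Averages over overlapping convex sets are comparable up to the gradient
energy. Chaining balls inside the connected set `Ω` compares the averages over all cells
(`CEM.exists_poincare_const`).

*Traces.* Near almost every boundary point `x`, `Ω` coincides with a single cell, so `B(x, r) ∩ Ω` is
convex with volume comparable to `r ^ d`. The oscillation of the averages over these sets on dyadic
scales is controlled by the energy in `B(x, r) ∩ Ω`. Integrated over the electrode, whose surface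
measure is upper Ahlfors regular of dimension `d - 1`, the energies gain a factor `r ^ (d - 1)`
against the loss `r ^ (2 - d)`, and the sum over the scales converges. This gives the existence of the
trace almost everywhere and its `L²` bound (`CEM.exists_trace_const`).

*Well-posedness.* The triples `(u, ∇u, U)` form a closed subspace of a Hilbert space. The two
inequalities above, together with `∑ U_l = 0`, make the variational form coercive
(`CEM.exists_coercive`), so that the Lax–Milgram theorem applies. The coercivity constant depends
only on the lower bound of `σ`, which makes `σ ↦ U(σ)` continuous along bounded sequences converging
almost everywhere (`CEM.tendsto_voltage`).

*Compactness and minimizers.* Adding the hyperplanes of a fine grid makes the cells small, and the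
Poincaré inequality on the cells gives Rellich's theorem (`CEM.totallyBounded_boundedH1`). A
minimizing sequence then has a subsequence that converges almost everywhere and whose gradients
converge weakly along an ultrafilter. The misfit and the double-well term converge, and the Dirichlet
energy is weakly lower semicontinuous, so the limit is a minimizer
(`CEM.exists_isMinOn_tikhonov`).
-/

/-! ### Weak gradients -/

namespace CEM

/-- Cauchy–Schwarz (Jensen) for a Bochner integral over a finite measure. -/
theorem enorm_integral_sq_le {α F : Type*} [MeasurableSpace α] [NormedAddCommGroup F]
    [NormedSpace ℝ F] (μ : Measure α) (f : α → F) :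
    ‖∫ x, f x ∂μ‖ₑ ^ 2 ≤ μ Set.univ * ∫⁻ x, ‖f x‖ₑ ^ 2 ∂μ := by
  by_cases hf : AEStronglyMeasurable f μ
  swap
  · rw [integral_non_aestronglyMeasurable hf]; simp
  have h1 := enorm_integral_le_lintegral_enorm (μ := μ) f
  have h2 := ENNReal.lintegral_mul_le_Lp_mul_Lq μ (Real.HolderConjugate.two_two)
    (f := fun _ => (1 : ENNReal)) (g := fun x => ‖f x‖ₑ) aemeasurable_const hf.enorm
  have h3 : ‖∫ x, f x ∂μ‖ₑ ≤ (μ Set.univ) ^ (1 / 2 : ℝ) * (∫⁻ x, ‖f x‖ₑ ^ 2 ∂μ) ^ (1 / 2 : ℝ) := by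
    refine h1.trans ?_
    simpa using h2
  calc ‖∫ x, f x ∂μ‖ₑ ^ 2
      ≤ ((μ Set.univ) ^ (1 / 2 : ℝ) * (∫⁻ x, ‖f x‖ₑ ^ 2 ∂μ) ^ (1 / 2 : ℝ)) ^ 2 := by gcongr
    _ = _ := by
      rw [mul_pow, ← ENNReal.rpow_natCast, ← ENNReal.rpow_natCast, ← ENNReal.rpow_mul,
        ← ENNReal.rpow_mul]
      norm_num

variable {d : ℕ} {Ω : Set (EuclideanSpace ℝ (Fin d))} {u : EuclideanSpace ℝ (Fin d) → ℝ}
  {G : EuclideanSpace ℝ (Fin d) → EuclideanSpace ℝ (Fin d)}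

theorem integrableOn_of_memLp_two {F : Type*} [NormedAddCommGroup F]
    {f : EuclideanSpace ℝ (Fin d) → F}
    (hb : Bornology.IsBounded Ω) (hu : MemLp f 2 (volume.restrict Ω)) : IntegrableOn f Ω := by
  have : IsFiniteMeasure (volume.restrict Ω) := ⟨by simpa using hb.measure_lt_top⟩
  exact hu.integrable (by norm_num)

theorem integrable_mul_of_hasCompactSupport {μ : Measure (EuclideanSpace ℝ (Fin d))}
    {f φ : EuclideanSpace ℝ (Fin d) → ℝ} (hf : Integrable f μ) (hφ : Continuous φ)
    (hc : HasCompactSupport φ) : Integrable (fun x => f x * φ x) μ := by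
  obtain ⟨C, hC⟩ := hc.exists_bound_of_continuous hφ
  exact hf.mul_bdd (c := C) hφ.aestronglyMeasurable (Eventually.of_forall hC)

theorem IsWeakGradient.integral_mul_fderiv (hb : Bornology.IsBounded Ω)
    (hu : MemLp u 2 (volume.restrict Ω)) (hG : IsWeakGradient Ω u G)
    {φ : EuclideanSpace ℝ (Fin d) → ℝ} (hφ : ContDiff ℝ ∞ φ) (hc : HasCompactSupport φ)
    (hs : tsupport φ ⊆ Ω) (h : EuclideanSpace ℝ (Fin d)) :
    ∫ x in Ω, u x * fderiv ℝ φ x h = - ∫ x in Ω, inner ℝ h (G x) * φ x := by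
  have hui := integrableOn_of_memLp_two hb hu
  have hGi := integrableOn_of_memLp_two hb hG.1
  have hh : h = ∑ i, h i • EuclideanSpace.single i (1 : ℝ) := by
    ext j; simp [Finset.sum_apply, Pi.single_apply]
  have e1 : ∀ x, u x * fderiv ℝ φ x h =
      ∑ i, h i * (u x * fderiv ℝ φ x (EuclideanSpace.single i 1)) := by
    intro x
    conv_lhs => rw [hh]
    rw [map_sum, Finset.mul_sum]
    refine Finset.sum_congr rfl fun i _ => ?_
    rw [map_smul, smul_eq_mul]; ring
  have e2 : ∀ x, inner ℝ h (G x) * φ x = ∑ i, h i * (G x i * φ x) := by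
    intro x
    rw [PiLp.inner_apply, Finset.sum_mul]
    refine Finset.sum_congr rfl fun i _ => ?_
    simp; ring
  simp_rw [e1, e2]
  have c1 : ∀ v, Continuous fun x => fderiv ℝ φ x v := fun v =>
    (hφ.continuous_fderiv (by simp)).clm_apply continuous_const
  rw [integral_finsetSum, integral_finsetSum, ← Finset.sum_neg_distrib]
  · refine Finset.sum_congr rfl fun i _ => ?_
    rw [integral_const_mul, integral_const_mul, hG.2 φ hφ hc hs i]; ring
  · intro i _
    refine (integrable_mul_of_hasCompactSupport ?_ hφ.continuous hc).const_mul _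
    exact (EuclideanSpace.proj (𝕜 := ℝ) i).integrable_comp hGi
  · intro i _
    refine (integrable_mul_of_hasCompactSupport hui (c1 _) ?_).const_mul _
    exact (hc.fderiv_apply (𝕜 := ℝ) _)

/-- Weak gradients are unique up to null sets. -/
theorem IsWeakGradient.ae_eq (ho : IsOpen Ω) (hb : Bornology.IsBounded Ω)
    {u' : EuclideanSpace ℝ (Fin d) → ℝ} (huu : u =ᵐ[volume.restrict Ω] u')
    {G' : EuclideanSpace ℝ (Fin d) → EuclideanSpace ℝ (Fin d)}
    (hG : IsWeakGradient Ω u G) (hG' : IsWeakGradient Ω u' G') :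
    G =ᵐ[volume.restrict Ω] G' := by
  have hGi := integrableOn_of_memLp_two hb hG.1
  have hGi' := integrableOn_of_memLp_two hb hG'.1
  have key : ∀ i, ∀ᵐ x, x ∈ Ω → G x i - G' x i = 0 := by
    intro i
    have hi : IntegrableOn (fun x => G x i) Ω := (EuclideanSpace.proj (𝕜 := ℝ) i).integrable_comp hGi
    have hi' : IntegrableOn (fun x => G' x i) Ω :=
      (EuclideanSpace.proj (𝕜 := ℝ) i).integrable_comp hGi'
    refine ho.ae_eq_zero_of_integral_contDiff_smul_eq_zero (hi.sub hi').locallyIntegrableOn ?_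
    intro φ hφ hc hs
    have h1 := hG.2 φ hφ hc hs i
    have h2 := hG'.2 φ hφ hc hs i
    have h3 : ∫ x in Ω, u x * fderiv ℝ φ x (EuclideanSpace.single i 1) =
        ∫ x in Ω, u' x * fderiv ℝ φ x (EuclideanSpace.single i 1) := by
      refine integral_congr_ae ?_
      filter_upwards [huu] with x hx
      rw [hx]
    rw [← setIntegral_eq_integral_of_forall_compl_eq_zero (s := Ω)]
    · have : ∀ x, φ x • (G x i - G' x i) = G x i * φ x - G' x i * φ x := by
        intro x; simp; ring
      simp_rw [this]
      rw [integral_sub (integrable_mul_of_hasCompactSupport hi hφ.continuous hc)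
        (integrable_mul_of_hasCompactSupport hi' hφ.continuous hc)]
      linarith
    · intro x hx
      have : φ x = 0 := image_eq_zero_of_notMem_tsupport fun hx' => hx (hs hx')
      simp [this]
  rw [EventuallyEq, ae_restrict_iff' ho.measurableSet]
  filter_upwards [ae_all_iff.2 key] with x hx hxΩ
  ext i
  exact sub_eq_zero.1 (hx i hxΩ)

theorem IsWeakGradient.congr {u' : EuclideanSpace ℝ (Fin d) → ℝ}
    {G' : EuclideanSpace ℝ (Fin d) → EuclideanSpace ℝ (Fin d)}
    (hG : IsWeakGradient Ω u G) (hu : u =ᵐ[volume.restrict Ω] u')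
    (hGG : G =ᵐ[volume.restrict Ω] G') : IsWeakGradient Ω u' G' := by
  refine ⟨hG.1.ae_eq hGG, fun φ hφ hc hs i => ?_⟩
  have h3 : ∫ x in Ω, u x * fderiv ℝ φ x (EuclideanSpace.single i 1) =
      ∫ x in Ω, u' x * fderiv ℝ φ x (EuclideanSpace.single i 1) := by
    refine integral_congr_ae ?_
    filter_upwards [hu] with x hx
    rw [hx]
  have h4 : ∫ x in Ω, G x i * φ x = ∫ x in Ω, G' x i * φ x := by
    refine integral_congr_ae ?_
    filter_upwards [hGG] with x hx
    rw [hx]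
  rw [← h3, ← h4, hG.2 φ hφ hc hs i]

end CEM

/-! ### Increments of Sobolev functions along segments -/

namespace CEM
variable {d : ℕ} {Ω : Set (EuclideanSpace ℝ (Fin d))} {u : EuclideanSpace ℝ (Fin d) → ℝ}
  {G : EuclideanSpace ℝ (Fin d) → EuclideanSpace ℝ (Fin d)}

theorem hasCompactSupport_comp_sub {φ : EuclideanSpace ℝ (Fin d) → ℝ} (hc : HasCompactSupport φ)
    (k : EuclideanSpace ℝ (Fin d)) : HasCompactSupport fun x => φ (x - k) :=
  hc.comp_homeomorph (Homeomorph.subRight k)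

theorem tsupport_comp_sub_subset {φ : EuclideanSpace ℝ (Fin d) → ℝ}
    (k : EuclideanSpace ℝ (Fin d)) :
    tsupport (fun x => φ (x - k)) ⊆ {x | x - k ∈ tsupport φ} := by
  have := tsupport_comp_subset_preimage φ (f := fun x : EuclideanSpace ℝ (Fin d) => x - k)
    (by fun_prop)
  exact this

theorem sub_eq_neg_integral_fderiv {φ : EuclideanSpace ℝ (Fin d) → ℝ} (hφ : ContDiff ℝ ∞ φ)
    (x h : EuclideanSpace ℝ (Fin d)) :
    φ (x - h) - φ x = - ∫ t in Set.Icc (0 : ℝ) 1, fderiv ℝ φ (x - t • h) h := by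
  have hd : ∀ t ∈ Set.uIcc (0 : ℝ) 1, HasDerivAt (fun t : ℝ => φ (x - t • h))
      (-(fderiv ℝ φ (x - t • h) h)) t := by
    intro t _
    have h1 : HasDerivAt (fun t : ℝ => x - t • h) (-h) t := by
      have := ((hasDerivAt_id t).smul_const h).const_sub x
      simpa using this
    have h2 := ((hφ.differentiable (by simp)) (x - t • h)).hasFDerivAt.comp_hasDerivAt t h1
    rw [map_neg] at h2
    exact h2
  have h2 := intervalIntegral.integral_eq_sub_of_hasDerivAt hd (by
    apply Continuous.intervalIntegrable
    have := hφ.continuous_fderiv (by simp)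
    exact ((this.comp (by fun_prop : Continuous fun t : ℝ => x - t • h)).clm_apply
      continuous_const).neg)
  rw [intervalIntegral.integral_neg, intervalIntegral.integral_of_le zero_le_one,
    ← integral_Icc_eq_integral_Ioc] at h2
  rw [h2]; simp

/-- Inside a convex open subset of `Ω`, the increments of an `H¹` function are the integrals of
its weak gradient along segments. -/
theorem IsWeakGradient.increment_eq (hb : Bornology.IsBounded Ω)
    (hu : MemLp u 2 (volume.restrict Ω))
    (hG : IsWeakGradient Ω u G) (hGm : StronglyMeasurable G)
    {D : Set (EuclideanSpace ℝ (Fin d))} (hDo : IsOpen D) (hDc : Convex ℝ D) (hD : D ⊆ Ω)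
    (h : EuclideanSpace ℝ (Fin d)) :
    ∀ᵐ x, x ∈ D → x + h ∈ D →
      u (x + h) - u x = ∫ t in Set.Icc (0 : ℝ) 1, inner ℝ h (G (x + t • h)) := by
  set ν : Measure ℝ := volume.restrict (Set.Icc (0 : ℝ) 1) with hν
  have : IsFiniteMeasure ν := ⟨by simp [hν]⟩
  have hui : IntegrableOn u D := (integrableOn_of_memLp_two hb hu).mono_set hD
  have hGi : IntegrableOn G D := (integrableOn_of_memLp_two hb hG.1).mono_set hD
  -- extended by zero, `u` and `⟪h, G⟫` can be integrated over the whole space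
  set g : EuclideanSpace ℝ (Fin d) → ℝ := D.indicator fun x => inner ℝ h (G x) with hg
  set v : EuclideanSpace ℝ (Fin d) → ℝ := D.indicator u with hv
  have hvi : Integrable v := hui.integrable_indicator hDo.measurableSet
  have hgi : Integrable g := IntegrableOn.integrable_indicator (hGi.const_inner h) hDo.measurableSet
  have hgm : StronglyMeasurable g :=
    ((stronglyMeasurable_const (b := h)).inner (𝕜 := ℝ) hGm).indicator hDo.measurableSet
  have hgt : ∀ k, Integrable fun x => g (x + k) := fun k => hgi.comp_add_right k
  have hFm : StronglyMeasurable fun p : EuclideanSpace ℝ (Fin d) × ℝ => g (p.1 + p.2 • h) :=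
    hgm.comp_measurable (by fun_prop)
  have hFi : Integrable (fun p : EuclideanSpace ℝ (Fin d) × ℝ => g (p.1 + p.2 • h))
      (volume.prod ν) := by
    rw [integrable_prod_iff' hFm.aestronglyMeasurable]
    refine ⟨Eventually.of_forall fun t => hgt (t • h), ?_⟩
    have : ∀ t : ℝ, ∫ x, ‖g (x + t • h)‖ = ∫ x, ‖g x‖ := fun t =>
      integral_add_right_eq_self (fun x => ‖g x‖) (t • h)
    simp only [this]
    exact integrable_const _
  set w : EuclideanSpace ℝ (Fin d) → ℝ := fun x => ∫ t, g (x + t • h) ∂ν with hw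
  have hwi : Integrable w := hFi.integral_prod_left
  have hEo : IsOpen (D ∩ {x | x + h ∈ D}) :=
    hDo.inter (hDo.preimage (by fun_prop : Continuous fun x : EuclideanSpace ℝ (Fin d) => x + h))
  have hfi : Integrable fun x => (v (x + h) - v x) - w x :=
    ((hvi.comp_add_right h).sub hvi).sub hwi
  -- it suffices to test the identity against functions supported where both `x` and `x + h` are in `D`
  have key : ∀ φ : EuclideanSpace ℝ (Fin d) → ℝ, ContDiff ℝ ∞ φ → HasCompactSupport φ →
      tsupport φ ⊆ D ∩ {x | x + h ∈ D} → ∫ x, φ x • ((v (x + h) - v x) - w x) = 0 := by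
    intro φ hφ hc hs
    have hφt : ∀ t : ℝ, ContDiff ℝ ∞ fun x => φ (x - t • h) := fun t =>
      hφ.comp (contDiff_id.sub contDiff_const)
    have hst : ∀ t ∈ Set.Icc (0 : ℝ) 1, tsupport (fun x => φ (x - t • h)) ⊆ D := by
      intro t ht x hx
      have h1 := hs (tsupport_comp_sub_subset _ hx)
      have h2 := hDc h1.1 h1.2 (sub_nonneg.2 ht.2) ht.1 (by ring)
      convert h2 using 1
      module
    -- the weak formulation for the translated test functions
    have hweak : ∀ t ∈ Set.Icc (0 : ℝ) 1,
        ∫ x, v x * fderiv ℝ φ (x - t • h) h = - ∫ x, g (x + t • h) * φ x := by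
      intro t ht
      have h1 := hG.integral_mul_fderiv hb hu (hφt t) (hasCompactSupport_comp_sub hc _)
        ((hst t ht).trans hD) h
      have h2 : ∀ x, fderiv ℝ (fun x => φ (x - t • h)) x = fderiv ℝ φ (x - t • h) := fun x =>
        fderiv_comp_sub (𝕜 := ℝ) (t • h)
      have h0 : ∀ x, x ∉ D → φ (x - t • h) = 0 := fun x hx =>
        image_eq_zero_of_notMem_tsupport (f := fun x => φ (x - t • h)) fun hx' => hx (hst t ht hx')
      have h0' : ∀ x, x ∉ D → fderiv ℝ φ (x - t • h) h = 0 := fun x hx => by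
        rw [← h2]
        have : x ∉ tsupport (fderiv ℝ fun x => φ (x - t • h)) := fun hx' =>
          hx (hst t ht (tsupport_fderiv_subset ℝ hx'))
        rw [image_eq_zero_of_notMem_tsupport this]; rfl
      simp_rw [h2] at h1
      have h3 : ∫ x, v x * fderiv ℝ φ (x - t • h) h
          = ∫ x in Ω, u x * fderiv ℝ φ (x - t • h) h := by
        rw [← setIntegral_eq_integral_of_forall_compl_eq_zero (s := Ω)
          (f := fun x => v x * fderiv ℝ φ (x - t • h) h)]
        · congr 1; ext x
          by_cases hx : x ∈ D
          · simp [hv, hx]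
          · simp [h0' x hx]
        · intro x hx
          simp [h0' x fun h => hx (hD h)]
      have h4 : ∫ x, g (x + t • h) * φ x = ∫ x in Ω, inner ℝ h (G x) * φ (x - t • h) := by
        rw [← integral_sub_right_eq_self (fun x => g (x + t • h) * φ x) (t • h),
          ← setIntegral_eq_integral_of_forall_compl_eq_zero (s := Ω)]
        · congr 1; ext x
          by_cases hx : x ∈ D
          · simp [hg, hx]
          · simp [h0 x hx]
        · intro x hx
          simp [h0 x fun h => hx (hD h)]
      rw [h3, h4, h1]
    have hφv : ∀ k, Integrable fun x => φ (x - k) * v x := fun k => by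
      simpa only [mul_comm, Function.comp] using integrable_mul_of_hasCompactSupport hvi
        (hφ.continuous.comp (by fun_prop : Continuous fun x : EuclideanSpace ℝ (Fin d) => x - k))
        (hasCompactSupport_comp_sub hc k)
    -- Fubini, the translated weak formulation, and the fundamental theorem of calculus for `φ`
    have e1 : ∫ x, φ x * w x = ∫ t, (∫ x, g (x + t • h) * φ x) ∂ν := by
      have : ∀ x, φ x * w x = ∫ t, g (x + t • h) * φ x ∂ν := fun x => by
        rw [integral_mul_const, mul_comm]
      simp_rw [this]
      refine integral_integral_swap ?_
      obtain ⟨C, hC⟩ := hc.exists_bound_of_continuous hφ.continuous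
      exact hFi.mul_bdd (c := C) (hφ.continuous.comp continuous_fst).aestronglyMeasurable
        (Eventually.of_forall fun p => hC p.1)
    have e2 : ∫ t, (∫ x, g (x + t • h) * φ x) ∂ν
        = ∫ x, v x * - ∫ t, fderiv ℝ φ (x - t • h) h ∂ν := by
      have h1 : ∫ t, (∫ x, g (x + t • h) * φ x) ∂ν
          = ∫ t, (∫ x, -(v x * fderiv ℝ φ (x - t • h) h)) ∂ν := by
        refine setIntegral_congr_fun measurableSet_Icc fun t ht => ?_
        rw [integral_neg, hweak t ht, neg_neg]
      rw [h1]
      have hcf : Continuous fun x => fderiv ℝ φ x h :=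
        (hφ.continuous_fderiv (by simp)).clm_apply continuous_const
      obtain ⟨C, hC⟩ := (hc.fderiv_apply (𝕜 := ℝ) h).exists_bound_of_continuous hcf
      rw [integral_integral_swap]
      · congr 1; ext x
        rw [integral_neg, integral_const_mul, mul_neg]
      · refine Integrable.neg ?_
        refine Integrable.mul_bdd (c := C) (hvi.comp_snd ν) ?_ (Eventually.of_forall fun p => hC _)
        exact (hcf.comp (by fun_prop : Continuous fun p : ℝ × EuclideanSpace ℝ (Fin d) =>
          p.2 - p.1 • h)).aestronglyMeasurable
    have hsub : ∀ x, - ∫ t, fderiv ℝ φ (x - t • h) h ∂ν = φ (x - h) - φ x := fun x =>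
      (sub_eq_neg_integral_fderiv hφ x h).symm
    simp only [hsub] at e2
    have e3 : ∫ x, φ x * v (x + h) = ∫ x, φ (x - h) * v x := by
      rw [← integral_sub_right_eq_self (fun x => φ x * v (x + h)) h]
      simp
    have hφv0 : Integrable fun x => φ x * v x := by simpa using hφv 0
    have hφvh : Integrable fun x => φ x * v (x + h) := by
      have := (hφv h).comp_add_right h
      simpa using this
    have hφw : Integrable fun x => φ x * w x := by
      simpa only [mul_comm] using integrable_mul_of_hasCompactSupport hwi hφ.continuous hc
    have hφd : Integrable fun x => φ x * v (x + h) - φ x * v x := hφvh.sub hφv0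
    simp only [smul_eq_mul, mul_sub]
    rw [integral_sub hφd hφw, integral_sub hφvh hφv0, e3, e1, e2]
    have : ∀ x, v x * (φ (x - h) - φ x) = φ (x - h) * v x - φ x * v x := fun x => by ring
    simp_rw [this]
    rw [integral_sub (hφv h) hφv0, sub_self]
  have hae := hEo.ae_eq_zero_of_integral_contDiff_smul_eq_zero (hfi.locallyIntegrable.locallyIntegrableOn _)
    key
  filter_upwards [hae] with x hx hxD hxh
  have h1 := hx ⟨hxD, hxh⟩
  have h2 : w x = ∫ t in Set.Icc (0 : ℝ) 1, inner ℝ h (G (x + t • h)) := by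
    refine setIntegral_congr_fun measurableSet_Icc fun t ht => ?_
    have : x + t • h ∈ D := by
      have h2 := hDc hxD hxh (sub_nonneg.2 ht.2) ht.1 (by ring)
      convert h2 using 1
      module
    simp [hg, this]
  simp only [hv, Set.indicator_of_mem hxD, Set.indicator_of_mem hxh] at h1
  rw [← h2]; linarith

end CEM

/-! ### The Poincaré inequality on convex sets -/

namespace CEM
variable {d : ℕ} {Ω : Set (EuclideanSpace ℝ (Fin d))} {u : EuclideanSpace ℝ (Fin d) → ℝ}
  {G : EuclideanSpace ℝ (Fin d) → EuclideanSpace ℝ (Fin d)}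

/-- Jensen's inequality for the square of the deviation of an average from a constant. -/
theorem enorm_average_sub_sq_le {α : Type*} [MeasurableSpace α] {μ : Measure α}
    [IsFiniteMeasure μ] [NeZero μ] {f : α → ℝ} (hf : Integrable f μ) (c : ℝ) :
    ‖⨍ y, f y ∂μ - c‖ₑ ^ 2 ≤ (μ Set.univ)⁻¹ * ∫⁻ y, ‖f y - c‖ₑ ^ 2 ∂μ := by
  have h0 : μ Set.univ ≠ 0 := by simpa using NeZero.ne μ
  have hp : ((μ Set.univ)⁻¹ • μ) Set.univ = 1 := by
    simp
  have : IsProbabilityMeasure ((μ Set.univ)⁻¹ • μ) := ⟨hp⟩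
  have hf' : Integrable f ((μ Set.univ)⁻¹ • μ) := hf.smul_measure (by simpa using h0)
  have h1 : ⨍ y, f y ∂μ - c = ∫ y, (f y - c) ∂((μ Set.univ)⁻¹ • μ) := by
    rw [integral_sub hf' (integrable_const c), integral_const, probReal_univ, one_smul]
    rfl
  rw [h1]
  refine (enorm_integral_sq_le _ _).trans ?_
  rw [hp, one_mul, lintegral_smul_measure, smul_eq_mul]

theorem volume_preimage_add_smul_le (D : Set (EuclideanSpace ℝ (Fin d)))
    (z : EuclideanSpace ℝ (Fin d)) {t : ℝ} (ht : 1 / 2 ≤ |t|) :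
    volume {h | z + t • h ∈ D} ≤ 2 ^ d * volume D := by
  have ht0 : t ≠ 0 := by rintro rfl; norm_num at ht
  have h1 : {h | z + t • h ∈ D} = (fun h => t • h) ⁻¹' ((fun h => z + h) ⁻¹' D) := rfl
  rw [h1, Measure.addHaar_preimage_smul _ ht0, measure_preimage_add, finrank_euclideanSpace_fin]
  gcongr
  rw [← ENNReal.ofReal_ofNat 2, ← ENNReal.ofReal_pow (by norm_num)]
  apply ENNReal.ofReal_le_ofReal
  rw [← inv_pow, abs_pow, abs_inv]
  gcongr
  exact inv_le_of_inv_le₀ (by norm_num) (by simpa using ht)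

/-- The symmetric form of the Poincaré inequality on convex sets. After the shift
`z = x + t (y - x)` the pairs `(x, y)` passing through `z` at time `t` are controlled by the
farther of the two endpoints, which costs the factor `2 ^ d`. -/
theorem IsWeakGradient.lintegral_sub_sq_le (hb : Bornology.IsBounded Ω)
    (hu : MemLp u 2 (volume.restrict Ω)) (hum : StronglyMeasurable u)
    (hG : IsWeakGradient Ω u G) (hGm : StronglyMeasurable G)
    {D : Set (EuclideanSpace ℝ (Fin d))} (hDo : IsOpen D) (hDc : Convex ℝ D) (hD : D ⊆ Ω)
    {ρ : ENNReal} (hρ : ∀ x ∈ D, ∀ y ∈ D, ‖x - y‖ₑ ≤ ρ) :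
    ∫⁻ x in D, ∫⁻ y in D, ‖u y - u x‖ₑ ^ 2 ≤
      ρ ^ 2 * (2 ^ d * volume D) * ∫⁻ x in D, ‖G x‖ₑ ^ 2 := by
  set χ : EuclideanSpace ℝ (Fin d) → ENNReal := D.indicator 1 with hχ
  have hχm : Measurable χ := measurable_one.indicator hDo.measurableSet
  have hχ1 : ∀ x, x ∈ D → χ x = 1 := fun x hx => by simp [hχ, hx]
  have hχ0 : ∀ x, x ∉ D → χ x = 0 := fun x hx => by simp [hχ, hx]
  have hχle : ∀ x, χ x ≤ 1 := fun x => by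
    by_cases hx : x ∈ D
    · rw [hχ1 x hx]
    · rw [hχ0 x hx]; simp
  have hgm : Measurable fun x => ‖G x‖ₑ := hGm.enorm
  have hum' : Measurable u := hum.measurable
  have hset : ∀ f : EuclideanSpace ℝ (Fin d) → ENNReal, ∫⁻ x in D, f x = ∫⁻ x, χ x * f x := by
    intro f
    rw [← lintegral_indicator hDo.measurableSet]
    congr 1; ext x
    by_cases hx : x ∈ D
    · simp [hχ, hx]
    · simp [hχ, hx]
  set ν : Measure ℝ := volume.restrict (Set.Icc (0 : ℝ) 1) with hν
  have hν1 : ν Set.univ = 1 := by simp [hν]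
  have : IsFiniteMeasure ν := ⟨by simp [hν]⟩
  -- one of `t` and `1 - t` is at least `1 / 2`, so one of the two constraints on `h` suffices
  have hvol : ∀ t ∈ Set.Icc (0 : ℝ) 1, ∀ z : EuclideanSpace ℝ (Fin d),
      ∫⁻ h, χ (z - t • h) * χ (z + (1 - t) • h) ≤ 2 ^ d * volume D := by
    intro t ht z
    have hs : ∀ s : ℝ, 1 / 2 ≤ |s| → ∫⁻ h, χ (z + s • h) ≤ 2 ^ d * volume D := by
      intro s hs
      refine le_trans (le_of_eq ?_) (volume_preimage_add_smul_le D z hs)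
      have hm : MeasurableSet {h | z + s • h ∈ D} :=
        (hDo.preimage (by fun_prop : Continuous fun h => z + s • h)).measurableSet
      rw [← lintegral_indicator_one hm]
      rfl
    rcases le_total (1 / 2) t with h | h
    · refine le_trans (lintegral_mono fun h => ?_) (hs (-t) (by rw [abs_neg, abs_of_nonneg ht.1]; exact h))
      rw [neg_smul, ← sub_eq_add_neg]
      exact mul_le_of_le_one_right' (hχle _)
    · refine le_trans (lintegral_mono fun h => ?_) (hs (1 - t)
        (by rw [abs_of_nonneg (by linarith [ht.2])]; linarith))
      exact mul_le_of_le_one_left' (hχle _)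
  calc ∫⁻ x in D, ∫⁻ y in D, ‖u y - u x‖ₑ ^ 2
      = ∫⁻ x, ∫⁻ h, χ x * (χ (x + h) * ‖u (x + h) - u x‖ₑ ^ 2) := by
        rw [hset]
        refine lintegral_congr fun x => ?_
        rw [hset, ← lintegral_const_mul _ (by fun_prop)]
        exact (lintegral_add_left_eq_self
          (fun y => χ x * (χ y * ‖u y - u x‖ₑ ^ 2)) x).symm
    _ = ∫⁻ h, ∫⁻ x, χ x * (χ (x + h) * ‖u (x + h) - u x‖ₑ ^ 2) := by
        refine lintegral_lintegral_swap ?_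
        simp only [Function.uncurry_def]
        fun_prop
    _ ≤ ∫⁻ h, ∫⁻ x, ∫⁻ t, χ x * (χ (x + h) * (‖h‖ₑ ^ 2 * ‖G (x + t • h)‖ₑ ^ 2)) ∂ν := by
        refine lintegral_mono fun h => lintegral_mono_ae ?_
        filter_upwards [hG.increment_eq hb hu hGm hDo hDc hD h] with x hx
        by_cases hxD : x ∈ D
        swap
        · simp [hχ0 x hxD]
        by_cases hxh : x + h ∈ D
        swap
        · simp [hχ0 _ hxh]
        simp only [hχ1 x hxD, hχ1 _ hxh, one_mul]
        rw [hx hxD hxh]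
        refine (enorm_integral_sq_le _ _).trans ?_
        rw [← hν, hν1, one_mul]
        refine lintegral_mono fun t => ?_
        rw [← mul_pow]
        gcongr
        rw [enorm_eq_nnnorm, enorm_eq_nnnorm, enorm_eq_nnnorm]
        exact_mod_cast nnnorm_inner_le_nnnorm (𝕜 := ℝ) h (G (x + t • h))
    _ = ∫⁻ h, ∫⁻ t, (∫⁻ x, χ x * (χ (x + h) * (‖h‖ₑ ^ 2 * ‖G (x + t • h)‖ₑ ^ 2))) ∂ν := by
        refine lintegral_congr fun h => lintegral_lintegral_swap ?_
        simp only [Function.uncurry_def]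
        have : Measurable fun p : EuclideanSpace ℝ (Fin d) × ℝ => ‖G (p.1 + p.2 • h)‖ₑ :=
          hgm.comp (by fun_prop)
        fun_prop
    _ ≤ ∫⁻ h, ∫⁻ t, (∫⁻ z, ρ ^ 2 * (χ z * ‖G z‖ₑ ^ 2) *
          (χ (z - t • h) * χ (z + (1 - t) • h))) ∂ν := by
        refine lintegral_mono fun h => setLIntegral_mono' measurableSet_Icc fun t ht => ?_
        rw [← lintegral_sub_right_eq_self _ (t • h)]
        refine lintegral_mono fun z => ?_
        have e : z - t • h + h = z + (1 - t) • h := by module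
        simp only [e, sub_add_cancel]
        by_cases h1 : z - t • h ∈ D
        swap
        · simp [hχ0 _ h1]
        by_cases h2 : z + (1 - t) • h ∈ D
        swap
        · simp [hχ0 _ h2]
        have h3 : z ∈ D := by
          have h2 := hDc h1 h2 (sub_nonneg.2 ht.2) ht.1 (by ring)
          convert h2 using 1
          module
        simp only [hχ1 _ h1, hχ1 _ h2, hχ1 _ h3, one_mul, mul_one]
        gcongr
        have := hρ _ h2 _ h1
        convert this using 2
        module
    _ = ∫⁻ t, (∫⁻ h, ∫⁻ z, ρ ^ 2 * (χ z * ‖G z‖ₑ ^ 2) *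
          (χ (z - t • h) * χ (z + (1 - t) • h))) ∂ν := by
        refine lintegral_lintegral_swap ?_
        refine Measurable.aemeasurable ?_
        refine Measurable.lintegral_prod_right' (f := fun p : (EuclideanSpace ℝ (Fin d) × ℝ) ×
          EuclideanSpace ℝ (Fin d) => ρ ^ 2 * (χ p.2 * ‖G p.2‖ₑ ^ 2) *
          (χ (p.2 - p.1.2 • p.1.1) * χ (p.2 + (1 - p.1.2) • p.1.1))) ?_
        have : Measurable fun p : (EuclideanSpace ℝ (Fin d) × ℝ) ×
          EuclideanSpace ℝ (Fin d) => ‖G p.2‖ₑ := hgm.comp measurable_snd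
        fun_prop
    _ = ∫⁻ t, (∫⁻ z, ∫⁻ h, ρ ^ 2 * (χ z * ‖G z‖ₑ ^ 2) *
          (χ (z - t • h) * χ (z + (1 - t) • h))) ∂ν := by
        refine lintegral_congr fun t => lintegral_lintegral_swap ?_
        simp only [Function.uncurry_def]
        have : Measurable fun p : EuclideanSpace ℝ (Fin d) × EuclideanSpace ℝ (Fin d) => ‖G p.2‖ₑ :=
          hgm.comp measurable_snd
        fun_prop
    _ ≤ ∫⁻ t, (∫⁻ z, ρ ^ 2 * (χ z * ‖G z‖ₑ ^ 2) * (2 ^ d * volume D)) ∂ν := by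
        refine setLIntegral_mono' measurableSet_Icc fun t ht => lintegral_mono fun z => ?_
        rw [lintegral_const_mul _ (by fun_prop)]
        gcongr
        exact hvol t ht z
    _ = ρ ^ 2 * (2 ^ d * volume D) * ∫⁻ x in D, ‖G x‖ₑ ^ 2 := by
        rw [lintegral_const, hν1, mul_one, lintegral_mul_const _ (by fun_prop),
          lintegral_const_mul _ (by fun_prop), ← hset]
        ring

/-- The **Poincaré inequality** on a convex open subset `D` of `Ω`, with constant
`2 ^ d (diam D) ^ 2`. -/
theorem IsWeakGradient.poincare (hb : Bornology.IsBounded Ω)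
    (hu : MemLp u 2 (volume.restrict Ω)) (hG : IsWeakGradient Ω u G)
    {D : Set (EuclideanSpace ℝ (Fin d))} (hDo : IsOpen D) (hDc : Convex ℝ D) (hD : D ⊆ Ω)
    {ρ : ENNReal} (hρ : ∀ x ∈ D, ∀ y ∈ D, ‖x - y‖ₑ ≤ ρ) :
    ∫⁻ x in D, ‖u x - ⨍ y in D, u y‖ₑ ^ 2 ≤ 2 ^ d * ρ ^ 2 * ∫⁻ x in D, ‖G x‖ₑ ^ 2 := by
  rcases D.eq_empty_or_nonempty with rfl | hne
  · simp
  set u' := hu.1.mk u with hu'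
  set G' := hG.1.1.mk G with hG'
  have huu : u =ᵐ[volume.restrict Ω] u' := hu.1.ae_eq_mk
  have hGG : G =ᵐ[volume.restrict Ω] G' := hG.1.1.ae_eq_mk
  have hr : volume.restrict D ≤ volume.restrict Ω := Measure.restrict_mono hD le_rfl
  have hle := (hG.congr huu hGG).lintegral_sub_sq_le hb (hu.ae_eq huu)
    hu.1.stronglyMeasurable_mk hG.1.1.stronglyMeasurable_mk hDo hDc hD hρ
  have huD : u =ᵐ[volume.restrict D] u' := huu.filter_mono (ae_mono hr)
  have hGD : G =ᵐ[volume.restrict D] G' := hGG.filter_mono (ae_mono hr)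
  have e1 : ∫⁻ x in D, ‖G x‖ₑ ^ 2 = ∫⁻ x in D, ‖G' x‖ₑ ^ 2 :=
    lintegral_congr_ae (hGD.mono fun x hx => by simp only [hx])
  have e2 : ∫⁻ x in D, ‖u x - ⨍ y in D, u y‖ₑ ^ 2 = ∫⁻ x in D, ‖u' x - ⨍ y in D, u' y‖ₑ ^ 2 := by
    rw [average_congr huD]
    exact lintegral_congr_ae (huD.mono fun x hx => by simp only [hx])
  rw [e1, e2]
  have hv0 : volume D ≠ 0 := (hDo.measure_pos volume hne).ne'
  have hvt : volume D ≠ ⊤ := (hb.subset hD).measure_lt_top.ne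
  have hui : IntegrableOn u' D := (integrableOn_of_memLp_two hb (hu.ae_eq huu)).mono_set hD
  have hpt : ∀ x, ‖u' x - ⨍ y in D, u' y‖ₑ ^ 2 ≤
      (volume D)⁻¹ * ∫⁻ y in D, ‖u' y - u' x‖ₑ ^ 2 := by
    intro x
    have : NeZero (volume.restrict D) := ⟨by simpa using hv0⟩
    have : IsFiniteMeasure (volume.restrict D) := ⟨by simpa using hvt.lt_top⟩
    have := enorm_average_sub_sq_le (μ := volume.restrict D) hui (u' x)
    rwa [Measure.restrict_apply_univ, ← enorm_neg, neg_sub] at this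
  calc ∫⁻ x in D, ‖u' x - ⨍ y in D, u' y‖ₑ ^ 2
      ≤ ∫⁻ x in D, (volume D)⁻¹ * ∫⁻ y in D, ‖u' y - u' x‖ₑ ^ 2 := lintegral_mono hpt
    _ = (volume D)⁻¹ * ∫⁻ x in D, ∫⁻ y in D, ‖u' y - u' x‖ₑ ^ 2 :=
        lintegral_const_mul' _ _ (by simpa using hv0)
    _ ≤ (volume D)⁻¹ * (ρ ^ 2 * (2 ^ d * volume D) * ∫⁻ x in D, ‖G' x‖ₑ ^ 2) := by gcongr
    _ = (volume D)⁻¹ * volume D * (2 ^ d * ρ ^ 2 * ∫⁻ x in D, ‖G' x‖ₑ ^ 2) := by ring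
    _ = _ := by rw [ENNReal.inv_mul_cancel hv0 hvt, one_mul]

end CEM

/-! ### Comparing averages over different sets -/

namespace CEM
variable {d : ℕ} {Ω : Set (EuclideanSpace ℝ (Fin d))} {u : EuclideanSpace ℝ (Fin d) → ℝ}
  {G : EuclideanSpace ℝ (Fin d) → EuclideanSpace ℝ (Fin d)}

theorem enorm_add_sq_le {F : Type*} [NormedAddCommGroup F] (a b : F) :
    ‖a + b‖ₑ ^ 2 ≤ 2 * (‖a‖ₑ ^ 2 + ‖b‖ₑ ^ 2) := by
  have h := ENNReal.rpow_add_le_mul_rpow_add_rpow ‖a‖ₑ ‖b‖ₑ (p := 2) (by norm_num)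
  have h2 : (2 : ℝ) - 1 = 1 := by norm_num
  rw [h2, ENNReal.rpow_one] at h
  have h3 : ‖a + b‖ₑ ^ 2 ≤ (‖a‖ₑ + ‖b‖ₑ) ^ 2 := by gcongr; exact enorm_add_le _ _
  refine h3.trans ?_
  simpa only [ENNReal.rpow_ofNat] using h

theorem enorm_sub_sq_le_of_mid {F : Type*} [NormedAddCommGroup F] (a b c : F) :
    ‖a - c‖ₑ ^ 2 ≤ 2 * (‖a - b‖ₑ ^ 2 + ‖b - c‖ₑ ^ 2) := by
  simpa using enorm_add_sq_le (a - b) (b - c)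

/-- The averages of `u` over a convex open set and over a subset of positive measure differ by
at most the gradient energy on the larger set. -/
theorem IsWeakGradient.average_sub_average_sq_le (hb : Bornology.IsBounded Ω)
    (hu : MemLp u 2 (volume.restrict Ω)) (hG : IsWeakGradient Ω u G)
    {D E : Set (EuclideanSpace ℝ (Fin d))} (hDo : IsOpen D) (hDc : Convex ℝ D) (hD : D ⊆ Ω)
    {ρ : ENNReal} (hρ : ∀ x ∈ D, ∀ y ∈ D, ‖x - y‖ₑ ≤ ρ) (hED : E ⊆ D) (hE : volume E ≠ 0) :
    ‖(⨍ y in E, u y) - ⨍ y in D, u y‖ₑ ^ 2 ≤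
      (volume E)⁻¹ * (2 ^ d * ρ ^ 2 * ∫⁻ x in D, ‖G x‖ₑ ^ 2) := by
  have hEt : volume E < ⊤ := (hb.subset (hED.trans hD)).measure_lt_top
  have : NeZero (volume.restrict E) := ⟨by simpa using hE⟩
  have : IsFiniteMeasure (volume.restrict E) := ⟨by simpa using hEt⟩
  have h1 := enorm_average_sub_sq_le (μ := volume.restrict E)
    ((integrableOn_of_memLp_two hb hu).mono_set (hED.trans hD)) (⨍ y in D, u y)
  rw [Measure.restrict_apply_univ] at h1
  refine h1.trans ?_
  gcongr
  exact (lintegral_mono_set hED).trans (hG.poincare hb hu hDo hDc hD hρ)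

/-- The averages over `D` and `D'` of an `H¹(Ω)` function differ by at most a constant times the
norm of the weak gradient. -/
def MeansComparable (Ω D D' : Set (EuclideanSpace ℝ (Fin d))) : Prop :=
  ∃ C : ENNReal, C ≠ ⊤ ∧ ∀ u G, MemLp u 2 (volume.restrict Ω) → IsWeakGradient Ω u G →
    ‖(⨍ y in D, u y) - ⨍ y in D', u y‖ₑ ^ 2 ≤ C * ∫⁻ x in Ω, ‖G x‖ₑ ^ 2

theorem MeansComparable.symm {D D' : Set (EuclideanSpace ℝ (Fin d))}
    (h : MeansComparable Ω D D') : MeansComparable Ω D' D := by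
  obtain ⟨C, hC, h⟩ := h
  refine ⟨C, hC, fun u G hu hG => ?_⟩
  rw [← enorm_neg, neg_sub]
  exact h u G hu hG

theorem MeansComparable.trans {D D' D'' : Set (EuclideanSpace ℝ (Fin d))}
    (h : MeansComparable Ω D D') (h' : MeansComparable Ω D' D'') : MeansComparable Ω D D'' := by
  obtain ⟨C, hC, h⟩ := h
  obtain ⟨C', hC', h'⟩ := h'
  refine ⟨2 * (C + C'), by finiteness, fun u G hu hG => ?_⟩
  refine (enorm_sub_sq_le_of_mid _ (⨍ y in D', u y) _).trans ?_
  rw [mul_assoc, add_mul]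
  gcongr
  · exact h u G hu hG
  · exact h' u G hu hG

theorem meansComparable_of_subset (hb : Bornology.IsBounded Ω)
    {D E : Set (EuclideanSpace ℝ (Fin d))} (hDo : IsOpen D) (hDc : Convex ℝ D) (hD : D ⊆ Ω)
    (hED : E ⊆ D) (hE : volume E ≠ 0) : MeansComparable Ω E D := by
  obtain ⟨C, hC⟩ := (Metric.isBounded_iff.1 (hb.subset hD))
  refine ⟨(volume E)⁻¹ * (2 ^ d * (ENNReal.ofReal C) ^ 2), ?_, fun u G hu hG => ?_⟩
  · have : (volume E)⁻¹ ≠ ⊤ := by simpa using hE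
    finiteness
  · have hρ : ∀ x ∈ D, ∀ y ∈ D, ‖x - y‖ₑ ≤ ENNReal.ofReal C := fun x hx y hy => by
      rw [← ofReal_norm, ← dist_eq_norm]
      exact ENNReal.ofReal_le_ofReal (hC hx hy)
    refine (hG.average_sub_average_sq_le hb hu hDo hDc hD hρ hED hE).trans ?_
    rw [mul_assoc (volume E)⁻¹]
    gcongr

/-- In a connected domain the averages over any two balls are comparable: the set of centres of
balls comparable with a given one is open and closed. -/
theorem exists_ball_meansComparable (ho : IsOpen Ω) (hconn : IsPreconnected Ω)
    (hb : Bornology.IsBounded Ω) {x₀ : EuclideanSpace ℝ (Fin d)} {r₀ : ℝ} (hr₀ : 0 < r₀)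
    (h₀ : Metric.ball x₀ r₀ ⊆ Ω) {x : EuclideanSpace ℝ (Fin d)} (hx : x ∈ Ω) :
    ∃ r > 0, Metric.ball x r ⊆ Ω ∧
      MeansComparable Ω (Metric.ball x r) (Metric.ball x₀ r₀) := by
  have hsub : ∀ (x y : EuclideanSpace ℝ (Fin d)) (r s : ℝ), 0 < s → Metric.ball x r ⊆ Ω →
      Metric.ball y s ⊆ Metric.ball x r → MeansComparable Ω (Metric.ball y s) (Metric.ball x r) :=
    fun x y r s hs h1 h2 => meansComparable_of_subset hb Metric.isOpen_ball (convex_ball _ _) h1 h2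
      (Metric.measure_ball_pos volume y hs).ne'
  set S : Set (EuclideanSpace ℝ (Fin d)) := {x | ∃ r > 0, Metric.ball x r ⊆ Ω ∧
      MeansComparable Ω (Metric.ball x r) (Metric.ball x₀ r₀)} with hS
  have hSo : IsOpen S := by
    rw [Metric.isOpen_iff]
    rintro y ⟨r, hr, h1, h2⟩
    refine ⟨r, hr, fun z hz => ?_⟩
    obtain ⟨s, hs, hsr⟩ := Metric.isOpen_iff.1 Metric.isOpen_ball z hz
    exact ⟨s, hs, hsr.trans h1, (hsub y z r s hs h1 hsr).trans h2⟩
  refine hconn.subset_of_closure_inter_subset hSo ⟨x₀, h₀ (Metric.mem_ball_self hr₀), ?_⟩ ?_ hx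
  · exact ⟨r₀, hr₀, h₀, hsub _ _ _ _ hr₀ h₀ subset_rfl⟩
  · rintro y ⟨hyc, hyΩ⟩
    obtain ⟨s, hs, hsΩ⟩ := Metric.isOpen_iff.1 ho y hyΩ
    obtain ⟨z, ⟨r, hr, h1, h2⟩, hz⟩ := Metric.mem_closure_iff.1 hyc s hs
    obtain ⟨t, ht, htr⟩ := Metric.isOpen_iff.1
      (Metric.isOpen_ball.inter Metric.isOpen_ball : IsOpen (Metric.ball z r ∩ Metric.ball y s)) z
      ⟨Metric.mem_ball_self hr, by rwa [Metric.mem_ball, dist_comm]⟩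
    refine ⟨s, hs, hsΩ, ?_⟩
    exact ((hsub y z s t ht hsΩ fun w hw => (htr hw).2).symm.trans
      (hsub z z r t ht h1 fun w hw => (htr hw).1)).trans h2

end CEM

/-! ### Hyperplane arrangements and their cells -/

namespace CEM
variable {d : ℕ} {Ω : Set (EuclideanSpace ℝ (Fin d))}

/-- The affine hyperplane `⟪n, x⟫ = b` coded by `h = (n, b)`. -/
def hyperplane (h : EuclideanSpace ℝ (Fin d) × ℝ) : Set (EuclideanSpace ℝ (Fin d)) :=
  {x | inner ℝ h.1 x = h.2}

/-- The open cell of the hyperplane arrangement `H` lying on the positive side of exactly the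
hyperplanes in `T`. -/
def cell (H T : Finset (EuclideanSpace ℝ (Fin d) × ℝ)) : Set (EuclideanSpace ℝ (Fin d)) :=
  {x | ∀ h ∈ H, (h ∈ T → h.2 < inner ℝ h.1 x) ∧ (h ∉ T → inner ℝ h.1 x < h.2)}

open Classical in
/-- The hyperplanes of `H` with `x` on their positive side. -/
noncomputable def positiveSide (H : Finset (EuclideanSpace ℝ (Fin d) × ℝ)) (x : EuclideanSpace ℝ (Fin d)) :
    Finset (EuclideanSpace ℝ (Fin d) × ℝ) :=
  H.filter fun h => h.2 < inner ℝ h.1 x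

open Classical in
/-- The nonempty cells of the arrangement `H` that are contained in `Ω`. -/
noncomputable def innerCells (Ω : Set (EuclideanSpace ℝ (Fin d)))
    (H : Finset (EuclideanSpace ℝ (Fin d) × ℝ)) :
    Finset (Finset (EuclideanSpace ℝ (Fin d) × ℝ)) :=
  H.powerset.filter fun T => (cell H T).Nonempty ∧ cell H T ⊆ Ω

variable {H T : Finset (EuclideanSpace ℝ (Fin d) × ℝ)}

theorem cell_eq_iInter (H T : Finset (EuclideanSpace ℝ (Fin d) × ℝ)) :
    cell H T = ⋂ h ∈ H, {x | (h ∈ T → h.2 < inner ℝ h.1 x) ∧ (h ∉ T → inner ℝ h.1 x < h.2)} := by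
  ext x; simp [cell]

theorem isOpen_cell (H T : Finset (EuclideanSpace ℝ (Fin d) × ℝ)) : IsOpen (cell H T) := by
  rw [cell_eq_iInter]
  refine isOpen_biInter_finset fun h _ => ?_
  by_cases hT : h ∈ T
  · simp only [hT, true_imp_iff, not_true_eq_false, false_imp_iff, and_true]
    exact isOpen_lt continuous_const (by fun_prop)
  · simp only [hT, false_imp_iff, not_false_eq_true, true_imp_iff, true_and]
    exact isOpen_lt (by fun_prop) continuous_const

theorem convex_cell (H T : Finset (EuclideanSpace ℝ (Fin d) × ℝ)) : Convex ℝ (cell H T) := by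
  rw [cell_eq_iInter]
  refine convex_iInter₂ fun h _ => ?_
  have hl : IsLinearMap ℝ fun x : EuclideanSpace ℝ (Fin d) => inner ℝ h.1 x :=
    (innerₛₗ ℝ h.1).isLinear
  by_cases hT : h ∈ T
  · simp only [hT, true_imp_iff, not_true_eq_false, false_imp_iff, and_true]
    exact convex_halfSpace_gt hl _
  · simp only [hT, false_imp_iff, not_false_eq_true, true_imp_iff, true_and]
    exact convex_halfSpace_lt hl _

theorem notMem_hyperplane_of_mem_cell {x : EuclideanSpace ℝ (Fin d)} (hx : x ∈ cell H T) :
    ∀ h ∈ H, x ∉ hyperplane h := by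
  intro h hh he
  by_cases hT : h ∈ T
  · exact ((hx h hh).1 hT).ne' he
  · exact ((hx h hh).2 hT).ne he

theorem mem_cell_positiveSide {x : EuclideanSpace ℝ (Fin d)} (hx : ∀ h ∈ H, x ∉ hyperplane h) :
    x ∈ cell H (positiveSide H x) := by
  intro h hh
  have hne : inner ℝ h.1 x ≠ h.2 := hx h hh
  simp only [positiveSide, Finset.mem_filter, hh, true_and]
  exact ⟨id, fun h' => lt_of_le_of_ne (not_lt.1 h') hne⟩

/-- A connected set avoiding the hyperplanes of `H` lies in a single cell. -/
theorem subset_cell_of_isPreconnected {S : Set (EuclideanSpace ℝ (Fin d))}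
    (hS : IsPreconnected S) (hSH : ∀ x ∈ S, ∀ h ∈ H, x ∉ hyperplane h)
    {y : EuclideanSpace ℝ (Fin d)} (hy : y ∈ S) : S ⊆ cell H (positiveSide H y) := by
  intro x hx h hh
  have hc : ContinuousOn (fun z : EuclideanSpace ℝ (Fin d) => inner ℝ h.1 z) S := by fun_prop
  simp only [positiveSide, Finset.mem_filter, hh, true_and]
  refine ⟨fun h1 => ?_, fun h1 => ?_⟩
  · by_contra h2
    obtain ⟨z, hz, hzh⟩ := hS.intermediate_value hx hy hc ⟨not_lt.1 h2, h1.le⟩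
    exact hSH z hz h hh hzh
  · by_contra h2
    obtain ⟨z, hz, hzh⟩ := hS.intermediate_value hy hx hc ⟨not_lt.1 h1, not_lt.1 h2⟩
    exact hSH z hz h hh hzh

/-- A connected set that meets an open set but not its frontier is contained in it. -/
theorem subset_of_isPreconnected_of_disjoint_frontier {S : Set (EuclideanSpace ℝ (Fin d))}
    (ho : IsOpen Ω) (hS : IsPreconnected S) (hSΩ : (S ∩ Ω).Nonempty)
    (hf : ∀ x ∈ S, x ∉ frontier Ω) : S ⊆ Ω := by
  refine hS.subset_of_closure_inter_subset ho hSΩ ?_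
  rintro x ⟨hxc, hxS⟩
  by_contra hx
  exact hf x hxS (by rw [ho.frontier_eq]; exact ⟨hxc, hx⟩)

theorem cell_subset_of_mem (ho : IsOpen Ω) (hH : frontier Ω ⊆ ⋃ h ∈ H, hyperplane h)
    {x : EuclideanSpace ℝ (Fin d)} (hx : x ∈ cell H T) (hxΩ : x ∈ Ω) : cell H T ⊆ Ω := by
  refine subset_of_isPreconnected_of_disjoint_frontier ho (convex_cell H T).isPreconnected
    ⟨x, hx, hxΩ⟩ fun y hy hyf => ?_
  obtain ⟨h, hh, hyh⟩ := Set.mem_iUnion₂.1 (hH hyf)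
  exact notMem_hyperplane_of_mem_cell hy h hh hyh

theorem positiveSide_mem_innerCells (ho : IsOpen Ω) (hH : frontier Ω ⊆ ⋃ h ∈ H, hyperplane h)
    {x : EuclideanSpace ℝ (Fin d)} (hx : ∀ h ∈ H, x ∉ hyperplane h) (hxΩ : x ∈ Ω) :
    positiveSide H x ∈ innerCells Ω H := by
  classical
  have h1 := mem_cell_positiveSide hx
  simp only [innerCells, Finset.mem_filter, Finset.mem_powerset]
  exact ⟨Finset.filter_subset _ _, ⟨x, h1⟩, cell_subset_of_mem ho hH h1 hxΩ⟩

theorem volume_hyperplane {h : EuclideanSpace ℝ (Fin d) × ℝ} (hh : h.1 ≠ 0) :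
    volume (hyperplane h) = 0 := by
  rcases (hyperplane h).eq_empty_or_nonempty with he | ⟨p, hp⟩
  · simp [he]
  have h1 : hyperplane h = (fun x => x + (-p)) ⁻¹' ((ℝ ∙ h.1)ᗮ : Submodule ℝ _) := by
    ext x
    simp only [Set.mem_preimage, SetLike.mem_coe, Submodule.mem_orthogonal_singleton_iff_inner_right,
      inner_add_right, inner_neg_right]
    have hp' : inner ℝ h.1 p = h.2 := hp
    rw [hp']
    exact ⟨fun hx => by rw [show inner ℝ h.1 x = h.2 from hx]; ring, fun hx => by
      show inner ℝ h.1 x = h.2; linarith⟩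
  rw [h1, measure_preimage_add_right]
  refine Measure.addHaar_submodule _ _ fun htop => hh ?_
  have : h.1 ∈ (ℝ ∙ h.1)ᗮ := by rw [htop]; trivial
  rw [Submodule.mem_orthogonal_singleton_iff_inner_right] at this
  exact inner_self_eq_zero.1 this

theorem exists_mem_notMem_hyperplane {h : EuclideanSpace ℝ (Fin d) × ℝ} (hh : h.1 ≠ 0)
    {S : Set (EuclideanSpace ℝ (Fin d))} (hS : IsOpen S) (hne : S.Nonempty) :
    ∃ x ∈ S, x ∉ hyperplane h := by
  by_contra! hc
  exact (hS.measure_pos volume hne).ne' (measure_mono_null hc (volume_hyperplane hh))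

theorem ae_notMem_hyperplane (hH0 : ∀ h ∈ H, h.1 ≠ 0) :
    ∀ᵐ x : EuclideanSpace ℝ (Fin d), ∀ h ∈ H, x ∉ hyperplane h := by
  refine (eventually_all_finset H).2 fun h hh => ?_
  exact measure_eq_zero_iff_ae_notMem.1 (volume_hyperplane (hH0 h hh))

/-- Near a boundary point lying on a single hyperplane of the arrangement (coded possibly by
several members of `H`), `Ω` coincides with one cell: of the two half balls cut out by this
hyperplane exactly one belongs to `Ω`, because `Ω` is the interior of its closure. -/
theorem exists_ball_inter_eq_cell (ho : IsOpen Ω) (hint : interior (closure Ω) = Ω)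
    (hH0 : ∀ h ∈ H, h.1 ≠ 0) (hH : frontier Ω ⊆ ⋃ h ∈ H, hyperplane h)
    {x : EuclideanSpace ℝ (Fin d)} (hx : x ∈ frontier Ω)
    (hgood : ∀ h ∈ H, ∀ h' ∈ H, x ∈ hyperplane h → x ∈ hyperplane h' →
      hyperplane h = hyperplane h') :
    ∃ T ∈ innerCells Ω H, x ∈ closure (cell H T) ∧
      ∃ r > 0, Metric.ball x r ∩ Ω = Metric.ball x r ∩ cell H T := by
  classical
  obtain ⟨h₀, hh₀, hxh₀⟩ := Set.mem_iUnion₂.1 (hH hx)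
  have hcl : ∀ h : EuclideanSpace ℝ (Fin d) × ℝ, IsClosed (hyperplane h) := fun h =>
    isClosed_eq (by fun_prop) continuous_const
  obtain ⟨r, hr, hrH⟩ : ∃ r > 0, ∀ y ∈ Metric.ball x r, ∀ h ∈ H, y ∈ hyperplane h →
      y ∈ hyperplane h₀ := by
    have hO : IsOpen (⋂ h ∈ H.filter fun h => x ∉ hyperplane h, (hyperplane h)ᶜ) :=
      isOpen_biInter_finset fun h _ => (hcl h).isOpen_compl
    obtain ⟨r, hr, hrO⟩ := Metric.isOpen_iff.1 hO x (by simp)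
    refine ⟨r, hr, fun y hy h hh hyh => ?_⟩
    by_cases hxh : x ∈ hyperplane h
    · rwa [hgood h₀ hh₀ h hh hxh₀ hxh]
    · have := Set.mem_iInter₂.1 (hrO hy) h (Finset.mem_filter.2 ⟨hh, hxh⟩)
      exact absurd hyh this
  set f : EuclideanSpace ℝ (Fin d) → ℝ := fun y => inner ℝ h₀.1 y - h₀.2 with hf
  have hf0 : ∀ y, y ∈ hyperplane h₀ ↔ f y = 0 := fun y => by
    simp [hf, hyperplane, sub_eq_zero]
  have hfc : Continuous f := by fun_prop
  -- the open half ball at `x` that contains `y`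
  set side : EuclideanSpace ℝ (Fin d) → Set (EuclideanSpace ℝ (Fin d)) := fun y =>
    Metric.ball x r ∩ {w | 0 < f y * f w} with hside
  have hconv : ∀ y, IsPreconnected (side y) := by
    intro y
    refine ((convex_ball x r).inter ?_).isPreconnected
    have hl : IsLinearMap ℝ fun w : EuclideanSpace ℝ (Fin d) => f y * inner ℝ h₀.1 w :=
      (f y • innerₛₗ ℝ h₀.1).isLinear
    convert convex_halfSpace_gt hl (f y * h₀.2) using 2
    ext w
    simp only [hf]
    constructor <;> intro h <;> nlinarith
  have havoid : ∀ y, ∀ w ∈ side y, ∀ h ∈ H, w ∉ hyperplane h := by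
    intro y w hw h hh hwh
    have := (hf0 w).1 (hrH w hw.1 h hh hwh)
    have h2 := hw.2
    simp [this] at h2
  have hself : ∀ y ∈ Metric.ball x r, f y ≠ 0 → y ∈ side y := fun y hy h0 =>
    ⟨hy, mul_self_pos.2 h0⟩
  have hsideΩ : ∀ y ∈ Metric.ball x r, y ∈ Ω → f y ≠ 0 → side y ⊆ Ω := by
    intro y hy hyΩ h0
    refine subset_of_isPreconnected_of_disjoint_frontier ho (hconv y) ⟨y, hself y hy h0, hyΩ⟩ ?_
    intro w hw hwf
    obtain ⟨h, hh, hwh⟩ := Set.mem_iUnion₂.1 (hH hwf)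
    exact havoid y w hw h hh hwh
  have hUo : IsOpen (Metric.ball x r ∩ Ω) := Metric.isOpen_ball.inter ho
  have hxc : x ∈ closure (Metric.ball x r ∩ Ω) :=
    Metric.isOpen_ball.inter_closure ⟨Metric.mem_ball_self hr, hx.1⟩
  obtain ⟨y, ⟨hyB, hyΩ⟩, hyh⟩ := exists_mem_notMem_hyperplane (hH0 h₀ hh₀) hUo
    (closure_nonempty_iff.1 ⟨x, hxc⟩)
  have hfy : f y ≠ 0 := fun h => hyh ((hf0 y).2 h)
  have hsub : Metric.ball x r ∩ Ω ⊆ side y := by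
    rintro w ⟨hwB, hwΩ⟩
    refine ⟨hwB, ?_⟩
    by_contra hneg
    simp only [Set.mem_ofPred_eq, not_lt] at hneg
    -- push `w` off the hyperplane, away from `y`
    obtain ⟨w', ⟨hwB', hwΩ'⟩, hneg'⟩ : ∃ w' ∈ Metric.ball x r ∩ Ω, f y * f w' < 0 := by
      have hcont : Continuous fun s : ℝ => w - (s * f y) • h₀.1 := by fun_prop
      have hev : ∀ᶠ s in 𝓝[>] (0 : ℝ), w - (s * f y) • h₀.1 ∈ Metric.ball x r ∩ Ω := by
        refine nhdsWithin_le_nhds (hcont.continuousAt.eventually_mem (hUo.mem_nhds ?_))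
        simpa using ⟨hwB, hwΩ⟩
      obtain ⟨s, hs, hs0⟩ := (hev.and self_mem_nhdsWithin).exists
      refine ⟨_, hs, ?_⟩
      have e : f y * f (w - (s * f y) • h₀.1) = f y * f w - s * (f y ^ 2 * ‖h₀.1‖ ^ 2) := by
        simp only [hf, inner_sub_right, inner_smul_right, real_inner_self_eq_norm_sq]
        ring
      rw [e]
      have : 0 < s * (f y ^ 2 * ‖h₀.1‖ ^ 2) :=
        mul_pos hs0 (mul_pos (by positivity) (pow_pos (norm_pos_iff.2 (hH0 h₀ hh₀)) 2))
      linarith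
    have hfw : f w' ≠ 0 := fun h => by simp [h] at hneg'
    -- `Ω` now meets both half balls, hence contains both, and `x` is interior to its closure
    have hsub : Metric.ball x r ⊆ closure Ω := by
      intro v hv
      rw [mem_closure_iff]
      intro o ho' hvo
      obtain ⟨z, ⟨hzo, hzB⟩, hzh⟩ := exists_mem_notMem_hyperplane (hH0 h₀ hh₀)
        (ho'.inter Metric.isOpen_ball) ⟨v, hvo, hv⟩
      have hfz : f z ≠ 0 := fun h => hzh ((hf0 z).2 h)
      refine ⟨z, hzo, ?_⟩
      rcases (mul_ne_zero hfy hfz).lt_or_gt with h | h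
      · refine hsideΩ w' hwB' hwΩ' hfw ⟨hzB, ?_⟩
        have := mul_pos_of_neg_of_neg hneg' h
        have h3 : f y * f w' * (f y * f z) = f y ^ 2 * (f w' * f z) := by ring
        rw [h3] at this
        exact pos_of_mul_pos_right this (by positivity)
      · exact hsideΩ y hyB hyΩ hfy ⟨hzB, h⟩
    have : x ∈ interior (closure Ω) :=
      mem_interior.2 ⟨_, hsub, Metric.isOpen_ball, Metric.mem_ball_self hr⟩
    rw [hint] at this
    exact (ho.frontier_eq ▸ hx).2 this
  have hyH : ∀ h ∈ H, y ∉ hyperplane h := fun h hh hyh' => hyh (hrH y hyB h hh hyh')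
  have hcellΩ := cell_subset_of_mem ho hH (mem_cell_positiveSide hyH) hyΩ
  have hcell : side y ⊆ cell H (positiveSide H y) :=
    subset_cell_of_isPreconnected (hconv y) (havoid y) (hself y hyB hfy)
  refine ⟨positiveSide H y, positiveSide_mem_innerCells ho hH hyH hyΩ,
    closure_mono (hsub.trans hcell) hxc, r, hr, ?_⟩
  refine Set.Subset.antisymm (fun w hw => ⟨hw.1, hcell (hsub hw)⟩) fun w hw => ⟨hw.1, hcellΩ hw.2⟩

end CEM

/-! ### The surface measure on hyperplanes -/

namespace CEM
variable {d : ℕ} {Ω : Set (EuclideanSpace ℝ (Fin d))}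

theorem finrank_orthogonal_singleton {n : EuclideanSpace ℝ (Fin d)} (hn : n ≠ 0) :
    Module.finrank ℝ (ℝ ∙ n)ᗮ = d - 1 := by
  have h1 := (ℝ ∙ n).finrank_add_finrank_orthogonal
  rw [finrank_span_singleton hn, finrank_euclideanSpace_fin] at h1
  omega

theorem surfaceMeasure_image_add {n : EuclideanSpace ℝ (Fin d)} (hn : n ≠ 0)
    (p : EuclideanSpace ℝ (Fin d)) (S : Set (ℝ ∙ n)ᗮ) :
    surfaceMeasure d ((fun v : (ℝ ∙ n)ᗮ => p + (v : EuclideanSpace ℝ (Fin d))) '' S) =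
      volume S := by
  have hi : Isometry fun v : (ℝ ∙ n)ᗮ => p + (v : EuclideanSpace ℝ (Fin d)) :=
    (IsometryEquiv.addLeft p).isometry.comp isometry_subtype_coe
  rw [surfaceMeasure, hi.euclideanHausdorffMeasure_image, ← finrank_orthogonal_singleton hn,
    InnerProductSpace.euclideanHausdorffMeasure_eq_volume]

theorem sub_mem_orthogonal_of_mem_hyperplane {h : EuclideanSpace ℝ (Fin d) × ℝ}
    {p x : EuclideanSpace ℝ (Fin d)} (hp : p ∈ hyperplane h) (hx : x ∈ hyperplane h) :
    x - p ∈ (ℝ ∙ h.1)ᗮ := by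
  rw [Submodule.mem_orthogonal_singleton_iff_inner_right, inner_sub_right]
  exact sub_eq_zero.2 (Eq.trans hx (Eq.symm hp))

/-- Hyperplanes are upper Ahlfors regular of dimension `d - 1`. -/
theorem surfaceMeasure_hyperplane_inter_ball_le {h : EuclideanSpace ℝ (Fin d) × ℝ}
    (hh : h.1 ≠ 0) : ∃ A : ENNReal, A ≠ ⊤ ∧ ∀ (z : EuclideanSpace ℝ (Fin d)) (r : ℝ), 0 < r →
      surfaceMeasure d (hyperplane h ∩ Metric.ball z r) ≤ A * ENNReal.ofReal r ^ (d - 1) := by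
  refine ⟨2 ^ (d - 1) * volume (Metric.ball (0 : (ℝ ∙ h.1)ᗮ) 1),
    by have := (measure_ball_lt_top (μ := volume) (x := (0 : (ℝ ∙ h.1)ᗮ)) (r := 1)).ne; finiteness,
    fun z r hr => ?_⟩
  rcases (hyperplane h ∩ Metric.ball z r).eq_empty_or_nonempty with he | ⟨p, hp, hpz⟩
  · simp [he]
  have hsub : hyperplane h ∩ Metric.ball z r ⊆
      (fun v : (ℝ ∙ h.1)ᗮ => p + (v : EuclideanSpace ℝ (Fin d))) '' Metric.ball 0 (2 * r) := by
    rintro x ⟨hx, hxz⟩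
    refine ⟨⟨x - p, sub_mem_orthogonal_of_mem_hyperplane hp hx⟩, ?_, by simp⟩
    rw [mem_ball_zero_iff]
    show ‖x - p‖ < 2 * r
    rw [← dist_eq_norm]
    have := dist_triangle_right x p z
    rw [Metric.mem_ball] at hxz hpz
    linarith
  refine (measure_mono hsub).trans ?_
  rw [surfaceMeasure_image_add hh, Measure.addHaar_ball_of_pos _ _ (by positivity),
    finrank_orthogonal_singleton hh, ENNReal.ofReal_pow (by positivity),
    ENNReal.ofReal_mul (by norm_num), mul_pow, ENNReal.ofReal_ofNat]
  exact le_of_eq (by ring)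

/-- Two distinct hyperplanes meet in a set of codimension two, which carries no surface measure. -/
theorem surfaceMeasure_hyperplane_inter_hyperplane {h h' : EuclideanSpace ℝ (Fin d) × ℝ}
    (hh : h.1 ≠ 0) (hh' : h'.1 ≠ 0) (hne : hyperplane h ≠ hyperplane h') :
    surfaceMeasure d (hyperplane h ∩ hyperplane h') = 0 := by
  rcases (hyperplane h ∩ hyperplane h').eq_empty_or_nonempty with he | ⟨p, hp, hp'⟩
  · simp [he]
  set N : Submodule ℝ (ℝ ∙ h.1)ᗮ := (ℝ ∙ h'.1)ᗮ.comap (ℝ ∙ h.1)ᗮ.subtype with hN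
  have hsub : hyperplane h ∩ hyperplane h' ⊆
      (fun v : (ℝ ∙ h.1)ᗮ => p + (v : EuclideanSpace ℝ (Fin d))) '' N := by
    rintro x ⟨hx, hx'⟩
    exact ⟨⟨x - p, sub_mem_orthogonal_of_mem_hyperplane hp hx⟩,
      sub_mem_orthogonal_of_mem_hyperplane hp' hx', by simp⟩
  refine measure_mono_null hsub ?_
  rw [surfaceMeasure_image_add hh]
  refine Measure.addHaar_submodule _ _ fun htop => hne ?_
  have hle : (ℝ ∙ h.1)ᗮ ≤ (ℝ ∙ h'.1)ᗮ := fun v hv => by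
    have : (⟨v, hv⟩ : (ℝ ∙ h.1)ᗮ) ∈ N := by rw [htop]; trivial
    exact this
  have hmem : h'.1 ∈ (ℝ ∙ h.1) := by
    rw [← (ℝ ∙ h.1).orthogonal_orthogonal]
    exact Submodule.orthogonal_le hle
      ((ℝ ∙ h'.1).le_orthogonal_orthogonal (Submodule.mem_span_singleton_self _))
  obtain ⟨c, hc⟩ := Submodule.mem_span_singleton.1 hmem
  have hc0 : c ≠ 0 := by rintro rfl; exact hh' (by rw [← hc, zero_smul])
  have hb : h'.2 = c * h.2 := by
    have h1 : inner ℝ h.1 p = h.2 := hp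
    have h2 : inner ℝ h'.1 p = h'.2 := hp'
    rw [← h1, ← h2, ← hc, real_inner_smul_left]
  ext x
  show inner ℝ h.1 x = h.2 ↔ inner ℝ h'.1 x = h'.2
  rw [hb, ← hc, real_inner_smul_left]
  exact ⟨fun h => by rw [h], fun h => mul_left_cancel₀ hc0 h⟩

variable {H : Finset (EuclideanSpace ℝ (Fin d) × ℝ)}

/-- The surface measure on a piece of a finite union of hyperplanes is upper Ahlfors regular. -/
theorem surfaceMeasure_restrict_ball_le (hH0 : ∀ h ∈ H, h.1 ≠ 0)
    {e : Set (EuclideanSpace ℝ (Fin d))} (he : e ⊆ ⋃ h ∈ H, hyperplane h) :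
    ∃ A : ENNReal, A ≠ ⊤ ∧ ∀ (z : EuclideanSpace ℝ (Fin d)) (r : ℝ), 0 < r →
      (surfaceMeasure d).restrict e (Metric.ball z r) ≤ A * ENNReal.ofReal r ^ (d - 1) := by
  have hA : ∀ h : H, ∃ A : ENNReal, A ≠ ⊤ ∧ ∀ (z : EuclideanSpace ℝ (Fin d)) (r : ℝ), 0 < r →
      surfaceMeasure d (hyperplane h.1 ∩ Metric.ball z r) ≤ A * ENNReal.ofReal r ^ (d - 1) :=
    fun h => surfaceMeasure_hyperplane_inter_ball_le (hH0 h.1 h.2)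
  choose A hA hAle using hA
  refine ⟨∑ h, A h, ENNReal.sum_ne_top.2 fun h _ => hA h, fun z r hr => ?_⟩
  rw [Measure.restrict_apply Metric.isOpen_ball.measurableSet]
  have hsub : Metric.ball z r ∩ e ⊆ ⋃ h : H, hyperplane h.1 ∩ Metric.ball z r := by
    rintro x ⟨hx, hxe⟩
    obtain ⟨h, hh, hxh⟩ := Set.mem_iUnion₂.1 (he hxe)
    exact Set.mem_iUnion.2 ⟨⟨h, hh⟩, hxh, hx⟩
  refine (measure_mono hsub).trans ((measure_iUnion_fintype_le _ _).trans ?_)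
  rw [Finset.sum_mul]
  exact Finset.sum_le_sum fun h _ => hAle h z r hr

theorem surfaceMeasure_lt_top (hH0 : ∀ h ∈ H, h.1 ≠ 0)
    {e : Set (EuclideanSpace ℝ (Fin d))} (hb : Bornology.IsBounded e)
    (he : e ⊆ ⋃ h ∈ H, hyperplane h) : surfaceMeasure d e < ⊤ := by
  obtain ⟨A, hA, hAle⟩ := surfaceMeasure_restrict_ball_le hH0 he
  obtain ⟨r, hr, hre⟩ := hb.subset_ball_lt 0 0
  have h1 := hAle 0 r hr
  rw [Measure.restrict_apply Metric.isOpen_ball.measurableSet, Set.inter_eq_right.2 hre] at h1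
  exact h1.trans_lt (by finiteness)

/-- Almost every point of a finite union of hyperplanes lies on only one of them. -/
theorem ae_restrict_hyperplane_eq (hH0 : ∀ h ∈ H, h.1 ≠ 0)
    (e : Set (EuclideanSpace ℝ (Fin d))) :
    ∀ᵐ x ∂(surfaceMeasure d).restrict e, ∀ h ∈ H, ∀ h' ∈ H, x ∈ hyperplane h →
      x ∈ hyperplane h' → hyperplane h = hyperplane h' := by
  refine ae_restrict_of_ae ((eventually_all_finset H).2 fun h hh =>
    (eventually_all_finset H).2 fun h' hh' => ?_)
  by_cases hne : hyperplane h = hyperplane h'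
  · exact Eventually.of_forall fun _ _ _ => hne
  · have := measure_eq_zero_iff_ae_notMem.1
      (surfaceMeasure_hyperplane_inter_hyperplane (hH0 h hh) (hH0 h' hh') hne)
    filter_upwards [this] with x hx h1 h2
    exact absurd ⟨h1, h2⟩ hx

end CEM

/-! ### The Poincaré inequality on polyhedral domains -/

namespace CEM
variable {d : ℕ} {Ω : Set (EuclideanSpace ℝ (Fin d))} {u : EuclideanSpace ℝ (Fin d) → ℝ}
  {G : EuclideanSpace ℝ (Fin d) → EuclideanSpace ℝ (Fin d)}
  {H : Finset (EuclideanSpace ℝ (Fin d) × ℝ)}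

/-- The polyhedral domain is exhausted, up to a null set, by its inner cells. -/
theorem setLIntegral_le_sum_innerCells (ho : IsOpen Ω) (hH0 : ∀ h ∈ H, h.1 ≠ 0)
    (hH : frontier Ω ⊆ ⋃ h ∈ H, hyperplane h) (f : EuclideanSpace ℝ (Fin d) → ENNReal) :
    ∫⁻ x in Ω, f x ≤ ∑ T ∈ innerCells Ω H, ∫⁻ x in cell H T, f x := by
  have hae : ∀ᵐ x, x ∈ Ω → x ∈ ⋃ T ∈ innerCells Ω H, cell H T := by
    filter_upwards [ae_notMem_hyperplane hH0] with x hx hxΩ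
    exact Set.mem_biUnion (positiveSide_mem_innerCells ho hH hx hxΩ) (mem_cell_positiveSide hx)
  have h1 : volume.restrict Ω ≤ ∑ T ∈ innerCells Ω H, volume.restrict (cell H T) := by
    have h2 : volume.restrict Ω ≤ volume.restrict (⋃ T ∈ innerCells Ω H, cell H T) :=
      Measure.restrict_mono' hae le_rfl
    refine h2.trans ?_
    rw [← Measure.sum_coe_finset]
    refine Measure.le_iff.2 fun s hs => ?_
    rw [Measure.restrict_apply hs, Measure.sum_apply _ hs]
    simp only [Measure.restrict_apply hs]
    rw [tsum_fintype, Set.inter_iUnion₂,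
      Finset.sum_coe_sort (innerCells Ω H) fun T => volume (s ∩ cell H T)]
    exact measure_biUnion_finset_le _ _
  refine (lintegral_mono' h1 le_rfl).trans (le_of_eq ?_)
  rw [lintegral_finsetSum_measure]

theorem mem_innerCells {T : Finset (EuclideanSpace ℝ (Fin d) × ℝ)} (hT : T ∈ innerCells Ω H) :
    (cell H T).Nonempty ∧ cell H T ⊆ Ω := by
  classical
  simp only [innerCells, Finset.mem_filter] at hT
  exact hT.2

theorem meansComparable_cell_ball (ho : IsOpen Ω) (hconn : IsPreconnected Ω)
    (hb : Bornology.IsBounded Ω) {x₀ : EuclideanSpace ℝ (Fin d)} {r₀ : ℝ} (hr₀ : 0 < r₀)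
    (h₀ : Metric.ball x₀ r₀ ⊆ Ω) {T : Finset (EuclideanSpace ℝ (Fin d) × ℝ)}
    (hT : T ∈ innerCells Ω H) : MeansComparable Ω (cell H T) (Metric.ball x₀ r₀) := by
  obtain ⟨⟨x, hx⟩, hTΩ⟩ := mem_innerCells hT
  obtain ⟨r, hr, hrΩ, hcomp⟩ := exists_ball_meansComparable ho hconn hb hr₀ h₀ (hTΩ hx)
  obtain ⟨s, hs, hsr⟩ := Metric.isOpen_iff.1
    (Metric.isOpen_ball.inter (isOpen_cell H T) : IsOpen (Metric.ball x r ∩ cell H T)) x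
    ⟨Metric.mem_ball_self hr, hx⟩
  have hpos := (Metric.measure_ball_pos volume x hs).ne'
  exact ((meansComparable_of_subset hb (isOpen_cell H T) (convex_cell H T) hTΩ
    (fun y hy => (hsr hy).2) hpos).symm.trans (meansComparable_of_subset hb Metric.isOpen_ball
      (convex_ball x r) hrΩ (fun y hy => (hsr hy).1) hpos)).trans hcomp

theorem exists_enorm_sub_le (hb : Bornology.IsBounded Ω) :
    ∃ ρ : ENNReal, ρ ≠ ⊤ ∧ ∀ x ∈ Ω, ∀ y ∈ Ω, ‖x - y‖ₑ ≤ ρ := by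
  obtain ⟨C, hC⟩ := Metric.isBounded_iff.1 hb
  refine ⟨ENNReal.ofReal C, by finiteness, fun x hx y hy => ?_⟩
  rw [← ofReal_norm, ← dist_eq_norm]
  exact ENNReal.ofReal_le_ofReal (hC hx hy)

/-- The Poincaré inequality on a connected polyhedral domain. -/
theorem exists_poincare_const (ho : IsOpen Ω) (hconn : IsPreconnected Ω)
    (hb : Bornology.IsBounded Ω) (hH0 : ∀ h ∈ H, h.1 ≠ 0)
    (hH : frontier Ω ⊆ ⋃ h ∈ H, hyperplane h) {x₀ : EuclideanSpace ℝ (Fin d)} {r₀ : ℝ}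
    (hr₀ : 0 < r₀) (h₀ : Metric.ball x₀ r₀ ⊆ Ω) :
    ∃ C : ENNReal, C ≠ ⊤ ∧ ∀ u G, MemLp u 2 (volume.restrict Ω) → IsWeakGradient Ω u G →
      ∫⁻ x in Ω, ‖u x - ⨍ y in Metric.ball x₀ r₀, u y‖ₑ ^ 2 ≤ C * ∫⁻ x in Ω, ‖G x‖ₑ ^ 2 := by
  obtain ⟨ρ, hρ, hρΩ⟩ := exists_enorm_sub_le hb
  have hC : ∀ T : innerCells Ω H, MeansComparable Ω (cell H T.1) (Metric.ball x₀ r₀) :=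
    fun T => meansComparable_cell_ball ho hconn hb hr₀ h₀ T.2
  choose C hCt hC using hC
  refine ⟨∑ T, 2 * (2 ^ d * ρ ^ 2 + C T * volume (cell H T.1)), ?_, fun u G hu hG => ?_⟩
  · refine ENNReal.sum_ne_top.2 fun T _ => ?_
    have h1 := hCt T
    have h2 : volume (cell H T.1) ≠ ⊤ := (hb.subset (mem_innerCells T.2).2).measure_lt_top.ne
    finiteness
  · refine (setLIntegral_le_sum_innerCells ho hH0 hH _).trans ?_
    rw [← Finset.sum_coe_sort, Finset.sum_mul]
    refine Finset.sum_le_sum fun T _ => ?_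
    have hTΩ := (mem_innerCells T.2).2
    set m := ⨍ y in cell H T.1, u y
    calc ∫⁻ x in cell H T.1, ‖u x - ⨍ y in Metric.ball x₀ r₀, u y‖ₑ ^ 2
        ≤ ∫⁻ x in cell H T.1, 2 * (‖u x - m‖ₑ ^ 2 + ‖m - ⨍ y in Metric.ball x₀ r₀, u y‖ₑ ^ 2) :=
          lintegral_mono fun x => enorm_sub_sq_le_of_mid _ _ _
      _ = 2 * ((∫⁻ x in cell H T.1, ‖u x - m‖ₑ ^ 2) +
            ‖m - ⨍ y in Metric.ball x₀ r₀, u y‖ₑ ^ 2 * volume (cell H T.1)) := by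
          rw [lintegral_const_mul' _ _ (by norm_num), lintegral_add_right _ measurable_const,
            setLIntegral_const]
      _ ≤ 2 * (2 ^ d * ρ ^ 2 * (∫⁻ x in Ω, ‖G x‖ₑ ^ 2) +
            (C T * ∫⁻ x in Ω, ‖G x‖ₑ ^ 2) * volume (cell H T.1)) := by
          gcongr
          · refine (hG.poincare hb hu (isOpen_cell H T.1) (convex_cell H T.1) hTΩ
              fun x hx y hy => hρΩ x (hTΩ hx) y (hTΩ hy)).trans ?_
            gcongr
          · exact hC T u G hu hG
      _ = _ := by ring

/-- A convex open set fills a fixed proportion of every small ball centred in its closure. -/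
theorem le_volume_ball_inter_of_convex {K : Set (EuclideanSpace ℝ (Fin d))} (hKo : IsOpen K)
    (hKc : Convex ℝ K) {x : EuclideanSpace ℝ (Fin d)} (hx : x ∈ closure K) {R r : ℝ}
    (hR : ∀ y ∈ K, dist y x < R) (hr : 0 < r) (hrR : r ≤ R) :
    ENNReal.ofReal (r / R) ^ d * volume K ≤ volume (Metric.ball x r ∩ K) := by
  have hR0 : 0 < R := hr.trans_le hrR
  have hsub : AffineMap.homothety x (r / R) '' K ⊆ Metric.ball x r ∩ K := by
    rintro _ ⟨y, hy, rfl⟩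
    refine ⟨?_, ?_⟩
    · rw [Metric.mem_ball, dist_homothety_center, dist_comm, Real.norm_of_nonneg (by positivity)]
      calc r / R * dist y x < r / R * R := by gcongr; exact hR y hy
        _ = r := by field_simp
    · have h1 := hKc.combo_closure_interior_mem_interior hx (hKo.interior_eq.symm ▸ hy)
        (a := 1 - r / R) (b := r / R) (sub_nonneg.2 ((div_le_one hR0).2 hrR)) (by positivity)
        (by ring)
      convert interior_subset h1 using 1
      rw [AffineMap.homothety_apply, vsub_eq_sub, vadd_eq_add]
      module
  refine le_trans (le_of_eq ?_) (measure_mono hsub)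
  rw [Measure.addHaar_image_homothety, finrank_euclideanSpace_fin,
    abs_of_nonneg (by positivity), ENNReal.ofReal_pow (by positivity)]

end CEM

/-! ### Convergence of averages at boundary points -/

namespace CEM
variable {d : ℕ} {Ω : Set (EuclideanSpace ℝ (Fin d))} {u : EuclideanSpace ℝ (Fin d) → ℝ}
  {G : EuclideanSpace ℝ (Fin d) → EuclideanSpace ℝ (Fin d)}
  {H : Finset (EuclideanSpace ℝ (Fin d) × ℝ)}

/-- A function on `(0, R]` with geometrically decaying oscillation on dyadic intervals has a limit
at `0`, at controlled distance from its value at `R`. -/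
theorem exists_tendsto_of_dyadic_oscillation {f : ℝ → ℝ} {R s : ℝ} (hR : 0 < R) (hs : 0 ≤ s)
    (hf : ∀ (k : ℕ) (r : ℝ), R / 2 ^ (k + 1) ≤ r → r ≤ R / 2 ^ k →
      |f r - f (R / 2 ^ k)| ≤ s * (3 / 4) ^ k) :
    ∃ L, Tendsto f (𝓝[>] 0) (𝓝 L) ∧ |f R - L| ≤ 4 * s := by
  have hdist : ∀ k : ℕ, dist (f (R / 2 ^ k)) (f (R / 2 ^ (k + 1))) ≤ s * (3 / 4) ^ k := by
    intro k
    rw [dist_comm, Real.dist_eq]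
    refine hf k _ le_rfl ?_
    gcongr
    · norm_num
    · omega
  obtain ⟨L, hL⟩ := cauchySeq_tendsto_of_complete
    (cauchySeq_of_le_geometric (3 / 4) s (by norm_num) hdist)
  have hLk : ∀ k : ℕ, |f (R / 2 ^ k) - L| ≤ 4 * s * (3 / 4) ^ k := by
    intro k
    have := dist_le_of_le_geometric_of_tendsto (3 / 4) s (by norm_num) hdist hL k
    rw [Real.dist_eq] at this
    refine this.trans (le_of_eq ?_)
    ring
  refine ⟨L, ?_, by simpa using hLk 0⟩
  rw [Metric.tendsto_nhds]
  intro ε hε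
  obtain ⟨N, hN⟩ : ∃ N : ℕ, 5 * s * (3 / 4 : ℝ) ^ N < ε := by
    have := (tendsto_pow_atTop_nhds_zero_of_lt_one (r := (3 / 4 : ℝ)) (by norm_num)
      (by norm_num)).const_mul (5 * s)
    rw [mul_zero] at this
    exact (this.eventually (gt_mem_nhds hε)).exists
  have hmem : Set.Ioo (0 : ℝ) (R / 2 ^ N) ∈ 𝓝[>] (0 : ℝ) := Ioo_mem_nhdsGT (by positivity)
  filter_upwards [hmem] with r hr
  have hrR : r / R < (1 / 2) ^ N := by
    rw [div_lt_iff₀ hR, one_div, inv_pow, mul_comm, ← div_eq_mul_inv]; exact hr.2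
  obtain ⟨k, hk1, hk2⟩ := exists_nat_pow_near_of_lt_one (x := r / R) (y := 1 / 2)
    (div_pos hr.1 hR) (hrR.le.trans (pow_le_one₀ (by norm_num) (by norm_num))) (by norm_num)
    (by norm_num)
  have hNk : N ≤ k := by
    by_contra hlt
    have : (1 / 2 : ℝ) ^ N ≤ (1 / 2) ^ (k + 1) :=
      pow_le_pow_of_le_one (by norm_num) (by norm_num) (by omega)
    linarith
  have e : ∀ j : ℕ, R / 2 ^ j = (1 / 2) ^ j * R := fun j => by
    rw [one_div, inv_pow, mul_comm, ← div_eq_mul_inv]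
  have h1 := hf k r (by rw [e]; exact (lt_div_iff₀ hR).1 hk1 |>.le)
    (by rw [e]; exact (div_le_iff₀ hR).1 hk2)
  rw [Real.dist_eq]
  calc |f r - L| ≤ |f r - f (R / 2 ^ k)| + |f (R / 2 ^ k) - L| := abs_sub_le _ _ _
    _ ≤ s * (3 / 4) ^ k + 4 * s * (3 / 4) ^ k := add_le_add h1 (hLk k)
    _ = 5 * s * (3 / 4) ^ k := by ring
    _ ≤ 5 * s * (3 / 4) ^ N := by
      gcongr _ * ?_
      exact pow_le_pow_of_le_one (by norm_num) (by norm_num) hNk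
    _ < ε := hN

/-- A weighted sum of the local gradient energies around `x` over the dyadic radii `R / 2 ^ k`. It
dominates the distance of the boundary trace at `x` from an average of `u`, and it is integrable
over every measure that is upper Ahlfors regular of dimension `d - 1`. -/
noncomputable def dyadicEnergy (Ω : Set (EuclideanSpace ℝ (Fin d))) (R : ℝ)
    (G : EuclideanSpace ℝ (Fin d) → EuclideanSpace ℝ (Fin d)) (x : EuclideanSpace ℝ (Fin d)) :
    ENNReal :=
  ∑' k : ℕ, (4 / 9 * 2 ^ d) ^ k * ∫⁻ y in Metric.ball x (R / 2 ^ k) ∩ Ω, ‖G y‖ₑ ^ 2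

/-- Averages of an `H¹` function over the intersections of a convex cell with balls shrinking to
a point `x` of its closure converge as soon as the dyadic energy at `x` is finite. -/
theorem IsWeakGradient.exists_tendsto_average {K : Set (EuclideanSpace ℝ (Fin d))}
    (hb : Bornology.IsBounded Ω) (hKo : IsOpen K) (hKc : Convex ℝ K) (hKne : K.Nonempty)
    (hKΩ : K ⊆ Ω) {R : ℝ} (hR : 0 < R) (hRK : ∀ x ∈ closure Ω, ∀ y ∈ Ω, dist y x < R) :
    ∃ M : ENNReal, M ≠ ⊤ ∧ ∀ u G, MemLp u 2 (volume.restrict Ω) → IsWeakGradient Ω u G →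
      ∀ x ∈ closure K, dyadicEnergy Ω R G x ≠ ⊤ →
        ∃ L, Tendsto (fun r => ⨍ y in Metric.ball x r ∩ K, u y) (𝓝[>] 0) (𝓝 L) ∧
          ‖L - ⨍ y in K, u y‖ₑ ^ 2 ≤ M * dyadicEnergy Ω R G x := by
  have hv0 : volume K ≠ 0 := (hKo.measure_pos volume hKne).ne'
  have hvt : volume K ≠ ⊤ := (hb.subset hKΩ).measure_lt_top.ne
  set M : ENNReal := (volume K)⁻¹ * (2 ^ d * 2 ^ d * ENNReal.ofReal (2 * R) ^ 2) with hM
  have hMt : M ≠ ⊤ := by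
    have : (volume K)⁻¹ ≠ ⊤ := by simpa using hv0
    finiteness
  refine ⟨16 * M, by finiteness, fun u G hu hG x hx hS => ?_⟩
  set S := dyadicEnergy Ω R G x with hSdef
  set f : ℝ → ℝ := fun r => ⨍ y in Metric.ball x r ∩ K, u y with hf
  have hxΩ : x ∈ closure Ω := closure_mono hKΩ hx
  have hvol : ∀ r, 0 < r → r ≤ R →
      ENNReal.ofReal (r / R) ^ d * volume K ≤ volume (Metric.ball x r ∩ K) := fun r hr hrR =>
    le_volume_ball_inter_of_convex hKo hKc hx (fun y hy => hRK x hxΩ y (hKΩ hy)) hr hrR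
  -- The weight `(4 / 9 * 2 ^ d) ^ k` of the energy at scale `k` exceeds the factor `(2 ^ d / 4) ^ k`
  -- lost in comparing averages by `(16 / 9) ^ k`, so the oscillation at scale `k` is `O((3 / 4) ^ k)`.
  have hosc : ∀ (k : ℕ) (r : ℝ), R / 2 ^ (k + 1) ≤ r → r ≤ R / 2 ^ k →
      ‖f r - f (R / 2 ^ k)‖ₑ ^ 2 ≤ M * S * (9 / 16) ^ k := by
    intro k r hr1 hr2
    have hr0 : 0 < r := lt_of_lt_of_le (by positivity) hr1
    have hrR : r ≤ R := hr2.trans (div_le_self hR.le (one_le_pow₀ (by norm_num)))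
    have hv1 : (2⁻¹ : ENNReal) ^ ((k + 1) * d) * volume K ≤ volume (Metric.ball x r ∩ K) := by
      refine le_trans ?_ (hvol r hr0 hrR)
      rw [pow_mul]
      gcongr
      rw [← ENNReal.ofReal_ofNat, ← ENNReal.ofReal_inv_of_pos (by norm_num),
        ← ENNReal.ofReal_pow (by norm_num)]
      apply ENNReal.ofReal_le_ofReal
      rw [le_div_iff₀ hR, inv_pow, mul_comm, ← div_eq_mul_inv]
      exact hr1
    have hv2 : volume (Metric.ball x r ∩ K) ≠ 0 := by
      refine (lt_of_lt_of_le ?_ hv1).ne'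
      have : (2⁻¹ : ENNReal) ^ ((k + 1) * d) ≠ 0 := pow_ne_zero _ (by simp)
      exact pos_iff_ne_zero.2 (mul_ne_zero this hv0)
    set ρ : ENNReal := ENNReal.ofReal (2 * R) * 2⁻¹ ^ k with hρ
    have hρD : ∀ y ∈ Metric.ball x (R / 2 ^ k) ∩ K, ∀ z ∈ Metric.ball x (R / 2 ^ k) ∩ K,
        ‖y - z‖ₑ ≤ ρ := by
      rintro y ⟨hy, -⟩ z ⟨hz, -⟩
      have h0 : (2⁻¹ : ENNReal) ^ k = ENNReal.ofReal (2⁻¹ ^ k) := by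
        rw [ENNReal.ofReal_pow (by norm_num), ENNReal.ofReal_inv_of_pos (by norm_num),
          ENNReal.ofReal_ofNat]
      rw [← ofReal_norm, ← dist_eq_norm, hρ, h0, ← ENNReal.ofReal_mul (by positivity)]
      apply ENNReal.ofReal_le_ofReal
      rw [Metric.mem_ball] at hy hz
      have h1 := dist_triangle_right y z x
      have h2 : 2 * R * (2⁻¹ : ℝ) ^ k = 2 * (R / 2 ^ k) := by
        rw [inv_pow]; ring
      rw [h2]; linarith
    have h1 := hG.average_sub_average_sq_le hb hu (D := Metric.ball x (R / 2 ^ k) ∩ K)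
      (E := Metric.ball x r ∩ K) (Metric.isOpen_ball.inter hKo) ((convex_ball _ _).inter hKc)
      (fun y hy => hKΩ hy.2) hρD
      (Set.inter_subset_inter_left _ (Metric.ball_subset_ball hr2)) hv2
    refine h1.trans ?_
    have h2 : (volume (Metric.ball x r ∩ K))⁻¹ ≤ 2 ^ ((k + 1) * d) * (volume K)⁻¹ := by
      refine (ENNReal.inv_le_inv.2 hv1).trans (le_of_eq ?_)
      rw [ENNReal.mul_inv (by right; exact hvt) (by right; exact hv0), ← ENNReal.inv_pow, inv_inv]
    have h3 : (4 / 9 * 2 ^ d : ENNReal) ^ k *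
        ∫⁻ y in Metric.ball x (R / 2 ^ k) ∩ Ω, ‖G y‖ₑ ^ 2 ≤ S := ENNReal.le_tsum k
    have h4 : ∫⁻ y in Metric.ball x (R / 2 ^ k) ∩ K, ‖G y‖ₑ ^ 2 ≤
        ∫⁻ y in Metric.ball x (R / 2 ^ k) ∩ Ω, ‖G y‖ₑ ^ 2 :=
      lintegral_mono_set (Set.inter_subset_inter_right _ hKΩ)
    have hnum : ((2 : ENNReal)⁻¹ ^ k) ^ 2 = (9 / 16) ^ k * (4 / 9) ^ k := by
      rw [← pow_mul, mul_comm k 2, pow_mul, ← mul_pow]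
      congr 1
      rw [ENNReal.div_eq_inv_mul, ENNReal.div_eq_inv_mul]
      have h9 : (9 : ENNReal)⁻¹ * 9 = 1 := ENNReal.inv_mul_cancel (by norm_num) (by norm_num)
      have h4 : (4 : ENNReal)⁻¹ * 4 = 1 := ENNReal.inv_mul_cancel (by norm_num) (by norm_num)
      have h16 : (16 : ENNReal)⁻¹ = 4⁻¹ * 4⁻¹ := by
        rw [← ENNReal.mul_inv (by norm_num) (by norm_num)]; norm_num
      have h2 : (2 : ENNReal)⁻¹ ^ 2 = 4⁻¹ := by rw [← ENNReal.inv_pow]; norm_num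
      rw [h2, h16]
      calc (4 : ENNReal)⁻¹ = 4⁻¹ * 1 * 1 := by ring
        _ = 4⁻¹ * ((4 : ENNReal)⁻¹ * 4) * ((9 : ENNReal)⁻¹ * 9) := by rw [h9, h4]
        _ = _ := by ring
    calc (volume (Metric.ball x r ∩ K))⁻¹ *
          (2 ^ d * ρ ^ 2 * ∫⁻ y in Metric.ball x (R / 2 ^ k) ∩ K, ‖G y‖ₑ ^ 2)
        ≤ (2 ^ ((k + 1) * d) * (volume K)⁻¹) *
          (2 ^ d * ρ ^ 2 * ∫⁻ y in Metric.ball x (R / 2 ^ k) ∩ Ω, ‖G y‖ₑ ^ 2) := by gcongr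
      _ = M * ((4 / 9 * 2 ^ d : ENNReal) ^ k *
          ∫⁻ y in Metric.ball x (R / 2 ^ k) ∩ Ω, ‖G y‖ₑ ^ 2) * (9 / 16) ^ k := by
        rw [hM, hρ, mul_pow _ _ 2, hnum, mul_pow (4 / 9) _ k, add_mul, pow_add, one_mul,
          mul_comm k d, pow_mul]
        ring
      _ ≤ M * S * (9 / 16) ^ k := by gcongr
  have hMS : M * S ≠ ⊤ := by finiteness
  set s := Real.sqrt (M * S).toReal with hs
  have hosc' : ∀ (k : ℕ) (r : ℝ), R / 2 ^ (k + 1) ≤ r → r ≤ R / 2 ^ k →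
      |f r - f (R / 2 ^ k)| ≤ s * (3 / 4) ^ k := by
    intro k r hr1 hr2
    have h1 := ENNReal.toReal_mono (by finiteness) (hosc k r hr1 hr2)
    rw [ENNReal.toReal_pow, toReal_enorm, ENNReal.toReal_mul, ENNReal.toReal_pow,
      ENNReal.toReal_div, Real.norm_eq_abs] at h1
    refine abs_le_of_sq_le_sq' ?_ (by positivity) |> abs_le.2
    rw [mul_pow, hs, Real.sq_sqrt ENNReal.toReal_nonneg, ← sq_abs]
    refine h1.trans (le_of_eq ?_)
    rw [← pow_mul, mul_comm k 2, pow_mul]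
    norm_num
  obtain ⟨L, hL, hLR⟩ := exists_tendsto_of_dyadic_oscillation hR (Real.sqrt_nonneg _) hosc'
  refine ⟨L, hL, ?_⟩
  have hfR : f R = ⨍ y in K, u y := by
    simp only [hf]
    rw [Set.inter_eq_right.2]
    exact fun y hy => hRK x hxΩ y (hKΩ hy)
  rw [hfR, abs_sub_comm] at hLR
  have h5 : |L - ⨍ y in K, u y| ^ 2 ≤ 16 * (M * S).toReal := by
    calc |L - ⨍ y in K, u y| ^ 2 ≤ (4 * s) ^ 2 := by gcongr
      _ = 16 * (M * S).toReal := by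
        rw [mul_pow, hs, Real.sq_sqrt ENNReal.toReal_nonneg]; norm_num
  calc ‖L - ⨍ y in K, u y‖ₑ ^ 2 = ENNReal.ofReal (|L - ⨍ y in K, u y| ^ 2) := by
        rw [ENNReal.ofReal_pow (abs_nonneg _), ← Real.norm_eq_abs, ofReal_norm]
    _ ≤ ENNReal.ofReal (16 * (M * S).toReal) := ENNReal.ofReal_le_ofReal h5
    _ = 16 * M * S := by
        rw [ENNReal.ofReal_mul (by norm_num), ENNReal.ofReal_toReal hMS, ENNReal.ofReal_ofNat]
        ring

end CEM

/-! ### The trace inequality on the boundary -/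

namespace CEM
variable {d : ℕ} {Ω : Set (EuclideanSpace ℝ (Fin d))} {u : EuclideanSpace ℝ (Fin d) → ℝ}
  {G : EuclideanSpace ℝ (Fin d) → EuclideanSpace ℝ (Fin d)}
  {H : Finset (EuclideanSpace ℝ (Fin d) × ℝ)}

theorem measurableSet_dist_lt (r : ℝ) :
    MeasurableSet {p : EuclideanSpace ℝ (Fin d) × EuclideanSpace ℝ (Fin d) | dist p.2 p.1 < r} :=
  (isOpen_lt (by fun_prop) continuous_const).measurableSet

/-- Integrated against an upper Ahlfors regular measure, the energy in balls of radius `r` gains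
the factor `r ^ (d - 1)`. -/
theorem lintegral_lintegral_ball_inter_le
    (hG : AEStronglyMeasurable G (volume.restrict Ω))
    (ν : Measure (EuclideanSpace ℝ (Fin d))) [IsFiniteMeasure ν] {r : ℝ} {A : ENNReal}
    (hA : ∀ z, ν (Metric.ball z r) ≤ A) :
    AEMeasurable (fun x => ∫⁻ y in Metric.ball x r ∩ Ω, ‖G y‖ₑ ^ 2) ν ∧
    ∫⁻ x, (∫⁻ y in Metric.ball x r ∩ Ω, ‖G y‖ₑ ^ 2) ∂ν ≤ A * ∫⁻ y in Ω, ‖G y‖ₑ ^ 2 := by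
  set G' := hG.mk G with hG'
  have hGm : Measurable fun y => ‖G' y‖ₑ ^ 2 := hG.stronglyMeasurable_mk.enorm.pow_const 2
  have hGG : G =ᵐ[volume.restrict Ω] G' := hG.ae_eq_mk
  set k : EuclideanSpace ℝ (Fin d) × EuclideanSpace ℝ (Fin d) → ENNReal :=
    {p : EuclideanSpace ℝ (Fin d) × EuclideanSpace ℝ (Fin d) | dist p.2 p.1 < r}.indicator
      fun p => ‖G' p.2‖ₑ ^ 2 with hk
  have hkm : Measurable k := (hGm.comp measurable_snd).indicator (measurableSet_dist_lt r)
  have e : ∀ x, ∫⁻ y in Metric.ball x r ∩ Ω, ‖G y‖ₑ ^ 2 = ∫⁻ y in Ω, k (x, y) := by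
    intro x
    have hm : MeasurableSet (Metric.ball x r) := Metric.isOpen_ball.measurableSet
    have h1 : ∀ y, k (x, y) = (Metric.ball x r).indicator (fun y => ‖G' y‖ₑ ^ 2) y := fun y => rfl
    simp_rw [h1]
    rw [lintegral_indicator hm, Measure.restrict_restrict hm]
    refine lintegral_congr_ae ?_
    have : G =ᵐ[volume.restrict (Metric.ball x r ∩ Ω)] G' :=
      hGG.filter_mono (ae_mono (Measure.restrict_mono Set.inter_subset_right le_rfl))
    filter_upwards [this] with y hy
    rw [hy]
  simp_rw [e]
  refine ⟨(hkm.lintegral_prod_right' (ν := volume.restrict Ω)).aemeasurable, ?_⟩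
  rw [lintegral_lintegral_swap (f := fun x y => k (x, y)) hkm.aemeasurable]
  have e2 : ∫⁻ y in Ω, ‖G y‖ₑ ^ 2 = ∫⁻ y in Ω, ‖G' y‖ₑ ^ 2 :=
    lintegral_congr_ae (hGG.mono fun y hy => by simp only [hy])
  rw [e2, ← lintegral_const_mul _ hGm]
  refine lintegral_mono fun y => ?_
  have h2 : ∀ x, k (x, y) = (Metric.ball y r).indicator (fun _ => ‖G' y‖ₑ ^ 2) x := fun x => by
    simp only [hk, Set.indicator, Metric.mem_ball, Set.mem_ofPred_eq, dist_comm]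
  simp_rw [h2]
  rw [lintegral_indicator Metric.isOpen_ball.measurableSet, setLIntegral_const, mul_comm]
  gcongr
  exact hA y

theorem dyadicEnergy_le (hd : 1 ≤ d)
    (ν : Measure (EuclideanSpace ℝ (Fin d))) [IsFiniteMeasure ν] {A : ENNReal}
    (hA : ∀ (z : EuclideanSpace ℝ (Fin d)) (r : ℝ), 0 < r →
      ν (Metric.ball z r) ≤ A * ENNReal.ofReal r ^ (d - 1)) {R : ℝ} (hR : 0 < R)
    (hG : AEStronglyMeasurable G (volume.restrict Ω)) :
    AEMeasurable (dyadicEnergy Ω R G) ν ∧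
    ∫⁻ x, dyadicEnergy Ω R G x ∂ν ≤
      9 * A * ENNReal.ofReal R ^ (d - 1) * ∫⁻ y in Ω, ‖G y‖ₑ ^ 2 := by
  have h1 : ∀ k : ℕ, _ := fun k => lintegral_lintegral_ball_inter_le hG ν
    (r := R / 2 ^ k) (fun z => hA z _ (by positivity))
  have hm : ∀ k : ℕ, AEMeasurable (fun x => (4 / 9 * 2 ^ d : ENNReal) ^ k *
      ∫⁻ y in Metric.ball x (R / 2 ^ k) ∩ Ω, ‖G y‖ₑ ^ 2) ν := fun k => (h1 k).1.const_mul _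
  refine ⟨AEMeasurable.tsum hm, ?_⟩
  simp only [dyadicEnergy]
  rw [lintegral_tsum hm]
  -- the gain `2 ^ (-k * (d - 1))` turns the weight `(4 / 9 * 2 ^ d) ^ k` into the summable `(8 / 9) ^ k`
  have h2 : ∀ k : ℕ, ∫⁻ x, ((4 / 9 * 2 ^ d : ENNReal) ^ k *
      ∫⁻ y in Metric.ball x (R / 2 ^ k) ∩ Ω, ‖G y‖ₑ ^ 2) ∂ν ≤
      (8 / 9) ^ k * (A * ENNReal.ofReal R ^ (d - 1) * ∫⁻ y in Ω, ‖G y‖ₑ ^ 2) := by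
    intro k
    rw [lintegral_const_mul'' _ (h1 k).1]
    refine (mul_le_mul_right (h1 k).2 _).trans (le_of_eq ?_)
    obtain ⟨m, rfl⟩ : ∃ m, d = m + 1 := ⟨d - 1, by omega⟩
    have h3 : ENNReal.ofReal (R / 2 ^ k) = ENNReal.ofReal R * 2⁻¹ ^ k := by
      rw [ENNReal.ofReal_div_of_pos (by positivity), ENNReal.ofReal_pow (by norm_num),
        ENNReal.ofReal_ofNat, ENNReal.div_eq_inv_mul, ENNReal.inv_pow, mul_comm]
    have h4 : (2 : ENNReal) ^ m * 2⁻¹ ^ m = 1 := by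
      rw [← mul_pow, ENNReal.mul_inv_cancel (by norm_num) (by norm_num), one_pow]
    have h5 : (4 / 9 * 2 : ENNReal) = 8 / 9 := by
      rw [ENNReal.div_eq_inv_mul, ENNReal.div_eq_inv_mul, mul_assoc]; norm_num
    have h6 : (4 / 9 * 2 ^ (m + 1) : ENNReal) ^ k * (2⁻¹ ^ k) ^ m = (8 / 9) ^ k := by
      rw [← pow_mul, mul_comm k m, pow_mul, ← mul_pow, pow_succ,
        show (4 / 9 * (2 ^ m * 2) * 2⁻¹ ^ m : ENNReal) = 4 / 9 * 2 * (2 ^ m * 2⁻¹ ^ m) by ring,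
        h4, mul_one, h5]
    rw [Nat.add_sub_cancel, h3, mul_pow, ← h6]
    ring
  refine (ENNReal.tsum_le_tsum h2).trans (le_of_eq ?_)
  rw [ENNReal.tsum_mul_right, ENNReal.tsum_geometric]
  have h7 : (1 - 8 / 9 : ENNReal)⁻¹ = 9 := by
    have : (1 - 8 / 9 : ENNReal) = 9⁻¹ := by
      refine ENNReal.sub_eq_of_eq_add (by finiteness) ?_
      rw [ENNReal.div_eq_inv_mul]
      calc (1 : ENNReal) = 9⁻¹ * 9 := (ENNReal.inv_mul_cancel (by norm_num) (by norm_num)).symm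
        _ = 9⁻¹ * (1 + 8) := by norm_num
        _ = _ := by rw [mul_add, mul_one]
    rw [this, inv_inv]
  rw [h7]; ring

theorem stronglyMeasurable_setIntegral_ball {u : EuclideanSpace ℝ (Fin d) → ℝ}
    (hu : AEStronglyMeasurable u (volume.restrict Ω)) (r : ℝ) :
    StronglyMeasurable fun x => ∫ y in Metric.ball x r ∩ Ω, u y := by
  set u' := hu.mk u with hu'
  have huu : u =ᵐ[volume.restrict Ω] u' := hu.ae_eq_mk
  have hkm : StronglyMeasurable
      ({p : EuclideanSpace ℝ (Fin d) × EuclideanSpace ℝ (Fin d) | dist p.2 p.1 < r}.indicator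
        fun p => u' p.2) :=
    (hu.stronglyMeasurable_mk.comp_measurable measurable_snd).indicator (measurableSet_dist_lt r)
  have h1 := hkm.integral_prod_right' (ν := volume.restrict Ω)
  convert! h1 using 2 with x
  have hm : MeasurableSet (Metric.ball x r) := Metric.isOpen_ball.measurableSet
  have h1 : ∀ y, {p : EuclideanSpace ℝ (Fin d) × EuclideanSpace ℝ (Fin d) |
      dist p.2 p.1 < r}.indicator (fun p => u' p.2) (x, y) = (Metric.ball x r).indicator u' y :=
    fun y => rfl
  simp_rw [h1]
  rw [integral_indicator hm, Measure.restrict_restrict hm]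
  refine integral_congr_ae ?_
  exact huu.filter_mono (ae_mono (Measure.restrict_mono Set.inter_subset_right le_rfl))

theorem stronglyMeasurable_average_ball {u : EuclideanSpace ℝ (Fin d) → ℝ}
    (hu : AEStronglyMeasurable u (volume.restrict Ω)) (r : ℝ) :
    StronglyMeasurable fun x => ⨍ y in Metric.ball x r ∩ Ω, u y := by
  have h1 : StronglyMeasurable fun x : EuclideanSpace ℝ (Fin d) =>
      volume.real (Metric.ball x r ∩ Ω) := by
    have := stronglyMeasurable_setIntegral_ball
      (aestronglyMeasurable_const (b := (1 : ℝ)) (μ := volume.restrict Ω)) r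
    simpa using this
  have h2 : StronglyMeasurable fun x : EuclideanSpace ℝ (Fin d) =>
      (volume.real (Metric.ball x r ∩ Ω))⁻¹ := h1.measurable.inv.stronglyMeasurable
  simp_rw [setAverage_eq]
  exact h2.smul (stronglyMeasurable_setIntegral_ball hu r)

/-- `u` has a boundary trace at `x`: its averages over `B(x, r) ∩ Ω` converge. -/
def HasTrace (Ω : Set (EuclideanSpace ℝ (Fin d))) (u : EuclideanSpace ℝ (Fin d) → ℝ)
    (x : EuclideanSpace ℝ (Fin d)) : Prop :=
  Tendsto (fun r => ⨍ y in Metric.ball x r ∩ Ω, u y) (𝓝[>] 0) (𝓝 (trace Ω u x))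

theorem hasTrace_of_tendsto {x : EuclideanSpace ℝ (Fin d)} {L : ℝ}
    (h : Tendsto (fun r => ⨍ y in Metric.ball x r ∩ Ω, u y) (𝓝[>] 0) (𝓝 L)) :
    trace Ω u x = L ∧ HasTrace Ω u x := by
  have : trace Ω u x = L := h.limUnder_eq
  exact ⟨this, by rw [HasTrace, this]; exact h⟩

theorem aestronglyMeasurable_trace (hu : AEStronglyMeasurable u (volume.restrict Ω))
    {ν : Measure (EuclideanSpace ℝ (Fin d))} (h : ∀ᵐ x ∂ν, HasTrace Ω u x) :
    AEStronglyMeasurable (trace Ω u) ν := by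
  obtain ⟨r, -, hr0, hr⟩ := exists_seq_strictAnti_tendsto (0 : ℝ)
  have hr' : Tendsto r atTop (𝓝[>] 0) :=
    tendsto_nhdsWithin_iff.2 ⟨hr, Eventually.of_forall hr0⟩
  refine aestronglyMeasurable_of_tendsto_ae atTop
    (f := fun (n : ℕ) x => ⨍ y in Metric.ball x (r n) ∩ Ω, u y)
    (fun n => (stronglyMeasurable_average_ball hu _).aestronglyMeasurable) ?_
  filter_upwards [h] with x hx
  exact hx.comp hr'

/-- **Trace theorem.** On a bounded piece `e` of the boundary of a polyhedral domain the trace of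
an `H¹` function exists almost everywhere, and its distance in `L²(e)` from an interior average is
controlled by the gradient. -/
theorem exists_trace_const (hd : 1 ≤ d) (hΩ : IsPolyhedralDomain Ω) (hH0 : ∀ h ∈ H, h.1 ≠ 0)
    (hH : frontier Ω ⊆ ⋃ h ∈ H, hyperplane h) {x₀ : EuclideanSpace ℝ (Fin d)} {r₀ : ℝ}
    (hr₀ : 0 < r₀) (h₀ : Metric.ball x₀ r₀ ⊆ Ω) {e : Set (EuclideanSpace ℝ (Fin d))}
    (hem : MeasurableSet e) (he : e ⊆ frontier Ω) :
    ∃ C : ENNReal, C ≠ ⊤ ∧ ∀ u G, MemLp u 2 (volume.restrict Ω) → IsWeakGradient Ω u G →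
      (∀ᵐ x ∂(surfaceMeasure d).restrict e, HasTrace Ω u x) ∧
      ∫⁻ x in e, ‖trace Ω u x - ⨍ y in Metric.ball x₀ r₀, u y‖ₑ ^ 2 ∂(surfaceMeasure d) ≤
        C * ∫⁻ x in Ω, ‖G x‖ₑ ^ 2 := by
  have ho := hΩ.isOpen
  have hb := hΩ.isBounded
  set ν := (surfaceMeasure d).restrict e with hν
  have hebd : Bornology.IsBounded e := (hb.closure.subset frontier_subset_closure).subset he
  have hνt : surfaceMeasure d e < ⊤ := surfaceMeasure_lt_top hH0 hebd (he.trans hH)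
  have : IsFiniteMeasure ν := ⟨by simpa [hν] using hνt⟩
  obtain ⟨A, hA, hAle⟩ := surfaceMeasure_restrict_ball_le hH0 (he.trans hH)
  obtain ⟨R, hR, hRΩ⟩ : ∃ R > 0, ∀ x ∈ closure Ω, ∀ y ∈ Ω, dist y x < R := by
    obtain ⟨C, hC⟩ := Metric.isBounded_iff.1 hb.closure
    refine ⟨max C 0 + 1, by positivity, fun x hx y hy => ?_⟩
    have := hC (subset_closure hy) hx
    have := le_max_left C 0
    linarith
  have hcomp : ∀ T : innerCells Ω H, MeansComparable Ω (cell H T.1) (Metric.ball x₀ r₀) :=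
    fun T => meansComparable_cell_ball ho hΩ.isConnected.isPreconnected hb hr₀ h₀ T.2
  choose C hCt hC using hcomp
  have hM : ∀ T : innerCells Ω H, _ := fun T => IsWeakGradient.exists_tendsto_average hb
    (isOpen_cell H T.1) (convex_cell H T.1) (mem_innerCells T.2).1 (mem_innerCells T.2).2 hR hRΩ
  choose M hMt hM using hM
  refine ⟨∑ T, 2 * (M T * (9 * A * ENNReal.ofReal R ^ (d - 1)) + C T * surfaceMeasure d e), ?_,
    fun u G hu hG => ?_⟩
  · refine ENNReal.sum_ne_top.2 fun T _ => ?_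
    have h1 := hCt T
    have h2 := hMt T
    have h3 := hνt.ne
    finiteness
  set I := ∫⁻ x in Ω, ‖G x‖ₑ ^ 2 with hI
  have hIt : I ≠ ⊤ := by
    have := hG.1.2
    rw [eLpNorm_lt_top_iff_lintegral_rpow_enorm_lt_top (by norm_num) (by norm_num)] at this
    simpa using this.ne
  obtain ⟨hSm, hSle⟩ := dyadicEnergy_le hd ν hAle hR hG.1.1
  have hSfin : ∀ᵐ x ∂ν, dyadicEnergy Ω R G x < ⊤ :=
    ae_lt_top' hSm (ne_top_of_le_ne_top (by finiteness) hSle)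
  set S := dyadicEnergy Ω R G with hS
  set m := ⨍ y in Metric.ball x₀ r₀, u y with hm
  have hpt : ∀ᵐ x ∂ν, HasTrace Ω u x ∧
      ‖trace Ω u x - m‖ₑ ^ 2 ≤ ∑ T, 2 * (M T * S x + C T * I) := by
    filter_upwards [hSfin, ae_restrict_hyperplane_eq hH0 e, ae_restrict_mem hem]
      with x hx hgood hxe
    obtain ⟨T, hT, hxT, r, hr, hrT⟩ :=
      exists_ball_inter_eq_cell ho hΩ.interior_closure hH0 hH (he hxe) hgood
    obtain ⟨L, hL, hLm⟩ := hM ⟨T, hT⟩ u G hu hG x hxT hx.ne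
    have hL' : Tendsto (fun r => ⨍ y in Metric.ball x r ∩ Ω, u y) (𝓝[>] 0) (𝓝 L) := by
      refine hL.congr' ?_
      filter_upwards [Ioo_mem_nhdsGT hr] with s hs
      have : Metric.ball x s ∩ cell H T = Metric.ball x s ∩ Ω := by
        rw [← Set.inter_eq_right.2 (Metric.ball_subset_ball hs.2.le : Metric.ball x s ⊆ _),
          Set.inter_comm (Metric.ball x r), Set.inter_assoc, Set.inter_assoc, hrT]
      simp only [this]
    obtain ⟨h1, h2⟩ := hasTrace_of_tendsto hL'
    refine ⟨h2, ?_⟩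
    rw [h1]
    refine (enorm_sub_sq_le_of_mid _ (⨍ y in cell H T, u y) _).trans ?_
    refine le_trans ?_ (Finset.single_le_sum (f := fun T : innerCells Ω H =>
      2 * (M T * S x + C T * I)) (fun _ _ => zero_le) (Finset.mem_univ ⟨T, hT⟩))
    gcongr
    exact hC ⟨T, hT⟩ u G hu hG
  refine ⟨hpt.mono fun x hx => hx.1, ?_⟩
  refine (lintegral_mono_ae (hpt.mono fun x hx => hx.2)).trans ?_
  rw [lintegral_finsetSum' _ fun T _ => (((hSm.const_mul _).add_const _).const_mul _),
    Finset.sum_mul]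
  refine Finset.sum_le_sum fun T _ => ?_
  rw [lintegral_const_mul' _ _ (by norm_num), lintegral_add_right _ measurable_const,
    lintegral_const_mul'' _ hSm, lintegral_const, hν, Measure.restrict_apply_univ]
  calc 2 * (M T * ∫⁻ x, S x ∂ν + C T * I * surfaceMeasure d e)
      ≤ 2 * (M T * (9 * A * ENNReal.ofReal R ^ (d - 1) * I) + C T * I * surfaceMeasure d e) := by
        gcongr
    _ = _ := by ring

end CEM

/-! ### The Hilbert space of the complete electrode model -/

namespace CEM
variable {d L : ℕ} {Ω : Set (EuclideanSpace ℝ (Fin d))} {u : EuclideanSpace ℝ (Fin d) → ℝ}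
  {G : EuclideanSpace ℝ (Fin d) → EuclideanSpace ℝ (Fin d)}

theorem lintegral_enorm_sq_eq_of_memLp {α F : Type*} [MeasurableSpace α] [NormedAddCommGroup F]
    {μ : Measure α} {f : α → F} (hf : MemLp f 2 μ) :
    ∫⁻ x, ‖f x‖ₑ ^ 2 ∂μ = ENNReal.ofReal (‖hf.toLp f‖ ^ 2) := by
  rw [ENNReal.ofReal_pow (norm_nonneg _), ofReal_norm, Lp.enorm_def,
    eLpNorm_congr_ae hf.coeFn_toLp, eLpNorm_eq_lintegral_rpow_enorm_toReal (by norm_num) (by norm_num),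
    ← ENNReal.rpow_natCast, ← ENNReal.rpow_mul]
  simp

theorem lintegral_enorm_sq_coe {α F : Type*} [MeasurableSpace α] [NormedAddCommGroup F]
    {μ : Measure α} (f : Lp F 2 μ) : ∫⁻ x, ‖f x‖ₑ ^ 2 ∂μ = ENNReal.ofReal (‖f‖ ^ 2) := by
  rw [lintegral_enorm_sq_eq_of_memLp (Lp.memLp f), Lp.toLp_coeFn]

theorem memLp_two_of_lintegral_lt_top {α F : Type*} [MeasurableSpace α] [NormedAddCommGroup F]
    {μ : Measure α} {f : α → F} (hf : AEStronglyMeasurable f μ)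
    (h : ∫⁻ x, ‖f x‖ₑ ^ 2 ∂μ < ⊤) : MemLp f 2 μ := by
  refine ⟨hf, ?_⟩
  rw [eLpNorm_lt_top_iff_lintegral_rpow_enorm_lt_top (by norm_num) (by norm_num)]
  simpa using h

/-- Weak gradients are characterized by orthogonality relations in `L²`; in particular they form
a weakly closed subspace. -/
theorem exists_isWeakGradient_iff_inner (Ω : Set (EuclideanSpace ℝ (Fin d))) :
    ∃ P : Set (Lp ℝ 2 (volume.restrict Ω) × Lp (EuclideanSpace ℝ (Fin d)) 2 (volume.restrict Ω)),
      ∀ (u : Lp ℝ 2 (volume.restrict Ω)) (G : Lp (EuclideanSpace ℝ (Fin d)) 2 (volume.restrict Ω)),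
        IsWeakGradient Ω u G ↔ ∀ p ∈ P, inner ℝ p.1 u + inner ℝ p.2 G = 0 := by
  have hrep : ∀ φ : EuclideanSpace ℝ (Fin d) → ℝ, ContDiff ℝ ∞ φ → HasCompactSupport φ →
      ∀ i : Fin d, ∃ p : Lp ℝ 2 (volume.restrict Ω) ×
        Lp (EuclideanSpace ℝ (Fin d)) 2 (volume.restrict Ω),
      ∀ (u : Lp ℝ 2 (volume.restrict Ω)) (G : Lp (EuclideanSpace ℝ (Fin d)) 2 (volume.restrict Ω)),
        ∫ x in Ω, u x * fderiv ℝ φ x (EuclideanSpace.single i 1) = inner ℝ p.1 u ∧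
        ∫ x in Ω, G x i * φ x = inner ℝ p.2 G := by
    intro φ hφ hc i
    have h1 : MemLp (fun x => fderiv ℝ φ x (EuclideanSpace.single i 1)) 2 (volume.restrict Ω) :=
      (((hφ.continuous_fderiv (by simp)).clm_apply continuous_const).memLp_of_hasCompactSupport
        (hc.fderiv_apply (𝕜 := ℝ) _)).restrict Ω
    have h2 : MemLp (fun x => φ x • EuclideanSpace.single i (1 : ℝ)) 2 (volume.restrict Ω) :=
      ((hφ.continuous.smul continuous_const).memLp_of_hasCompactSupport
        hc.smul_right).restrict Ω
    refine ⟨(h1.toLp _, h2.toLp _), fun u G => ⟨?_, ?_⟩⟩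
    · rw [L2.inner_def]
      refine integral_congr_ae ?_
      filter_upwards [h1.coeFn_toLp] with x hx
      rw [hx]; simp
    · rw [L2.inner_def]
      refine integral_congr_ae ?_
      filter_upwards [h2.coeFn_toLp] with x hx
      rw [hx, real_inner_smul_left, EuclideanSpace.inner_single_left]; simp [mul_comm]
  refine ⟨{p | ∃ φ : EuclideanSpace ℝ (Fin d) → ℝ, ContDiff ℝ ∞ φ ∧ HasCompactSupport φ ∧
    tsupport φ ⊆ Ω ∧ ∃ i, ∀ (u : Lp ℝ 2 (volume.restrict Ω))
      (G : Lp (EuclideanSpace ℝ (Fin d)) 2 (volume.restrict Ω)),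
        ∫ x in Ω, u x * fderiv ℝ φ x (EuclideanSpace.single i 1) = inner ℝ p.1 u ∧
        ∫ x in Ω, G x i * φ x = inner ℝ p.2 G}, fun u G => ⟨?_, ?_⟩⟩
  · rintro hG p ⟨φ, hφ, hc, hs, i, hp⟩
    rw [← (hp u G).1, ← (hp u G).2, hG.2 φ hφ hc hs i, neg_add_cancel]
  · intro h
    refine ⟨Lp.memLp G, fun φ hφ hc hs i => ?_⟩
    obtain ⟨p, hp⟩ := hrep φ hφ hc i
    rw [(hp u G).1, (hp u G).2]
    exact eq_neg_of_add_eq_zero_left (h p ⟨φ, hφ, hc, hs, i, hp⟩)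

/-- The Hilbert space `L²(Ω) × L²(Ω)^d × ℝ^L` in which `H¹(Ω) × ℝ_⋄^L` is realized. -/
abbrev Ambient (Ω : Set (EuclideanSpace ℝ (Fin d))) (L : ℕ) : Type :=
  WithLp 2 (Lp ℝ 2 (volume.restrict Ω) ×
    WithLp 2 (Lp (EuclideanSpace ℝ (Fin d)) 2 (volume.restrict Ω) × EuclideanSpace ℝ (Fin L)))

/-- The space `H¹(Ω) × ℝ_⋄^L`, as the triples `(u, ∇u, U)` with `∑ U_l = 0`. -/
def cemSpace (Ω : Set (EuclideanSpace ℝ (Fin d))) (L : ℕ) : Submodule ℝ (Ambient Ω L) where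
  carrier := {w | IsWeakGradient Ω w.fst w.snd.fst ∧ ∑ l, w.snd.snd l = 0}
  add_mem' := by
    obtain ⟨P, hP⟩ := exists_isWeakGradient_iff_inner Ω
    rintro w w' ⟨h1, h2⟩ ⟨h1', h2'⟩
    rw [hP] at h1 h1'
    refine ⟨(hP _ _).2 fun p hp => ?_, ?_⟩
    · have e1 := h1 p hp
      have e2 := h1' p hp
      simp only [WithLp.add_fst, WithLp.add_snd, inner_add_right]
      linarith
    · simp only [WithLp.add_snd, PiLp.add_apply, Finset.sum_add_distrib, h2, h2', add_zero]
  zero_mem' := by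
    obtain ⟨P, hP⟩ := exists_isWeakGradient_iff_inner Ω
    exact ⟨(hP _ _).2 fun p _ => by simp, by simp⟩
  smul_mem' := by
    obtain ⟨P, hP⟩ := exists_isWeakGradient_iff_inner Ω
    rintro c w ⟨h1, h2⟩
    rw [hP] at h1
    refine ⟨(hP _ _).2 fun p hp => ?_, ?_⟩
    · have e1 := h1 p hp
      simp only [WithLp.smul_fst, WithLp.smul_snd, real_inner_smul_right]
      rw [← mul_add, e1, mul_zero]
    · simp only [WithLp.smul_snd, PiLp.smul_apply, smul_eq_mul, ← Finset.mul_sum, h2, mul_zero]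

theorem isClosed_cemSpace (Ω : Set (EuclideanSpace ℝ (Fin d))) (L : ℕ) :
    IsClosed (cemSpace Ω L : Set (Ambient Ω L)) := by
  obtain ⟨P, hP⟩ := exists_isWeakGradient_iff_inner Ω
  have h1 : Continuous fun w : Ambient Ω L => w.fst := (WithLp.fstL 2 ℝ _ _).continuous
  have h2 : Continuous fun w : Ambient Ω L => w.snd.fst :=
    (WithLp.fstL 2 ℝ _ _).continuous.comp (WithLp.sndL 2 ℝ _ _).continuous
  have h3 : Continuous fun w : Ambient Ω L => w.snd.snd :=
    (WithLp.sndL 2 ℝ _ _).continuous.comp (WithLp.sndL 2 ℝ _ _).continuous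
  have e : (cemSpace Ω L : Set (Ambient Ω L)) =
      (⋂ p ∈ P, {w | inner ℝ p.1 w.fst + inner ℝ p.2 w.snd.fst = 0}) ∩
        {w | ∑ l, w.snd.snd l = 0} := by
    ext w
    show IsWeakGradient Ω w.fst w.snd.fst ∧ _ ↔ _
    rw [hP]
    simp
  rw [e]
  refine (isClosed_biInter fun p _ => isClosed_eq ?_ continuous_const).inter
    (isClosed_eq ?_ continuous_const)
  · exact (continuous_const.inner h1).add (continuous_const.inner h2)
  · fun_prop

instance (Ω : Set (EuclideanSpace ℝ (Fin d))) (L : ℕ) : CompleteSpace (cemSpace Ω L) :=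
  (isClosed_cemSpace Ω L).completeSpace_coe

theorem norm_sq_eq (w : Ambient Ω L) :
    ‖w‖ ^ 2 = ‖w.fst‖ ^ 2 + (‖w.snd.fst‖ ^ 2 + ‖w.snd.snd‖ ^ 2) := by
  rw [WithLp.prod_norm_sq_eq_of_L2, WithLp.prod_norm_sq_eq_of_L2]

theorem trace_congr {v : EuclideanSpace ℝ (Fin d) → ℝ} (h : u =ᵐ[volume.restrict Ω] v) :
    trace Ω u = trace Ω v := by
  ext x
  have : ∀ r, ⨍ y in Metric.ball x r ∩ Ω, u y = ⨍ y in Metric.ball x r ∩ Ω, v y := fun r =>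
    average_congr (h.filter_mono (ae_mono (Measure.restrict_mono Set.inter_subset_right le_rfl)))
  simp only [trace, this]

theorem HasTrace.trace_add {v : EuclideanSpace ℝ (Fin d) → ℝ} {x : EuclideanSpace ℝ (Fin d)}
    (hu : HasTrace Ω u x) (hv : HasTrace Ω v x) (hui : IntegrableOn u Ω) (hvi : IntegrableOn v Ω) :
    trace Ω (u + v) x = trace Ω u x + trace Ω v x := by
  refine (hasTrace_of_tendsto ?_).1
  refine (hu.add hv).congr fun r => ?_
  rw [setAverage_eq, setAverage_eq, setAverage_eq, ← smul_add]
  congr 1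
  exact (integral_add (hui.mono_set Set.inter_subset_right)
    (hvi.mono_set Set.inter_subset_right)).symm

theorem HasTrace.trace_smul {x : EuclideanSpace ℝ (Fin d)} (hu : HasTrace Ω u x) (c : ℝ) :
    trace Ω (c • u) x = c * trace Ω u x := by
  refine (hasTrace_of_tendsto ?_).1
  refine (hu.const_mul c).congr fun r => ?_
  rw [setAverage_eq, setAverage_eq]
  simp only [Pi.smul_apply, smul_eq_mul, integral_const_mul]
  ring

/-- The trace operator `H¹(Ω) → L²(e)` is well defined and bounded. -/
theorem exists_trace_bound (hd : 1 ≤ d) (hΩ : IsPolyhedralDomain Ω)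
    {e : Set (EuclideanSpace ℝ (Fin d))} (hem : MeasurableSet e) (he : e ⊆ frontier Ω) :
    ∃ C : ENNReal, C ≠ ⊤ ∧ ∀ u G, MemLp u 2 (volume.restrict Ω) → IsWeakGradient Ω u G →
      (∀ᵐ x ∂(surfaceMeasure d).restrict e, HasTrace Ω u x) ∧
      AEStronglyMeasurable (trace Ω u) ((surfaceMeasure d).restrict e) ∧
      ∫⁻ x in e, ‖trace Ω u x‖ₑ ^ 2 ∂(surfaceMeasure d) ≤
        C * ((∫⁻ x in Ω, ‖u x‖ₑ ^ 2) + ∫⁻ x in Ω, ‖G x‖ₑ ^ 2) := by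
  obtain ⟨H, hH0, hH⟩ := hΩ.frontier_subset
  have hb := hΩ.isBounded
  obtain ⟨x₀, hx₀⟩ := hΩ.isConnected.nonempty
  obtain ⟨r₀, hr₀, h₀⟩ := Metric.isOpen_iff.1 hΩ.isOpen x₀ hx₀
  obtain ⟨C, hC, hCle⟩ := exists_trace_const hd hΩ hH0 hH hr₀ h₀ hem he
  have hνt : surfaceMeasure d e < ⊤ :=
    surfaceMeasure_lt_top hH0 ((hb.closure.subset frontier_subset_closure).subset he) (he.trans hH)
  set B := Metric.ball x₀ r₀ with hB
  have hB0 : volume B ≠ 0 := (Metric.measure_ball_pos volume x₀ hr₀).ne'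
  have hBt : (volume B)⁻¹ ≠ ⊤ := by simpa using hB0
  refine ⟨2 * (C + (volume B)⁻¹ * surfaceMeasure d e), by finiteness, fun u G hu hG => ?_⟩
  obtain ⟨htr, hle⟩ := hCle u G hu hG
  refine ⟨htr, aestronglyMeasurable_trace hu.1 htr, ?_⟩
  have : NeZero (volume.restrict B) := ⟨by simpa using hB0⟩
  have : IsFiniteMeasure (volume.restrict B) := ⟨by simpa using (hb.subset h₀).measure_lt_top⟩
  have hm : ‖⨍ y in B, u y‖ₑ ^ 2 ≤ (volume B)⁻¹ * ∫⁻ x in Ω, ‖u x‖ₑ ^ 2 := by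
    have := enorm_average_sub_sq_le (μ := volume.restrict B)
      ((integrableOn_of_memLp_two hb hu).mono_set h₀) 0
    simp only [sub_zero, Measure.restrict_apply_univ] at this
    refine this.trans ?_
    gcongr
  set m := ⨍ y in B, u y with hmdef
  calc ∫⁻ x in e, ‖trace Ω u x‖ₑ ^ 2 ∂(surfaceMeasure d)
      ≤ ∫⁻ x in e, 2 * (‖trace Ω u x - m‖ₑ ^ 2 + ‖m‖ₑ ^ 2) ∂(surfaceMeasure d) :=
        lintegral_mono fun x => by simpa using enorm_add_sq_le (trace Ω u x - m) m
    _ = 2 * ((∫⁻ x in e, ‖trace Ω u x - m‖ₑ ^ 2 ∂(surfaceMeasure d)) +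
          ‖m‖ₑ ^ 2 * surfaceMeasure d e) := by
        rw [lintegral_const_mul' _ _ (by norm_num), lintegral_add_right _ measurable_const,
          setLIntegral_const]
    _ ≤ 2 * (C * (∫⁻ x in Ω, ‖G x‖ₑ ^ 2) +
          ((volume B)⁻¹ * ∫⁻ x in Ω, ‖u x‖ₑ ^ 2) * surfaceMeasure d e) := by gcongr
    _ = 2 * (C * (∫⁻ x in Ω, ‖G x‖ₑ ^ 2) +
          (volume B)⁻¹ * surfaceMeasure d e * ∫⁻ x in Ω, ‖u x‖ₑ ^ 2) := by ring
    _ ≤ 2 * ((C + (volume B)⁻¹ * surfaceMeasure d e) * (∫⁻ x in Ω, ‖G x‖ₑ ^ 2) +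
          (C + (volume B)⁻¹ * surfaceMeasure d e) * ∫⁻ x in Ω, ‖u x‖ₑ ^ 2) := by
        gcongr
        · exact le_self_add
        · exact le_add_self
    _ = _ := by ring

end CEM

/-! ### The variational form -/

namespace CEM
variable {d L : ℕ} {Ω : Set (EuclideanSpace ℝ (Fin d))} {u : EuclideanSpace ℝ (Fin d) → ℝ}
  {G : EuclideanSpace ℝ (Fin d) → EuclideanSpace ℝ (Fin d)}

theorem cemSpace_sum_eq_zero (w : cemSpace Ω L) : ∑ l, w.1.snd.snd l = 0 := w.2.2

theorem isFiniteMeasure_surfaceMeasure_restrict (hΩ : IsPolyhedralDomain Ω)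
    {e : Set (EuclideanSpace ℝ (Fin d))} (he : e ⊆ frontier Ω) :
    IsFiniteMeasure ((surfaceMeasure d).restrict e) := by
  obtain ⟨H, hH0, hH⟩ := hΩ.frontier_subset
  refine ⟨?_⟩
  rw [Measure.restrict_apply_univ]
  exact surfaceMeasure_lt_top hH0
    ((hΩ.isBounded.closure.subset frontier_subset_closure).subset he) (he.trans hH)

theorem memLp_trace (hd : 1 ≤ d) (hΩ : IsPolyhedralDomain Ω)
    {e : Set (EuclideanSpace ℝ (Fin d))} (hem : MeasurableSet e) (he : e ⊆ frontier Ω)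
    (hu : MemLp u 2 (volume.restrict Ω)) (hG : IsWeakGradient Ω u G) :
    MemLp (trace Ω u) 2 ((surfaceMeasure d).restrict e) := by
  obtain ⟨C, hC, h⟩ := exists_trace_bound hd hΩ hem he
  obtain ⟨-, h1, h2⟩ := h u G hu hG
  refine memLp_two_of_lintegral_lt_top h1 (h2.trans_lt ?_)
  rw [lintegral_enorm_sq_eq_of_memLp hu, lintegral_enorm_sq_eq_of_memLp hG.1]
  finiteness

/-- The voltage drop `u - U_l` over the `l`-th contact layer. -/
noncomputable def jumpFun (w : cemSpace Ω L) (l : Fin L) (x : EuclideanSpace ℝ (Fin d)) : ℝ :=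
  trace Ω w.1.fst x - w.1.snd.snd l

theorem memLp_jumpFun (hd : 1 ≤ d) (hΩ : IsPolyhedralDomain Ω)
    {e : Set (EuclideanSpace ℝ (Fin d))} (hem : MeasurableSet e) (he : e ⊆ frontier Ω)
    (w : cemSpace Ω L) (l : Fin L) :
    MemLp (jumpFun w l) 2 ((surfaceMeasure d).restrict e) := by
  have := isFiniteMeasure_surfaceMeasure_restrict hΩ he
  exact (memLp_trace hd hΩ hem he (Lp.memLp _) w.2.1).sub (memLp_const _)

theorem ae_jumpFun_add (hd : 1 ≤ d) (hΩ : IsPolyhedralDomain Ω)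
    {e : Set (EuclideanSpace ℝ (Fin d))} (hem : MeasurableSet e) (he : e ⊆ frontier Ω)
    (w w' : cemSpace Ω L) (l : Fin L) :
    jumpFun (w + w') l =ᵐ[(surfaceMeasure d).restrict e] jumpFun w l + jumpFun w' l := by
  obtain ⟨C, hC, h⟩ := exists_trace_bound hd hΩ hem he
  have hcongr : trace Ω (w + w').1.fst = trace Ω (⇑w.1.fst + ⇑w'.1.fst) :=
    trace_congr (Lp.coeFn_add _ _)
  have hU : (w + w').1.snd.snd l = w.1.snd.snd l + w'.1.snd.snd l := rfl
  filter_upwards [(h _ _ (Lp.memLp _) w.2.1).1, (h _ _ (Lp.memLp _) w'.2.1).1] with x h1 h2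
  simp only [jumpFun, Pi.add_apply]
  rw [hcongr, hU, h1.trace_add h2 (integrableOn_of_memLp_two hΩ.isBounded (Lp.memLp _))
    (integrableOn_of_memLp_two hΩ.isBounded (Lp.memLp _))]
  ring

theorem ae_jumpFun_smul (hd : 1 ≤ d) (hΩ : IsPolyhedralDomain Ω)
    {e : Set (EuclideanSpace ℝ (Fin d))} (hem : MeasurableSet e) (he : e ⊆ frontier Ω)
    (c : ℝ) (w : cemSpace Ω L) (l : Fin L) :
    jumpFun (c • w) l =ᵐ[(surfaceMeasure d).restrict e] c • jumpFun w l := by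
  obtain ⟨C, hC, h⟩ := exists_trace_bound hd hΩ hem he
  have hcongr : trace Ω (c • w).1.fst = trace Ω (c • ⇑w.1.fst) :=
    trace_congr (Lp.coeFn_smul _ _)
  have hU : (c • w).1.snd.snd l = c * w.1.snd.snd l := rfl
  filter_upwards [(h _ _ (Lp.memLp _) w.2.1).1] with x h1
  simp only [jumpFun, Pi.smul_apply, smul_eq_mul]
  rw [hcongr, hU, h1.trace_smul c]
  ring

theorem exists_norm_jumpFun_le (hd : 1 ≤ d) (hΩ : IsPolyhedralDomain Ω)
    {e : Set (EuclideanSpace ℝ (Fin d))} (hem : MeasurableSet e) (he : e ⊆ frontier Ω)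
    (l : Fin L) : ∃ C : ℝ, ∀ w : cemSpace Ω L,
    ‖(memLp_jumpFun hd hΩ hem he w l).toLp‖ ≤ C * ‖w‖ := by
  have hfin := isFiniteMeasure_surfaceMeasure_restrict hΩ he
  obtain ⟨C, hC, h⟩ := exists_trace_bound hd hΩ hem he
  have hνt : surfaceMeasure d e ≠ ⊤ := by
    simpa using (measure_lt_top ((surfaceMeasure d).restrict e) Set.univ).ne
  set K : ENNReal := 2 * (C + surfaceMeasure d e) with hK
  refine ⟨Real.sqrt K.toReal, fun w => ?_⟩
  rw [← abs_of_nonneg (norm_nonneg (MemLp.toLp _ _)), ← Real.sqrt_sq (norm_nonneg w),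
    ← Real.sqrt_mul ENNReal.toReal_nonneg]
  refine Real.abs_le_sqrt ?_
  have h1 := (h _ _ (Lp.memLp w.1.fst) w.2.1).2.2
  rw [lintegral_enorm_sq_coe, lintegral_enorm_sq_coe, ← ENNReal.ofReal_add (by positivity)
    (by positivity)] at h1
  have h2 : ENNReal.ofReal (‖(memLp_jumpFun hd hΩ hem he w l).toLp‖ ^ 2) ≤
      K * ENNReal.ofReal (‖w‖ ^ 2) := by
    rw [← lintegral_enorm_sq_eq_of_memLp]
    have hU : ‖w.1.snd.snd l‖ₑ ^ 2 ≤ ENNReal.ofReal (‖w.1.snd.snd‖ ^ 2) := by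
      rw [← ofReal_norm, ← ENNReal.ofReal_pow (norm_nonneg _)]
      apply ENNReal.ofReal_le_ofReal
      gcongr
      exact PiLp.norm_apply_le _ l
    calc ∫⁻ x in e, ‖trace Ω w.1.fst x - w.1.snd.snd l‖ₑ ^ 2 ∂(surfaceMeasure d)
        ≤ ∫⁻ x in e, 2 * (‖trace Ω w.1.fst x‖ₑ ^ 2 + ‖w.1.snd.snd l‖ₑ ^ 2)
            ∂(surfaceMeasure d) := lintegral_mono fun x => by
              simpa using enorm_sub_sq_le_of_mid (trace Ω w.1.fst x) 0 (w.1.snd.snd l)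
      _ = 2 * ((∫⁻ x in e, ‖trace Ω w.1.fst x‖ₑ ^ 2 ∂(surfaceMeasure d)) +
            ‖w.1.snd.snd l‖ₑ ^ 2 * surfaceMeasure d e) := by
          rw [lintegral_const_mul' _ _ (by norm_num), lintegral_add_right _ measurable_const,
            setLIntegral_const]
      _ ≤ 2 * (C * ENNReal.ofReal (‖w‖ ^ 2) + ENNReal.ofReal (‖w‖ ^ 2) * surfaceMeasure d e) := by
          have hw : ‖w‖ ^ 2 = _ := norm_sq_eq w.1
          gcongr 2 * (?_ + ?_ * _)
          · refine h1.trans ?_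
            gcongr
            rw [hw]; nlinarith [sq_nonneg ‖w.1.snd.snd‖]
          · refine hU.trans ?_
            apply ENNReal.ofReal_le_ofReal
            rw [hw]; nlinarith [sq_nonneg ‖w.1.fst‖, sq_nonneg ‖w.1.snd.fst‖]
      _ = K * ENNReal.ofReal (‖w‖ ^ 2) := by rw [hK]; ring
  have hKt : K ≠ ⊤ := by finiteness
  have h3 := ENNReal.toReal_mono (by finiteness) h2
  rw [ENNReal.toReal_mul, ENNReal.toReal_ofReal (by positivity),
    ENNReal.toReal_ofReal (by positivity)] at h3
  exact h3

/-- The voltage drop `(u, U) ↦ u - U_l ∈ L²(e)` over the contact layer as a bounded operator. -/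
noncomputable def jump (hd : 1 ≤ d) (hΩ : IsPolyhedralDomain Ω)
    {e : Set (EuclideanSpace ℝ (Fin d))} (hem : MeasurableSet e) (he : e ⊆ frontier Ω)
    (l : Fin L) :
    cemSpace Ω L →L[ℝ] Lp ℝ 2 ((surfaceMeasure d).restrict e) :=
  LinearMap.mkContinuousOfExistsBound
    { toFun := fun w => (memLp_jumpFun hd hΩ hem he w l).toLp
      map_add' := fun w w' =>
        (MemLp.toLp_eq_toLp_iff _ ((memLp_jumpFun hd hΩ hem he w l).add
          (memLp_jumpFun hd hΩ hem he w' l))).2 (ae_jumpFun_add hd hΩ hem he w w' l)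
      map_smul' := fun c w =>
        (MemLp.toLp_eq_toLp_iff _ ((memLp_jumpFun hd hΩ hem he w l).const_smul c)).2
          (ae_jumpFun_smul hd hΩ hem he c w l) }
    (exists_norm_jumpFun_le hd hΩ hem he l)

theorem coeFn_jump (hd : 1 ≤ d) (hΩ : IsPolyhedralDomain Ω)
    {e : Set (EuclideanSpace ℝ (Fin d))} (hem : MeasurableSet e) (he : e ⊆ frontier Ω)
    (l : Fin L) (w : cemSpace Ω L) :
    jump hd hΩ hem he l w =ᵐ[(surfaceMeasure d).restrict e] jumpFun w l :=
  MemLp.coeFn_toLp (memLp_jumpFun hd hΩ hem he w l)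

theorem lintegral_enorm_jumpFun_sq (hd : 1 ≤ d) (hΩ : IsPolyhedralDomain Ω)
    {e : Set (EuclideanSpace ℝ (Fin d))} (hem : MeasurableSet e) (he : e ⊆ frontier Ω)
    (l : Fin L) (w : cemSpace Ω L) :
    ∫⁻ x in e, ‖jumpFun w l x‖ₑ ^ 2 ∂(surfaceMeasure d) =
      ENNReal.ofReal (‖jump hd hΩ hem he l w‖ ^ 2) :=
  lintegral_enorm_sq_eq_of_memLp (memLp_jumpFun hd hΩ hem he w l)

theorem inner_eq_integral_mul_of_ae_eq {α : Type*} [MeasurableSpace α] {μ : Measure α}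
    {f g : Lp ℝ 2 μ} {f' g' : α → ℝ} (hf : f =ᵐ[μ] f') (hg : g =ᵐ[μ] g') :
    inner ℝ f g = ∫ x, f' x * g' x ∂μ := by
  rw [L2.inner_def]
  refine integral_congr_ae ?_
  filter_upwards [hf, hg] with x h1 h2
  rw [h1, h2]
  simp [mul_comm]

/-- The gradient component of `(u, ∇u, U)`. -/
noncomputable def gradL (Ω : Set (EuclideanSpace ℝ (Fin d))) (L : ℕ) :
    cemSpace Ω L →L[ℝ] Lp (EuclideanSpace ℝ (Fin d)) 2 (volume.restrict Ω) :=
  (WithLp.fstL 2 ℝ _ _).comp ((WithLp.sndL 2 ℝ _ _).comp (cemSpace Ω L).subtypeL)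

theorem gradL_apply (w : cemSpace Ω L) : gradL Ω L w = w.1.snd.fst := rfl

/-- The electrode component of `(u, ∇u, U)`. -/
noncomputable def electrodeL (Ω : Set (EuclideanSpace ℝ (Fin d))) (L : ℕ) :
    cemSpace Ω L →L[ℝ] EuclideanSpace ℝ (Fin L) :=
  (WithLp.sndL 2 ℝ _ _).comp ((WithLp.sndL 2 ℝ _ _).comp (cemSpace Ω L).subtypeL)

theorem electrodeL_apply (w : cemSpace Ω L) : electrodeL Ω L w = w.1.snd.snd := rfl

/-- Multiplication by a bounded coefficient on `L²(Ω)^d`. -/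
noncomputable def mulL (σ : Lp ℝ ⊤ (volume.restrict Ω)) :
    Lp (EuclideanSpace ℝ (Fin d)) 2 (volume.restrict Ω) →L[ℝ]
      Lp (EuclideanSpace ℝ (Fin d)) 2 (volume.restrict Ω) :=
  (ContinuousLinearMap.lsmul ℝ ℝ).holderL (volume.restrict Ω) ⊤ 2 2 σ

theorem coeFn_mulL (σ : Lp ℝ ⊤ (volume.restrict Ω))
    (F : Lp (EuclideanSpace ℝ (Fin d)) 2 (volume.restrict Ω)) :
    mulL σ F =ᵐ[volume.restrict Ω] fun x => σ x • F x :=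
  ContinuousLinearMap.coeFn_holder (r := 2) (ContinuousLinearMap.lsmul ℝ ℝ) σ F

/-- The inner product of `F` as a bounded bilinear map. -/
noncomputable def innerBilin (F : Type*) [NormedAddCommGroup F] [InnerProductSpace ℝ F] :
    F →L[ℝ] F →L[ℝ] ℝ :=
  (isBoundedBilinearMap_inner (𝕜 := ℝ) (E := F)).toContinuousLinearMap

/-- The variational form of the complete electrode model on `H¹(Ω) × ℝ_⋄^L`. -/
noncomputable def bilin (hd : 1 ≤ d) (hΩ : IsPolyhedralDomain Ω)
    {e : Fin L → Set (EuclideanSpace ℝ (Fin d))} (he : IsElectrodeFamily Ω e) (z : Fin L → ℝ)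
    (σ : Lp ℝ ⊤ (volume.restrict Ω)) : cemSpace Ω L →L[ℝ] cemSpace Ω L →L[ℝ] ℝ :=
  (innerBilin (Lp (EuclideanSpace ℝ (Fin d)) 2 (volume.restrict Ω))).bilinearComp
      ((mulL σ).comp (gradL Ω L)) (gradL Ω L) +
    ∑ l, (z l)⁻¹ • (innerBilin (Lp ℝ 2 ((surfaceMeasure d).restrict (e l)))).bilinearComp
      (jump hd hΩ (he.measurableSet l) (he.subset_frontier l) l)
      (jump hd hΩ (he.measurableSet l) (he.subset_frontier l) l)

theorem bilin_apply (hd : 1 ≤ d) (hΩ : IsPolyhedralDomain Ω)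
    {e : Fin L → Set (EuclideanSpace ℝ (Fin d))} (he : IsElectrodeFamily Ω e) (z : Fin L → ℝ)
    (σ : Lp ℝ ⊤ (volume.restrict Ω)) (w w' : cemSpace Ω L) :
    bilin hd hΩ he z σ w w' = inner ℝ (mulL σ (gradL Ω L w)) (gradL Ω L w') +
      ∑ l, (z l)⁻¹ * inner ℝ (jump hd hΩ (he.measurableSet l) (he.subset_frontier l) l w)
        (jump hd hΩ (he.measurableSet l) (he.subset_frontier l) l w') := by
  simp only [bilin, add_apply, sum_apply, smul_apply, smul_eq_mul]
  rfl

theorem weakGrad_spec (hu : ∃ G, IsWeakGradient Ω u G) : IsWeakGradient Ω u (weakGrad Ω u) := by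
  rw [weakGrad, dif_pos hu]
  exact hu.choose_spec

theorem weakGrad_ae_eq (hΩ : IsPolyhedralDomain Ω) {v : EuclideanSpace ℝ (Fin d) → ℝ}
    (huv : u =ᵐ[volume.restrict Ω] v) (hG : IsWeakGradient Ω v G) :
    weakGrad Ω u =ᵐ[volume.restrict Ω] G := by
  have hu : IsWeakGradient Ω u G := hG.congr huv.symm EventuallyEq.rfl
  exact (weakGrad_spec ⟨G, hu⟩).ae_eq hΩ.isOpen hΩ.isBounded huv hG

theorem memH1_of_cemSpace (w : cemSpace Ω L) : MemH1 Ω w.1.fst :=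
  ⟨Lp.memLp _, _, w.2.1⟩

/-- The functional form agrees with the concrete one. -/
theorem form_eq_bilin (hd : 1 ≤ d) (hΩ : IsPolyhedralDomain Ω)
    {e : Fin L → Set (EuclideanSpace ℝ (Fin d))} (he : IsElectrodeFamily Ω e) (z : Fin L → ℝ)
    {σ : EuclideanSpace ℝ (Fin d) → ℝ} {σ' : Lp ℝ ⊤ (volume.restrict Ω)}
    (hσ : σ =ᵐ[volume.restrict Ω] σ') {v : EuclideanSpace ℝ (Fin d) → ℝ} {w w' : cemSpace Ω L}
    (hu : u =ᵐ[volume.restrict Ω] w.1.fst) (hv : v =ᵐ[volume.restrict Ω] w'.1.fst) :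
    form Ω e z σ u w.1.snd.snd v w'.1.snd.snd = bilin hd hΩ he z σ' w w' := by
  rw [bilin_apply, form, trace_congr hu, trace_congr hv]
  congr 1
  · rw [L2.inner_def, gradL_apply, gradL_apply]
    refine integral_congr_ae ?_
    filter_upwards [coeFn_mulL σ' w.1.snd.fst, weakGrad_ae_eq hΩ hu w.2.1,
      weakGrad_ae_eq hΩ hv w'.2.1, hσ] with x h1 h2 h3 h4
    rw [h1, h2, h3, h4, real_inner_smul_left]
  · refine Finset.sum_congr rfl fun l _ => ?_
    rw [inner_eq_integral_mul_of_ae_eq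
      (coeFn_jump hd hΩ (he.measurableSet l) (he.subset_frontier l) l w)
      (coeFn_jump hd hΩ (he.measurableSet l) (he.subset_frontier l) l w')]
    rfl

theorem exists_cemSpace_of_memH1 (hu : MemH1 Ω u) {U : EuclideanSpace ℝ (Fin L)}
    (hU : ∑ l, U l = 0) : ∃ w : cemSpace Ω L, u =ᵐ[volume.restrict Ω] w.1.fst ∧
      w.1.snd.snd = U := by
  obtain ⟨hu2, G, hG⟩ := hu
  refine ⟨⟨WithLp.toLp 2 (hu2.toLp u, WithLp.toLp 2 (hG.1.toLp G, U)), ?_, hU⟩, ?_, rfl⟩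
  · exact hG.congr hu2.coeFn_toLp.symm hG.1.coeFn_toLp.symm
  · exact hu2.coeFn_toLp.symm

-- From here on these operators are used through their evaluation lemmas only; unfolding them makes
-- unification over the nested `Lp` spaces very slow.
attribute [irreducible] jump gradL electrodeL mulL bilin

end CEM

/-! ### Coercivity and the Lax–Milgram theorem -/

namespace CEM
variable {d L : ℕ} {Ω : Set (EuclideanSpace ℝ (Fin d))} {u : EuclideanSpace ℝ (Fin d) → ℝ}
  {G : EuclideanSpace ℝ (Fin d) → EuclideanSpace ℝ (Fin d)}

/-- The energy controls the full norm of `H¹(Ω) × ℝ_⋄^L`. With `m` an interior average of `u`, both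
`u - m` and its traces are controlled by `∇u`, hence so is each `m - U_l` up to the voltage
drops; since the `U_l` sum to zero one of them has the sign opposite to `m`, which bounds `m`. -/
theorem exists_lintegral_norm_sq_le (hd : 1 ≤ d) (hL : 1 ≤ L) (hΩ : IsPolyhedralDomain Ω)
    {e : Fin L → Set (EuclideanSpace ℝ (Fin d))} (he : IsElectrodeFamily Ω e) :
    ∃ K : ENNReal, K ≠ ⊤ ∧ ∀ w : cemSpace Ω L,
      (∫⁻ x in Ω, ‖w.1.fst x‖ₑ ^ 2) + (∫⁻ x in Ω, ‖w.1.snd.fst x‖ₑ ^ 2) +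
        ∑ l, ‖w.1.snd.snd l‖ₑ ^ 2 ≤
      K * ((∫⁻ x in Ω, ‖w.1.snd.fst x‖ₑ ^ 2) +
        ∑ l, ∫⁻ x in e l, ‖jumpFun w l x‖ₑ ^ 2 ∂(surfaceMeasure d)) := by
  obtain ⟨H, hH0, hH⟩ := hΩ.frontier_subset
  have hb := hΩ.isBounded
  obtain ⟨x₀, hx₀⟩ := hΩ.isConnected.nonempty
  obtain ⟨r₀, hr₀, h₀⟩ := Metric.isOpen_iff.1 hΩ.isOpen x₀ hx₀
  obtain ⟨C₀, hC₀, hC₀le⟩ := exists_poincare_const hΩ.isOpen hΩ.isConnected.isPreconnected hb hH0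
    hH hr₀ h₀
  have hC : ∀ l, _ := fun l => exists_trace_const hd hΩ hH0 hH hr₀ h₀ (he.measurableSet l)
    (he.subset_frontier l)
  choose C hCt hCle using hC
  have hνt : ∀ l, surfaceMeasure d (e l) ≠ ⊤ := fun l => by
    have := isFiniteMeasure_surfaceMeasure_restrict hΩ (he.subset_frontier l)
    simpa using (measure_lt_top ((surfaceMeasure d).restrict (e l)) Set.univ).ne
  have hΩt : volume Ω ≠ ⊤ := hb.measure_lt_top.ne
  set Q : Fin L → ENNReal := fun l => (surfaceMeasure d (e l))⁻¹ * (2 * (C l + 1)) with hQ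
  have hQt : ∀ l, Q l ≠ ⊤ := fun l => by
    have h1 := hCt l
    have h2 : (surfaceMeasure d (e l))⁻¹ ≠ ⊤ := by simpa using (he.measure_pos l).ne'
    simp only [hQ]
    finiteness
  set Q' : ENNReal := ∑ l, Q l with hQ'
  have hQt' : Q' ≠ ⊤ := ENNReal.sum_ne_top.2 fun l _ => hQt l
  have hS : ∑ l, 2 * (Q l + Q') ≠ ⊤ := ENNReal.sum_ne_top.2 fun l _ => by
    have := hQt l
    finiteness
  refine ⟨2 * (C₀ + volume Ω * Q') + 1 + ∑ l, 2 * (Q l + Q'), by finiteness, fun w => ?_⟩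
  set m := ⨍ y in Metric.ball x₀ r₀, w.1.fst y with hm
  set a := ∫⁻ x in Ω, ‖w.1.snd.fst x‖ₑ ^ 2 with ha
  set J : Fin L → ENNReal := fun l => ∫⁻ x in e l, ‖jumpFun w l x‖ₑ ^ 2 ∂(surfaceMeasure d) with hJ
  set T := a + ∑ l, J l with hT
  have haT : a ≤ T := le_self_add
  have hJT : ∀ l, J l ≤ T := fun l =>
    (Finset.single_le_sum (f := J) (fun _ _ => zero_le) (Finset.mem_univ l)).trans le_add_self
  have hmU : ∀ l, ‖m - w.1.snd.snd l‖ₑ ^ 2 ≤ Q l * T := by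
    intro l
    have h1 : ‖m - w.1.snd.snd l‖ₑ ^ 2 * surfaceMeasure d (e l) ≤ 2 * (C l + 1) * T := by
      calc ‖m - w.1.snd.snd l‖ₑ ^ 2 * surfaceMeasure d (e l)
          = ∫⁻ x in e l, ‖m - w.1.snd.snd l‖ₑ ^ 2 ∂(surfaceMeasure d) := (setLIntegral_const _ _).symm
        _ ≤ ∫⁻ x in e l, 2 * (‖trace Ω w.1.fst x - m‖ₑ ^ 2 + ‖jumpFun w l x‖ₑ ^ 2)
              ∂(surfaceMeasure d) := by
            refine lintegral_mono fun x => ?_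
            have := enorm_sub_sq_le_of_mid m (trace Ω w.1.fst x) (w.1.snd.snd l)
            rwa [← enorm_neg (m - trace Ω w.1.fst x), neg_sub] at this
        _ = 2 * ((∫⁻ x in e l, ‖trace Ω w.1.fst x - m‖ₑ ^ 2 ∂(surfaceMeasure d)) + J l) := by
            have hjm := (memLp_jumpFun hd hΩ (he.measurableSet l) (he.subset_frontier l) w l).1
            rw [lintegral_const_mul' _ _ (by norm_num), lintegral_add_right' _ (hjm.enorm.pow_const 2)]
        _ ≤ 2 * (C l * T + T) := by
            gcongr
            · exact ((hCle l _ _ (Lp.memLp _) w.2.1).2).trans (by gcongr)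
            · exact hJT l
        _ = _ := by ring
    have h2 := ENNReal.le_div_iff_mul_le (b := surfaceMeasure d (e l))
      (Or.inl (he.measure_pos l).ne') (Or.inl (hνt l)) |>.2 h1
    refine h2.trans (le_of_eq ?_)
    rw [ENNReal.div_eq_inv_mul, hQ]; ring
  -- since `∑ U_l = 0`, some `U_l` satisfies `m * U_l ≤ 0`, whence `|m| ≤ |m - U_l|`
  have hm2 : ‖m‖ₑ ^ 2 ≤ Q' * T := by
    have hne : (Finset.univ : Finset (Fin L)).Nonempty := ⟨⟨0, hL⟩, Finset.mem_univ _⟩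
    obtain ⟨l, -, hl⟩ := Finset.exists_le_of_sum_le (f := fun l => m * w.1.snd.snd l)
      (g := fun _ => 0) hne (by rw [← Finset.mul_sum, cemSpace_sum_eq_zero w]; simp)
    have h1 : ‖m‖ₑ ^ 2 ≤ ‖m - w.1.snd.snd l‖ₑ ^ 2 := by
      gcongr
      rw [← ofReal_norm, ← ofReal_norm]
      apply ENNReal.ofReal_le_ofReal
      rw [Real.norm_eq_abs, Real.norm_eq_abs]
      apply sq_le_sq.1
      nlinarith [sq_nonneg (w.1.snd.snd l)]
    refine h1.trans ((hmU l).trans ?_)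
    gcongr
    exact Finset.single_le_sum (f := Q) (fun _ _ => zero_le) (Finset.mem_univ l)
  have hu2 : ∫⁻ x in Ω, ‖w.1.fst x‖ₑ ^ 2 ≤ 2 * (C₀ + volume Ω * Q') * T := by
    calc ∫⁻ x in Ω, ‖w.1.fst x‖ₑ ^ 2
        ≤ ∫⁻ x in Ω, 2 * (‖w.1.fst x - m‖ₑ ^ 2 + ‖m‖ₑ ^ 2) :=
          lintegral_mono fun x => by simpa using enorm_add_sq_le (w.1.fst x - m) m
      _ = 2 * ((∫⁻ x in Ω, ‖w.1.fst x - m‖ₑ ^ 2) + ‖m‖ₑ ^ 2 * volume Ω) := by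
          rw [lintegral_const_mul' _ _ (by norm_num), lintegral_add_right _ measurable_const,
            setLIntegral_const]
      _ ≤ 2 * (C₀ * T + (Q' * T) * volume Ω) := by
          gcongr
          exact (hC₀le _ _ (Lp.memLp _) w.2.1).trans (by gcongr)
      _ = _ := by ring
  have hU2 : ∑ l, ‖w.1.snd.snd l‖ₑ ^ 2 ≤ (∑ l, 2 * (Q l + Q')) * T := by
    rw [Finset.sum_mul]
    refine Finset.sum_le_sum fun l _ => ?_
    have h1 := enorm_add_sq_le (w.1.snd.snd l - m) m
    rw [sub_add_cancel, ← enorm_neg (w.1.snd.snd l - m), neg_sub] at h1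
    refine h1.trans ?_
    rw [mul_assoc, add_mul]
    gcongr
    exact hmU l
  calc (∫⁻ x in Ω, ‖w.1.fst x‖ₑ ^ 2) + a + ∑ l, ‖w.1.snd.snd l‖ₑ ^ 2
      ≤ 2 * (C₀ + volume Ω * Q') * T + 1 * T + (∑ l, 2 * (Q l + Q')) * T := by
        gcongr
        rwa [one_mul]
    _ = _ := by ring

theorem exists_norm_sq_le (hd : 1 ≤ d) (hL : 1 ≤ L) (hΩ : IsPolyhedralDomain Ω)
    {e : Fin L → Set (EuclideanSpace ℝ (Fin d))} (he : IsElectrodeFamily Ω e) :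
    ∃ K > 0, ∀ w : cemSpace Ω L, ‖w‖ ^ 2 ≤ K * (‖gradL Ω L w‖ ^ 2 +
      ∑ l, ‖jump hd hΩ (he.measurableSet l) (he.subset_frontier l) l w‖ ^ 2) := by
  obtain ⟨K, hK, h⟩ := exists_lintegral_norm_sq_le hd hL hΩ he
  refine ⟨K.toReal + 1, by positivity, fun w => ?_⟩
  have h1 := h w
  have hUl : ∑ l, ‖w.1.snd.snd l‖ₑ ^ 2 = ENNReal.ofReal (‖w.1.snd.snd‖ ^ 2) := by
    rw [EuclideanSpace.norm_sq_eq, ENNReal.ofReal_sum_of_nonneg fun _ _ => by positivity]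
    refine Finset.sum_congr rfl fun l _ => ?_
    rw [ENNReal.ofReal_pow (norm_nonneg _), ofReal_norm]
  simp only [fun l => lintegral_enorm_jumpFun_sq hd hΩ (he.measurableSet l) (he.subset_frontier l) l w,
    hUl, lintegral_enorm_sq_coe] at h1
  rw [← ENNReal.ofReal_add (by positivity) (by positivity),
    ← ENNReal.ofReal_add (by positivity) (by positivity),
    ← ENNReal.ofReal_sum_of_nonneg fun _ _ => by positivity,
    ← ENNReal.ofReal_add (by positivity) (Finset.sum_nonneg fun _ _ => by positivity)] at h1
  have h2 := ENNReal.toReal_mono (by finiteness) h1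
  rw [ENNReal.toReal_mul, ENNReal.toReal_ofReal (by positivity), ENNReal.toReal_ofReal
    (add_nonneg (by positivity) (Finset.sum_nonneg fun _ _ => by positivity))] at h2
  have hw : ‖w‖ ^ 2 = _ := norm_sq_eq w.1
  rw [hw, gradL_apply]
  rw [add_mul, one_mul]
  have h3 : 0 ≤ ‖w.1.snd.fst‖ ^ 2 +
      ∑ l, ‖jump hd hΩ (he.measurableSet l) (he.subset_frontier l) l w‖ ^ 2 :=
    add_nonneg (by positivity) (Finset.sum_nonneg fun _ _ => by positivity)
  linarith

theorem le_inner_mulL_self {c : ℝ} {σ : Lp ℝ ⊤ (volume.restrict Ω)}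
    (hσ : ∀ᵐ x ∂(volume.restrict Ω), c ≤ σ x)
    (F : Lp (EuclideanSpace ℝ (Fin d)) 2 (volume.restrict Ω)) :
    c * ‖F‖ ^ 2 ≤ inner ℝ (mulL σ F) F := by
  rw [← real_inner_self_eq_norm_sq, ← real_inner_smul_left, ← sub_nonneg, ← inner_sub_left,
    L2.inner_def]
  refine integral_nonneg_of_ae ?_
  filter_upwards [hσ, Lp.coeFn_sub (mulL σ F) (c • F), coeFn_mulL σ F, Lp.coeFn_smul c F]
    with x h1 h2 h3 h4
  rw [h2, Pi.sub_apply, h3, h4, Pi.smul_apply, ← sub_smul, real_inner_smul_left,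
    real_inner_self_eq_norm_sq]
  exact mul_nonneg (sub_nonneg.2 h1) (sq_nonneg _)

theorem mul_energy_le_bilin (hd : 1 ≤ d) (hΩ : IsPolyhedralDomain Ω)
    {e : Fin L → Set (EuclideanSpace ℝ (Fin d))} (he : IsElectrodeFamily Ω e) {z : Fin L → ℝ}
    {c κ : ℝ} (hc : κ ≤ c) (hz : ∀ l, κ ≤ (z l)⁻¹) {σ : Lp ℝ ⊤ (volume.restrict Ω)}
    (hσ : ∀ᵐ x ∂(volume.restrict Ω), c ≤ σ x) (w : cemSpace Ω L) :
    κ * (‖gradL Ω L w‖ ^ 2 +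
      ∑ l, ‖jump hd hΩ (he.measurableSet l) (he.subset_frontier l) l w‖ ^ 2) ≤
      bilin hd hΩ he z σ w w := by
  rw [bilin_apply, mul_add, Finset.mul_sum]
  refine add_le_add ?_ (Finset.sum_le_sum fun l _ => ?_)
  · exact (mul_le_mul_of_nonneg_right hc (sq_nonneg _)).trans (le_inner_mulL_self hσ _)
  · rw [real_inner_self_eq_norm_sq]
    exact mul_le_mul_of_nonneg_right (hz l) (sq_nonneg _)

set_option maxHeartbeats 600000 in
/-- The variational form is coercive, uniformly over all conductivities bounded below by `c`. -/
theorem exists_coercive (hd : 1 ≤ d) (hL : 1 ≤ L) (hΩ : IsPolyhedralDomain Ω)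
    {e : Fin L → Set (EuclideanSpace ℝ (Fin d))} (he : IsElectrodeFamily Ω e) {z : Fin L → ℝ}
    (hz : ∀ l, 0 < z l) {c : ℝ} (hc : 0 < c) :
    ∃ κ > 0, ∀ σ : Lp ℝ ⊤ (volume.restrict Ω), (∀ᵐ x ∂(volume.restrict Ω), c ≤ σ x) →
      ∀ w : cemSpace Ω L, κ * ‖w‖ * ‖w‖ ≤ bilin hd hΩ he z σ w w := by
  obtain ⟨K, hK, h⟩ := exists_norm_sq_le hd hL hΩ he
  have hne : (Finset.univ : Finset (Fin L)).Nonempty := ⟨⟨0, hL⟩, Finset.mem_univ _⟩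
  obtain ⟨l₀, -, hl₀⟩ := Finset.exists_min_image Finset.univ (fun l => (z l)⁻¹) hne
  obtain ⟨κ, hκ0, hκc, hκz⟩ : ∃ κ > 0, κ ≤ c ∧ κ ≤ (z l₀)⁻¹ :=
    ⟨min c (z l₀)⁻¹, lt_min hc (inv_pos.2 (hz l₀)), min_le_left _ _, min_le_right _ _⟩
  refine ⟨κ / K, by positivity, fun σ hσ w => ?_⟩
  have h1 := mul_energy_le_bilin hd hΩ he hκc
    (fun l => hκz.trans (hl₀ l (Finset.mem_univ l))) hσ w
  refine le_trans ?_ h1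
  rw [div_mul_eq_mul_div, div_mul_eq_mul_div, div_le_iff₀ hK]
  calc κ * ‖w‖ * ‖w‖ = κ * ‖w‖ ^ 2 := by ring
    _ ≤ κ * (K * _) := mul_le_mul_of_nonneg_left (h w) hκ0.le
    _ = _ := by ring

/-- **Lax–Milgram**: a coercive form represents every bounded functional. -/
theorem _root_.IsCoercive.exists_forall_eq {V : Type*} [NormedAddCommGroup V]
    [InnerProductSpace ℝ V] [CompleteSpace V] {B : V →L[ℝ] V →L[ℝ] ℝ} (hB : IsCoercive B)
    (ℓ : V →L[ℝ] ℝ) : ∃ w, ∀ w', B w w' = ℓ w' := by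
  refine ⟨hB.continuousLinearEquivOfBilin.symm ((InnerProductSpace.toDual ℝ V).symm ℓ),
    fun w' => ?_⟩
  rw [← hB.continuousLinearEquivOfBilin_apply, ContinuousLinearEquiv.apply_symm_apply,
    InnerProductSpace.toDual_symm_apply]

/-- The functional `(v, V) ↦ ⟪I, V⟫` given by the input current. -/
noncomputable def currentL (Ω : Set (EuclideanSpace ℝ (Fin d))) (I : EuclideanSpace ℝ (Fin L)) :
    cemSpace Ω L →L[ℝ] ℝ :=
  (innerSL ℝ I).comp (electrodeL Ω L)

theorem currentL_apply (I : EuclideanSpace ℝ (Fin L)) (w : cemSpace Ω L) :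
    currentL Ω I w = inner ℝ I w.1.snd.snd := by
  rw [currentL, ContinuousLinearMap.comp_apply, electrodeL_apply, innerSL_apply_apply]

set_option maxHeartbeats 1000000 in
theorem exists_bilin_eq (hd : 1 ≤ d) (hL : 1 ≤ L) (hΩ : IsPolyhedralDomain Ω)
    {e : Fin L → Set (EuclideanSpace ℝ (Fin d))} (he : IsElectrodeFamily Ω e) {z : Fin L → ℝ}
    (hz : ∀ l, 0 < z l) {c : ℝ} (hc : 0 < c) {σ : Lp ℝ ⊤ (volume.restrict Ω)}
    (hσ : ∀ᵐ x ∂(volume.restrict Ω), c ≤ σ x) (I : EuclideanSpace ℝ (Fin L)) :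
    ∃ w : cemSpace Ω L, ∀ w' : cemSpace Ω L,
      bilin hd hΩ he z σ w w' = inner ℝ I w'.1.snd.snd := by
  obtain ⟨κ, hκ, h⟩ := exists_coercive hd hL hΩ he hz hc
  have hco : IsCoercive (bilin hd hΩ he z σ) := ⟨κ, hκ, h σ hσ⟩
  obtain ⟨w, hw⟩ := IsCoercive.exists_forall_eq (V := cemSpace Ω L) hco (currentL Ω I)
  exact ⟨w, fun w' => (hw w').trans (currentL_apply I w')⟩

end CEM

/-! ### Well-posedness and continuity of the forward map -/

namespace CEM
variable {d L : ℕ} {Ω : Set (EuclideanSpace ℝ (Fin d))} {u : EuclideanSpace ℝ (Fin d) → ℝ}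
  {G : EuclideanSpace ℝ (Fin d) → EuclideanSpace ℝ (Fin d)}

theorem memH1_congr {v : EuclideanSpace ℝ (Fin d) → ℝ} (h : u =ᵐ[volume.restrict Ω] v)
    (hv : MemH1 Ω v) : MemH1 Ω u := by
  obtain ⟨hv2, G, hG⟩ := hv
  exact ⟨hv2.ae_eq h.symm, G, hG.congr h.symm EventuallyEq.rfl⟩

/-- Weak solutions are the solutions of the abstract variational equation. -/
theorem isSolution_iff (hd : 1 ≤ d) (hΩ : IsPolyhedralDomain Ω)
    {e : Fin L → Set (EuclideanSpace ℝ (Fin d))} (he : IsElectrodeFamily Ω e) (z : Fin L → ℝ)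
    (I : EuclideanSpace ℝ (Fin L)) {σ : EuclideanSpace ℝ (Fin d) → ℝ}
    {σ' : Lp ℝ ⊤ (volume.restrict Ω)} (hσ : σ =ᵐ[volume.restrict Ω] σ') {w : cemSpace Ω L}
    (hu : u =ᵐ[volume.restrict Ω] w.1.fst) :
    IsSolution Ω e z I σ u w.1.snd.snd ↔
      ∀ w' : cemSpace Ω L, bilin hd hΩ he z σ' w w' = inner ℝ I w'.1.snd.snd := by
  constructor
  · rintro ⟨-, -, h⟩ w'
    rw [← form_eq_bilin hd hΩ he z hσ hu (EventuallyEq.refl _ _),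
      h _ _ (memH1_of_cemSpace w') (cemSpace_sum_eq_zero w')]
  · refine fun h => ⟨memH1_congr hu (memH1_of_cemSpace w), cemSpace_sum_eq_zero w,
      fun v V hv hV => ?_⟩
    obtain ⟨w', hv', rfl⟩ := exists_cemSpace_of_memH1 hv hV
    rw [form_eq_bilin hd hΩ he z hσ hu hv', h]

theorem norm_gradL_le (w : cemSpace Ω L) : ‖gradL Ω L w‖ ≤ ‖w‖ := by
  rw [gradL_apply]
  have hw : ‖w‖ ^ 2 = _ := norm_sq_eq w.1
  refine (sq_le_sq₀ (norm_nonneg _) (norm_nonneg _)).1 ?_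
  rw [hw]; nlinarith [sq_nonneg ‖w.1.fst‖, sq_nonneg ‖w.1.snd.snd‖]

theorem norm_electrodeL_le (w : cemSpace Ω L) : ‖electrodeL Ω L w‖ ≤ ‖w‖ := by
  rw [electrodeL_apply]
  have hw : ‖w‖ ^ 2 = _ := norm_sq_eq w.1
  refine (sq_le_sq₀ (norm_nonneg _) (norm_nonneg _)).1 ?_
  rw [hw]; nlinarith [sq_nonneg ‖w.1.fst‖, sq_nonneg ‖w.1.snd.fst‖]

set_option maxHeartbeats 1000000 in
theorem bilin_sub_bilin (hd : 1 ≤ d) (hΩ : IsPolyhedralDomain Ω)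
    {e : Fin L → Set (EuclideanSpace ℝ (Fin d))} (he : IsElectrodeFamily Ω e) (z : Fin L → ℝ)
    (σ σ' : Lp ℝ ⊤ (volume.restrict Ω)) (w w' : cemSpace Ω L) :
    bilin hd hΩ he z σ w w' - bilin hd hΩ he z σ' w w' =
      inner ℝ (mulL σ (gradL Ω L w) - mulL σ' (gradL Ω L w)) (gradL Ω L w') := by
  rw [bilin_apply, bilin_apply, add_sub_add_right_eq_sub]
  exact (inner_sub_left _ _ _).symm

theorem le_of_mul_mul_le_mul {κ n a b : ℝ} (hn : 0 ≤ n) (ha : 0 ≤ a) (h1 : κ * n * n ≤ b)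
    (h2 : b ≤ a * n) : κ * n ≤ a := by
  rcases hn.eq_or_lt with rfl | h0
  · simpa using ha
  · exact le_of_mul_le_mul_right (h1.trans h2) h0

/-- Stability of the weak solution with respect to the conductivity. For `σ = σ'` this is
uniqueness. -/
theorem mul_norm_sub_le (hd : 1 ≤ d) (hΩ : IsPolyhedralDomain Ω)
    {e : Fin L → Set (EuclideanSpace ℝ (Fin d))} (he : IsElectrodeFamily Ω e) {z : Fin L → ℝ}
    {σ σ' : Lp ℝ ⊤ (volume.restrict Ω)} {κ : ℝ}
    (hκ : ∀ w : cemSpace Ω L, κ * ‖w‖ * ‖w‖ ≤ bilin hd hΩ he z σ w w) {w₁ w₂ : cemSpace Ω L}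
    (h : ∀ w', bilin hd hΩ he z σ w₁ w' = bilin hd hΩ he z σ' w₂ w') :
    κ * ‖w₁ - w₂‖ ≤ ‖mulL σ' (gradL Ω L w₂) - mulL σ (gradL Ω L w₂)‖ := by
  have h2 : bilin hd hΩ he z σ (w₁ - w₂) (w₁ - w₂) =
      inner ℝ (mulL σ' (gradL Ω L w₂) - mulL σ (gradL Ω L w₂)) (gradL Ω L (w₁ - w₂)) :=
    (ContinuousLinearMap.map_sub₂ (bilin hd hΩ he z σ) w₁ w₂ (w₁ - w₂)).trans <|
      (congrArg (· - _) (h _)).trans (bilin_sub_bilin hd hΩ he z σ' σ w₂ (w₁ - w₂))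
  refine le_of_mul_mul_le_mul (norm_nonneg _) (norm_nonneg _) (hκ (w₁ - w₂)) (h2.le.trans ?_)
  exact (real_inner_le_norm _ _).trans
    (mul_le_mul_of_nonneg_left (norm_gradL_le _) (norm_nonneg _))

theorem exists_Linfty_of_mem_admissible {c₀ c₁ : ℝ} (hc₀ : 0 < c₀)
    {σ : EuclideanSpace ℝ (Fin d) → ℝ} (hσ : σ ∈ admissible Ω c₀ c₁) :
    ∃ σ' : Lp ℝ ⊤ (volume.restrict Ω), σ =ᵐ[volume.restrict Ω] σ' ∧
      ∀ᵐ x ∂(volume.restrict Ω), c₀ ≤ σ' x := by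
  have h : MemLp σ ⊤ (volume.restrict Ω) := by
    refine memLp_top_of_bound hσ.1.1.1 c₁ ?_
    filter_upwards [hσ.2] with x hx
    rw [Real.norm_eq_abs, abs_of_nonneg (hc₀.le.trans hx.1)]
    exact hx.2
  refine ⟨h.toLp σ, h.coeFn_toLp.symm, ?_⟩
  filter_upwards [hσ.2, h.coeFn_toLp] with x h1 h2
  rw [h2]; exact h1.1

theorem existsUnique_isSolution (hd : 1 ≤ d) (hL : 1 ≤ L) (hΩ : IsPolyhedralDomain Ω)
    {e : Fin L → Set (EuclideanSpace ℝ (Fin d))} (he : IsElectrodeFamily Ω e) {z : Fin L → ℝ}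
    (hz : ∀ l, 0 < z l) (I : EuclideanSpace ℝ (Fin L)) {c₀ c₁ : ℝ} (hc₀ : 0 < c₀)
    {σ : EuclideanSpace ℝ (Fin d) → ℝ} (hσ : σ ∈ admissible Ω c₀ c₁) :
    ∃ (u : EuclideanSpace ℝ (Fin d) → ℝ) (U : EuclideanSpace ℝ (Fin L)),
      IsSolution Ω e z I σ u U ∧
      ∀ (u' : EuclideanSpace ℝ (Fin d) → ℝ) (U' : EuclideanSpace ℝ (Fin L)),
        IsSolution Ω e z I σ u' U' → u' =ᵐ[volume.restrict Ω] u ∧ U' = U := by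
  obtain ⟨σ', hσ', hc⟩ := exists_Linfty_of_mem_admissible hc₀ hσ
  obtain ⟨κ, hκ, hco⟩ := exists_coercive hd hL hΩ he hz hc₀
  obtain ⟨w, hw⟩ := exists_bilin_eq hd hL hΩ he hz hc₀ hc I
  refine ⟨w.1.fst, w.1.snd.snd,
    (isSolution_iff hd hΩ he z I hσ' (EventuallyEq.refl _ _)).2 hw, fun u' U' h' => ?_⟩
  obtain ⟨w', hu', rfl⟩ := exists_cemSpace_of_memH1 h'.1 h'.2.1
  have hw' := (isSolution_iff hd hΩ he z I hσ' hu').1 h'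
  have h0 := mul_norm_sub_le hd hΩ he (hco σ' hc) (fun v => (hw' v).trans (hw v).symm)
  rw [sub_self, norm_zero] at h0
  have h1 : ‖w' - w‖ = 0 :=
    le_antisymm (nonpos_of_mul_nonpos_right h0 hκ) (norm_nonneg _)
  obtain rfl := sub_eq_zero.1 (norm_eq_zero.1 h1)
  exact ⟨hu', rfl⟩

theorem isSolution_voltage (hd : 1 ≤ d) (hL : 1 ≤ L) (hΩ : IsPolyhedralDomain Ω)
    {e : Fin L → Set (EuclideanSpace ℝ (Fin d))} (he : IsElectrodeFamily Ω e) {z : Fin L → ℝ}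
    (hz : ∀ l, 0 < z l) (I : EuclideanSpace ℝ (Fin L)) {c₀ c₁ : ℝ} (hc₀ : 0 < c₀)
    {σ : EuclideanSpace ℝ (Fin d) → ℝ} (hσ : σ ∈ admissible Ω c₀ c₁) :
    ∃ u, IsSolution Ω e z I σ u (voltage Ω e z I σ) := by
  obtain ⟨u, U, h, -⟩ := existsUnique_isSolution hd hL hΩ he hz I hc₀ hσ
  have h' : ∃ U : EuclideanSpace ℝ (Fin L), ∃ u, IsSolution Ω e z I σ u U := ⟨U, u, h⟩
  rw [voltage, dif_pos h']
  exact h'.choose_spec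

/-- Multiplication operators converge strongly when the coefficients converge boundedly almost
everywhere. -/
theorem tendsto_mulL {c₀ c₁ : ℝ} {s : ℕ → Lp ℝ ⊤ (volume.restrict Ω)}
    {s' : Lp ℝ ⊤ (volume.restrict Ω)} 
    (hs : ∀ n, ∀ᵐ x ∂(volume.restrict Ω), c₀ ≤ s n x ∧ s n x ≤ c₁)
    (hlim : ∀ᵐ x ∂(volume.restrict Ω), Tendsto (fun n => s n x) atTop (𝓝 (s' x)))
    (F : Lp (EuclideanSpace ℝ (Fin d)) 2 (volume.restrict Ω)) :
    Tendsto (fun n => ‖mulL s' F - mulL (s n) F‖) atTop (𝓝 0) := by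
  have hae : ∀ n, ⇑(mulL s' F - mulL (s n) F) =ᵐ[volume.restrict Ω]
      fun x => (s' x - s n x) • F x := fun n => by
    filter_upwards [Lp.coeFn_sub (mulL s' F) (mulL (s n) F), coeFn_mulL s' F, coeFn_mulL (s n) F]
      with x h1 h2 h3
    rw [h1, Pi.sub_apply, h2, h3, sub_smul]
  have hs' : ∀ᵐ x ∂(volume.restrict Ω), c₀ ≤ s' x ∧ s' x ≤ c₁ := by
    filter_upwards [hlim, ae_all_iff.2 hs] with x h1 h2
    exact ⟨ge_of_tendsto' h1 fun n => (h2 n).1, le_of_tendsto' h1 fun n => (h2 n).2⟩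
  have h1 : Tendsto (fun n => ∫⁻ x in Ω, ‖(mulL s' F - mulL (s n) F) x‖ₑ ^ 2) atTop
      (𝓝 (∫⁻ x in Ω, 0)) := by
    refine tendsto_lintegral_of_dominated_convergence'
      (bound := fun x => ‖(c₁ - c₀) • F x‖ₑ ^ 2) ?_ ?_ ?_ ?_
    · exact fun n => (Lp.aestronglyMeasurable _).enorm.pow_const 2
    · intro n
      filter_upwards [hae n, hs n, hs'] with x h1 h2 h3
      rw [h1, enorm_smul, enorm_smul]
      gcongr
      rw [← ofReal_norm, ← ofReal_norm]
      apply ENNReal.ofReal_le_ofReal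
      rw [Real.norm_eq_abs, Real.norm_eq_abs]
      refine (abs_le.2 ⟨?_, ?_⟩).trans (le_abs_self _) <;> linarith
    · have := lintegral_enorm_sq_eq_of_memLp ((Lp.memLp F).const_smul (c₁ - c₀))
      exact this.trans_ne ENNReal.ofReal_ne_top
    · filter_upwards [hlim, ae_all_iff.2 hae] with x h1 h2
      have h3 : Tendsto (fun n => ‖(s' x - s n x) • F x‖ₑ ^ 2) atTop
          (𝓝 (‖(s' x - s' x) • F x‖ₑ ^ 2)) :=
        ((ENNReal.continuous_pow 2).tendsto _).comp
          (((tendsto_const_nhds.sub h1).smul_const (F x)).enorm)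
      simp only [sub_self, zero_smul, enorm_zero, ne_eq, OfNat.ofNat_ne_zero, not_false_eq_true,
        zero_pow] at h3
      exact h3.congr fun n => by rw [h2 n]
  simp only [lintegral_enorm_sq_coe, lintegral_zero] at h1
  have h2 := (ENNReal.tendsto_toReal ENNReal.zero_ne_top).comp h1
  have h3 : Tendsto (fun n => ‖mulL s' F - mulL (s n) F‖ ^ 2) atTop (𝓝 0) := by
    refine h2.congr fun n => ?_
    rw [Function.comp_apply, ENNReal.toReal_ofReal (sq_nonneg _)]
  have h4 := (Real.continuous_sqrt.tendsto 0).comp h3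
  rw [Real.sqrt_zero] at h4
  exact h4.congr fun n => Real.sqrt_sq (norm_nonneg _)

set_option maxHeartbeats 1000000 in
/-- The forward map is continuous along sequences of admissible conductivities that converge
almost everywhere. -/
theorem tendsto_voltage (hd : 1 ≤ d) (hL : 1 ≤ L) (hΩ : IsPolyhedralDomain Ω)
    {e : Fin L → Set (EuclideanSpace ℝ (Fin d))} (he : IsElectrodeFamily Ω e) {z : Fin L → ℝ}
    (hz : ∀ l, 0 < z l) (I : EuclideanSpace ℝ (Fin L)) {c₀ c₁ : ℝ} (hc₀ : 0 < c₀)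
    {s : ℕ → EuclideanSpace ℝ (Fin d) → ℝ} {σ : EuclideanSpace ℝ (Fin d) → ℝ}
    (hs : ∀ n, s n ∈ admissible Ω c₀ c₁) (hσ : σ ∈ admissible Ω c₀ c₁)
    (hlim : ∀ᵐ x ∂(volume.restrict Ω), Tendsto (fun n => s n x) atTop (𝓝 (σ x))) :
    Tendsto (fun n => voltage Ω e z I (s n)) atTop (𝓝 (voltage Ω e z I σ)) := by
  obtain ⟨κ, hκ, hco⟩ := exists_coercive hd hL hΩ he hz hc₀
  have hrep : ∀ σ ∈ admissible Ω c₀ c₁, ∃ (σ' : Lp ℝ ⊤ (volume.restrict Ω)) (w : cemSpace Ω L),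
      σ =ᵐ[volume.restrict Ω] σ' ∧ (∀ᵐ x ∂(volume.restrict Ω), c₀ ≤ σ' x) ∧
      voltage Ω e z I σ = electrodeL Ω L w ∧
      ∀ w' : cemSpace Ω L, bilin hd hΩ he z σ' w w' = inner ℝ I w'.1.snd.snd := by
    intro σ hσ
    obtain ⟨σ', h1, h2⟩ := exists_Linfty_of_mem_admissible hc₀ hσ
    obtain ⟨u, hu⟩ := isSolution_voltage hd hL hΩ he hz I hc₀ hσ
    obtain ⟨w, hw, hU⟩ := exists_cemSpace_of_memH1 hu.1 hu.2.1
    rw [← hU] at hu ⊢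
    exact ⟨σ', w, h1, h2, (electrodeL_apply w).symm, (isSolution_iff hd hΩ he z I h1 hw).1 hu⟩
  obtain ⟨σ', w, h1, h2, h3, h4⟩ := hrep σ hσ
  choose s' v k1 k2 k3 k4 using fun n => hrep (s n) (hs n)
  have hT : Tendsto (fun n => ‖mulL σ' (gradL Ω L w) - mulL (s' n) (gradL Ω L w)‖) atTop (𝓝 0) := by
    refine tendsto_mulL (c₀ := c₀) (c₁ := c₁) (fun n => ?_) ?_ _
    · filter_upwards [(hs n).2, k1 n] with x hx hx'
      rwa [← hx']
    · filter_upwards [hlim, h1, ae_all_iff.2 k1] with x hx hx1 hx2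
      rw [← hx1]
      exact hx.congr hx2
  have hT2 := hT.const_mul κ⁻¹
  rw [mul_zero] at hT2
  refine tendsto_iff_norm_sub_tendsto_zero.2 (squeeze_zero (fun _ => norm_nonneg _) (fun n => ?_) hT2)
  rw [k3 n, h3, ← map_sub, inv_mul_eq_div, le_div_iff₀' hκ]
  refine le_trans ?_ (mul_norm_sub_le hd hΩ he (hco (s' n) (k2 n))
    (fun v => (k4 n v).trans (h4 v).symm))
  exact mul_le_mul_of_nonneg_left (norm_electrodeL_le _) hκ.le

end CEM

/-! ### Rellich's compactness theorem -/

namespace CEM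
variable {d L : ℕ} {Ω : Set (EuclideanSpace ℝ (Fin d))} {u : EuclideanSpace ℝ (Fin d) → ℝ}
  {G : EuclideanSpace ℝ (Fin d) → EuclideanSpace ℝ (Fin d)}
  {H T : Finset (EuclideanSpace ℝ (Fin d) × ℝ)}

theorem positiveSide_eq_of_mem_cell (hT : T ⊆ H) {x : EuclideanSpace ℝ (Fin d)}
    (hx : x ∈ cell H T) : positiveSide H x = T := by
  classical
  ext h
  simp only [positiveSide, Finset.mem_filter]
  constructor
  · rintro ⟨hh, h1⟩
    by_contra h2
    exact lt_asymm h1 ((hx h hh).2 h2)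
  · exact fun h1 => ⟨hT h1, (hx h (hT h1)).1 h1⟩

theorem sum_innerCells_setLIntegral_le (Ω : Set (EuclideanSpace ℝ (Fin d)))
    (H : Finset (EuclideanSpace ℝ (Fin d) × ℝ)) (f : EuclideanSpace ℝ (Fin d) → ENNReal) :
    ∑ T ∈ innerCells Ω H, ∫⁻ x in cell H T, f x ≤ ∫⁻ x in Ω, f x := by
  classical
  have hsub : ∀ T ∈ innerCells Ω H, T ⊆ H := fun T hT => by
    simp only [innerCells, Finset.mem_filter, Finset.mem_powerset] at hT
    exact hT.1
  rw [← lintegral_biUnion_finset]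
  · exact lintegral_mono_set (Set.iUnion₂_subset fun T hT => (mem_innerCells hT).2)
  · intro T hT T' hT' hne
    refine Set.disjoint_left.2 fun x hx hx' => hne ?_
    rw [← positiveSide_eq_of_mem_cell (hsub T hT) hx, positiveSide_eq_of_mem_cell (hsub T' hT') hx']
  · exact fun T _ => (isOpen_cell H T).measurableSet

/-- Adding the hyperplanes of a fine grid to an arrangement makes its cells in `Ω` small. -/
theorem exists_small_innerCells (hb : Bornology.IsBounded Ω) (hH0 : ∀ h ∈ H, h.1 ≠ 0)
    (hH : frontier Ω ⊆ ⋃ h ∈ H, hyperplane h) {η : ℝ} (hη : 0 < η) :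
    ∃ H' : Finset (EuclideanSpace ℝ (Fin d) × ℝ), (∀ h ∈ H', h.1 ≠ 0) ∧
      frontier Ω ⊆ (⋃ h ∈ H', hyperplane h) ∧
      ∀ T ∈ innerCells Ω H', ∀ x ∈ cell H' T, ∀ y ∈ cell H' T, ‖x - y‖ ^ 2 ≤ d * η ^ 2 := by
  classical
  obtain ⟨R, hR⟩ := hb.exists_norm_le
  obtain ⟨N, hN⟩ := exists_nat_gt (R / η)
  -- all grid hyperplanes `x i = k * η` that can bound a grid cube meeting `Ω`
  set grid : Finset (EuclideanSpace ℝ (Fin d) × ℝ) :=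
    (Finset.univ ×ˢ Finset.Icc (-(N : ℤ) - 1) (N + 1)).image fun p : Fin d × ℤ =>
      (EuclideanSpace.single p.1 1, p.2 * η) with hgrid
  have hmem : ∀ i : Fin d, ∀ k : ℤ, -(N : ℤ) - 1 ≤ k → k ≤ N + 1 →
      ((EuclideanSpace.single i (1 : ℝ), k * η) : EuclideanSpace ℝ (Fin d) × ℝ) ∈ H ∪ grid :=
    fun i k h1 h2 => Finset.mem_union_right _ (Finset.mem_image.2 ⟨(i, k), by simp [h1, h2], rfl⟩)
  refine ⟨H ∪ grid, ?_, ?_, ?_⟩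
  · intro h hh
    rcases Finset.mem_union.1 hh with h1 | h1
    · exact hH0 h h1
    · obtain ⟨p, -, rfl⟩ := Finset.mem_image.1 h1
      simp
  · exact hH.trans (Set.biUnion_subset_biUnion_left fun h hh => Finset.mem_union_left _ hh)
  intro T hT x hx y hy
  have hside : ∀ (i : Fin d) (k : ℤ), -(N : ℤ) - 1 ≤ k → k ≤ N + 1 →
      (k * η < x i ∧ k * η < y i) ∨ (x i < k * η ∧ y i < k * η) := by
    intro i k h1 h2
    have hx' := hx _ (hmem i k h1 h2)
    have hy' := hy _ (hmem i k h1 h2)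
    simp only [EuclideanSpace.inner_single_left, map_one, one_mul] at hx' hy'
    by_cases hk : ((EuclideanSpace.single i (1 : ℝ), k * η) : EuclideanSpace ℝ (Fin d) × ℝ) ∈ T
    · exact Or.inl ⟨hx'.1 hk, hy'.1 hk⟩
    · exact Or.inr ⟨hx'.2 hk, hy'.2 hk⟩
  have hcoord : ∀ i : Fin d, ‖(x - y) i‖ ^ 2 ≤ η ^ 2 := by
    intro i
    have hxR : |x i| ≤ N * η := by
      have h1 := (PiLp.norm_apply_le x i).trans (hR x ((mem_innerCells hT).2 hx))
      rw [Real.norm_eq_abs] at h1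
      rw [div_lt_iff₀ hη] at hN
      linarith
    set k := ⌊x i / η⌋ with hk
    have hk1 : k * η ≤ x i := (le_div_iff₀ hη).1 (Int.floor_le _)
    have hk2 : x i < (k + 1 : ℤ) * η := by
      have := (div_lt_iff₀ hη).1 (Int.lt_floor_add_one (x i / η))
      push_cast; exact this
    have hkN : -(N : ℤ) ≤ k := by
      rw [hk, Int.le_floor, le_div_iff₀ hη]
      push_cast
      linarith [neg_le_of_abs_le hxR]
    have hkN' : k ≤ N := by
      have h3 : (k : ℝ) ≤ (N : ℝ) := le_of_mul_le_mul_right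
        (hk1.trans ((le_abs_self _).trans hxR)) hη
      exact_mod_cast h3
    have e1 := hside i k (by omega) (by omega)
    have e2 := hside i (k + 1) (by omega) (by omega)
    rw [PiLp.sub_apply, Real.norm_eq_abs, sq_abs]
    push_cast at e2 hk2
    apply sq_le_sq'
    · rcases e1 with e1 | e1 <;> rcases e2 with e2 | e2 <;> nlinarith [e1.1, e1.2, e2.1, e2.2]
    · rcases e1 with e1 | e1 <;> rcases e2 with e2 | e2 <;> nlinarith [e1.1, e1.2, e2.1, e2.2]
  rw [EuclideanSpace.norm_sq_eq]
  calc ∑ i, ‖(x - y) i‖ ^ 2 ≤ ∑ _i : Fin d, η ^ 2 := Finset.sum_le_sum fun i _ => hcoord i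
    _ = d * η ^ 2 := by simp

/-- On small cells a function in `H¹(Ω)` is determined by its cell averages up to a small error. -/
theorem IsWeakGradient.lintegral_sq_le_of_average_le (hΩ : IsPolyhedralDomain Ω)
    (hH0 : ∀ h ∈ H, h.1 ≠ 0) (hH : frontier Ω ⊆ ⋃ h ∈ H, hyperplane h)
    {ρ δ : ENNReal} (hρ : ∀ T ∈ innerCells Ω H, ∀ x ∈ cell H T, ∀ y ∈ cell H T, ‖x - y‖ₑ ≤ ρ)
    (hu : MemLp u 2 (volume.restrict Ω)) (hG : IsWeakGradient Ω u G)
    (hδ : ∀ T ∈ innerCells Ω H, ‖⨍ y in cell H T, u y‖ₑ ≤ δ) :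
    ∫⁻ x in Ω, ‖u x‖ₑ ^ 2 ≤
      2 * (2 ^ d * ρ ^ 2 * (∫⁻ x in Ω, ‖G x‖ₑ ^ 2) + δ ^ 2 * volume Ω) := by
  calc ∫⁻ x in Ω, ‖u x‖ₑ ^ 2 ≤ ∑ T ∈ innerCells Ω H, ∫⁻ x in cell H T, ‖u x‖ₑ ^ 2 :=
        setLIntegral_le_sum_innerCells hΩ.isOpen hH0 hH _
    _ ≤ ∑ T ∈ innerCells Ω H, 2 * (2 ^ d * ρ ^ 2 * (∫⁻ x in cell H T, ‖G x‖ₑ ^ 2) +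
          δ ^ 2 * ∫⁻ x in cell H T, 1) := by
        refine Finset.sum_le_sum fun T hT => ?_
        calc ∫⁻ x in cell H T, ‖u x‖ₑ ^ 2
            ≤ ∫⁻ x in cell H T, 2 * (‖u x - ⨍ y in cell H T, u y‖ₑ ^ 2 +
                ‖⨍ y in cell H T, u y‖ₑ ^ 2) := lintegral_mono fun x => by
              simpa using enorm_add_sq_le (u x - ⨍ y in cell H T, u y) (⨍ y in cell H T, u y)
          _ = 2 * ((∫⁻ x in cell H T, ‖u x - ⨍ y in cell H T, u y‖ₑ ^ 2) +
                ‖⨍ y in cell H T, u y‖ₑ ^ 2 * ∫⁻ x in cell H T, 1) := by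
              rw [lintegral_const_mul' _ _ (by norm_num), lintegral_add_right _ measurable_const,
                setLIntegral_const, setLIntegral_one]
          _ ≤ _ := by
              gcongr
              · exact hG.poincare hΩ.isBounded hu (isOpen_cell H T) (convex_cell H T)
                  (mem_innerCells hT).2 (hρ T hT)
              · exact hδ T hT
    _ = 2 * (2 ^ d * ρ ^ 2 * (∑ T ∈ innerCells Ω H, ∫⁻ x in cell H T, ‖G x‖ₑ ^ 2) +
          δ ^ 2 * ∑ T ∈ innerCells Ω H, ∫⁻ x in cell H T, 1) := by
        rw [← Finset.mul_sum, Finset.sum_add_distrib, Finset.mul_sum, Finset.mul_sum]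
    _ ≤ 2 * (2 ^ d * ρ ^ 2 * (∫⁻ x in Ω, ‖G x‖ₑ ^ 2) + δ ^ 2 * ∫⁻ x in Ω, 1) := by
        gcongr <;> exact sum_innerCells_setLIntegral_le _ _ _
    _ = _ := by rw [setLIntegral_one]

/-- The functions in `H¹(Ω)` with `‖∇f‖ ≤ M` and `|f| ≤ c`. -/
def boundedH1 (Ω : Set (EuclideanSpace ℝ (Fin d))) (M c : ℝ) : Set (Lp ℝ 2 (volume.restrict Ω)) :=
  {f | (∃ g : Lp (EuclideanSpace ℝ (Fin d)) 2 (volume.restrict Ω),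
    IsWeakGradient Ω f g ∧ ‖g‖ ≤ M) ∧ ∀ᵐ x ∂(volume.restrict Ω), |f x| ≤ c}

theorem isWeakGradient_sub {f f' : Lp ℝ 2 (volume.restrict Ω)}
    {g g' : Lp (EuclideanSpace ℝ (Fin d)) 2 (volume.restrict Ω)} (h : IsWeakGradient Ω f g)
    (h' : IsWeakGradient Ω f' g') : IsWeakGradient Ω ⇑(f - f') ⇑(g - g') := by
  obtain ⟨P, hP⟩ := exists_isWeakGradient_iff_inner Ω
  rw [hP] at h h' ⊢
  intro p hp
  rw [inner_sub_right, inner_sub_right]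
  linarith [h p hp, h' p hp]

theorem abs_average_le_of_ae {α : Type*} [MeasurableSpace α] {μ : Measure α} [IsFiniteMeasure μ]
    {f : α → ℝ} {c : ℝ} (hc : 0 ≤ c) (h : ∀ᵐ x ∂μ, |f x| ≤ c) : |⨍ x, f x ∂μ| ≤ c := by
  rcases eq_or_ne μ 0 with rfl | hμ
  · simpa using hc
  have : NeZero μ := ⟨hμ⟩
  have h1 := norm_integral_le_of_norm_le_const (μ := (μ Set.univ)⁻¹ • μ) (f := f) (C := c)
    (Measure.ae_smul_measure h _)
  simpa [average] using h1

/-- **Rellich's theorem** on polyhedral domains: bounded subsets of `H¹(Ω)` are precompact in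
`L²(Ω)`. On the small cells of a fine grid adapted to `Ω`, the Poincaré inequality shows that a
function is determined, up to a small error, by finitely many bounded averages. -/
theorem totallyBounded_boundedH1 (hΩ : IsPolyhedralDomain Ω) {M c : ℝ} (hc : 0 ≤ c) :
    TotallyBounded (boundedH1 Ω M c) := by
  classical
  obtain ⟨H, hH0, hH⟩ := hΩ.frontier_subset
  have hb := hΩ.isBounded
  refine Metric.totallyBounded_of_finite_discretization fun ε hε => ?_
  obtain ⟨η, hη, hηε⟩ : ∃ η > 0, 2 * (2 ^ d * (d * η ^ 2) * (2 * M) ^ 2 +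
      η ^ 2 * (volume Ω).toReal) < ε ^ 2 := by
    have h1 : Tendsto (fun η : ℝ => 2 * (2 ^ d * (d * η ^ 2) * (2 * M) ^ 2 +
        η ^ 2 * (volume Ω).toReal)) (𝓝[>] 0) (𝓝 (2 * (2 ^ d * (d * 0 ^ 2) * (2 * M) ^ 2 +
        0 ^ 2 * (volume Ω).toReal))) :=
      (Continuous.tendsto (by fun_prop) 0).mono_left nhdsWithin_le_nhds
    have h2 : 2 * (2 ^ d * ((d : ℝ) * 0 ^ 2) * (2 * M) ^ 2 + 0 ^ 2 * (volume Ω).toReal) < ε ^ 2 := by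
      have : 0 < ε ^ 2 := by positivity
      simpa using this
    obtain ⟨η, h3, h4⟩ := ((h1.eventually_lt_const h2).and self_mem_nhdsWithin).exists
    exact ⟨η, h4, h3⟩
  obtain ⟨H', hH0', hH', hsmall⟩ := exists_small_innerCells hb hH0 hH hη
  set ρ : ENNReal := ENNReal.ofReal (Real.sqrt (d * η ^ 2)) with hρ
  have hρ2 : ρ ^ 2 = ENNReal.ofReal (d * η ^ 2) := by
    rw [hρ, ← ENNReal.ofReal_pow (Real.sqrt_nonneg _), Real.sq_sqrt (by positivity)]
  have hρle : ∀ T ∈ innerCells Ω H', ∀ x ∈ cell H' T, ∀ y ∈ cell H' T, ‖x - y‖ₑ ≤ ρ := by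
    intro T hT x hx y hy
    rw [← ofReal_norm]
    exact ENNReal.ofReal_le_ofReal (Real.le_sqrt_of_sq_le (hsmall T hT x hx y hy))
  have hav : ∀ f : boundedH1 Ω M c, ∀ T : innerCells Ω H',
      |⨍ y in cell H' T.1, f.1 y| ≤ c := by
    intro f T
    have hTΩ := (mem_innerCells T.2).2
    have : IsFiniteMeasure (volume.restrict (cell H' T.1)) :=
      ⟨by simpa using (hb.subset hTΩ).measure_lt_top⟩
    exact abs_average_le_of_ae hc (f.2.2.filter_mono (ae_mono (Measure.restrict_mono hTΩ le_rfl)))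
  -- the averages over the cells, rounded to multiples of `η`
  refine ⟨innerCells Ω H' → Finset.Icc ⌊-c / η⌋ ⌊c / η⌋, inferInstance,
    fun f T => ⟨⌊(⨍ y in cell H' T.1, f.1 y) / η⌋, ?_⟩, fun f f' hff => ?_⟩
  · have := abs_le.1 (hav f T)
    rw [Finset.mem_Icc]
    exact ⟨Int.floor_mono (by gcongr; exact this.1), Int.floor_mono (by gcongr; exact this.2)⟩
  obtain ⟨⟨g, hg, hgM⟩, -⟩ := f.2
  obtain ⟨⟨g', hg', hgM'⟩, -⟩ := f'.2
  have hδ : ∀ T ∈ innerCells Ω H', ‖⨍ y in cell H' T, (f.1 - f'.1) y‖ₑ ≤ ENNReal.ofReal η := by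
    intro T hT
    have hTΩ := (mem_innerCells hT).2
    have h1 : ⨍ y in cell H' T, (f.1 - f'.1) y =
        (⨍ y in cell H' T, f.1 y) - ⨍ y in cell H' T, f'.1 y := by
      rw [setAverage_eq, setAverage_eq, setAverage_eq, ← smul_sub, ← integral_sub
        ((integrableOn_of_memLp_two hb (Lp.memLp f.1)).mono_set hTΩ)
        ((integrableOn_of_memLp_two hb (Lp.memLp f'.1)).mono_set hTΩ)]
      congr 1
      exact integral_congr_ae ((Lp.coeFn_sub f.1 f'.1).filter_mono
        (ae_mono (Measure.restrict_mono hTΩ le_rfl)))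
    have h2 := Int.abs_sub_lt_one_of_floor_eq_floor
      (congrArg Subtype.val (congrFun hff ⟨T, hT⟩))
    rw [← sub_div, abs_div, abs_of_pos hη, div_lt_one hη] at h2
    rw [h1, ← ofReal_norm]
    exact ENNReal.ofReal_le_ofReal h2.le
  have h1 := (isWeakGradient_sub hg hg').lintegral_sq_le_of_average_le hΩ hH0' hH' hρle
    (Lp.memLp (f.1 - f'.1)) hδ
  rw [lintegral_enorm_sq_coe, lintegral_enorm_sq_coe, hρ2] at h1
  have hΩt : volume Ω ≠ ⊤ := hb.measure_lt_top.ne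
  have h2 := ENNReal.toReal_mono (by finiteness) h1
  rw [ENNReal.toReal_mul, ENNReal.toReal_add (by finiteness) (by finiteness)] at h2
  simp only [ENNReal.toReal_mul, ENNReal.toReal_pow, ENNReal.toReal_ofNat,
    ENNReal.toReal_ofReal (sq_nonneg _), ENNReal.toReal_ofReal hη.le,
    ENNReal.toReal_ofReal (by positivity : (0 : ℝ) ≤ d * η ^ 2)] at h2
  have h3 : ‖g - g'‖ ≤ 2 * M := (norm_sub_le _ _).trans (by linarith)
  rw [dist_eq_norm]
  refine lt_of_pow_lt_pow_left₀ 2 hε.le (h2.trans_lt (lt_of_le_of_lt ?_ hηε))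
  gcongr

end CEM

/-! ### Existence of minimizers -/

namespace CEM
variable {d L : ℕ} {Ω : Set (EuclideanSpace ℝ (Fin d))} {u : EuclideanSpace ℝ (Fin d) → ℝ}
  {G : EuclideanSpace ℝ (Fin d) → EuclideanSpace ℝ (Fin d)}

/-- Bounded sequences in a Hilbert space converge weakly along an ultrafilter. -/
theorem exists_tendsto_inner_hyperfilter {V : Type*} [NormedAddCommGroup V]
    [InnerProductSpace ℝ V] [CompleteSpace V] {g : ℕ → V} {M : ℝ} (hg : ∀ n, ‖g n‖ ≤ M) :
    ∃ g' : V, ∀ v, Tendsto (fun n => inner ℝ v (g n)) (hyperfilter ℕ : Filter ℕ)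
      (𝓝 (inner ℝ v g')) := by
  set F : ℕ → WeakDual ℝ V := fun n => StrongDual.toWeakDual (InnerProductSpace.toDual ℝ V (g n))
  have hF : ((hyperfilter ℕ).map F : Filter (WeakDual ℝ V)) ≤
      𝓟 (WeakDual.toStrongDual ⁻¹' Metric.closedBall (0 : StrongDual ℝ V) M) := by
    have hmem : ∀ n, F n ∈ WeakDual.toStrongDual ⁻¹' Metric.closedBall (0 : StrongDual ℝ V) M := by
      intro n
      show InnerProductSpace.toDual ℝ V (g n) ∈ Metric.closedBall _ _
      rw [mem_closedBall_zero_iff, LinearIsometryEquiv.norm_map]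
      exact hg n
    exact tendsto_principal.2 (Eventually.of_forall hmem)
  obtain ⟨ℓ, -, hℓ⟩ := (WeakDual.isCompact_closedBall (0 : StrongDual ℝ V) M).ultrafilter_le_nhds _ hF
  refine ⟨(InnerProductSpace.toDual ℝ V).symm (WeakDual.toStrongDual ℓ), fun v => ?_⟩
  have h1 := ((WeakDual.eval_continuous (𝕜 := ℝ) v).tendsto ℓ).comp (show Tendsto F _ _ from hℓ)
  rw [real_inner_comm, InnerProductSpace.toDual_symm_apply]
  refine h1.congr fun n => ?_
  rw [real_inner_comm]
  exact InnerProductSpace.toDual_apply_apply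

theorem isWeakGradient_const (c : ℝ) :
    IsWeakGradient Ω (fun _ => c) 0 := by
  refine ⟨MemLp.zero, fun φ hφ hc hs i => ?_⟩
  -- integration by parts against a constant, `φ` having compact support
  have h1 : ∫ x, c * fderiv ℝ φ x (EuclideanSpace.single i 1) = 0 := by
    have hd := (hφ.continuous_fderiv (by simp)).clm_apply
      (continuous_const (y := EuclideanSpace.single i (1 : ℝ)))
    rw [integral_mul_fderiv_eq_neg_fderiv_mul_of_integrable (f := fun _ => c)]
    · simp
    · simp
    · exact (hd.integrable_of_hasCompactSupport (hc.fderiv_apply (𝕜 := ℝ) _)).const_mul c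
    · exact (hφ.continuous.integrable_of_hasCompactSupport hc).const_mul c
    · exact fun _ _ => differentiableAt_const c
    · exact fun x _ => hφ.differentiable (by simp) x
  rw [setIntegral_eq_integral_of_forall_compl_eq_zero, h1]
  · simp
  · intro x hx
    have : fderiv ℝ φ x = 0 := by
      by_contra h
      exact hx (hs (tsupport_fderiv_subset ℝ (subset_tsupport _ h)))
    simp [this]

theorem doubleWell_nonneg (c₀ c₁ s : ℝ) : 0 ≤ doubleWell c₀ c₁ s :=
  mul_nonneg (sq_nonneg _) (sq_nonneg _)

theorem continuous_doubleWell (c₀ c₁ : ℝ) : Continuous (doubleWell c₀ c₁) := by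
  unfold doubleWell; fun_prop

theorem doubleWell_le {c₀ c₁ s : ℝ} (h₀ : c₀ ≤ s) (h₁ : s ≤ c₁) :
    doubleWell c₀ c₁ s ≤ (c₁ - c₀) ^ 2 * (c₁ - c₀) ^ 2 := by
  unfold doubleWell
  refine mul_le_mul ?_ ?_ (sq_nonneg _) (sq_nonneg _)
  · exact pow_le_pow_left₀ (by linarith) (by linarith) 2
  · rw [← neg_sub c₁ s, neg_sq]
    exact pow_le_pow_left₀ (by linarith) (by linarith) 2

theorem tendsto_integral_doubleWell (hb : Bornology.IsBounded Ω) {c₀ c₁ : ℝ}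
    {s : ℕ → EuclideanSpace ℝ (Fin d) → ℝ} {σ : EuclideanSpace ℝ (Fin d) → ℝ}
    (hs : ∀ n, s n ∈ admissible Ω c₀ c₁)
    (hlim : ∀ᵐ x ∂(volume.restrict Ω), Tendsto (fun n => s n x) atTop (𝓝 (σ x))) :
    Tendsto (fun n => ∫ x in Ω, doubleWell c₀ c₁ (s n x)) atTop
      (𝓝 (∫ x in Ω, doubleWell c₀ c₁ (σ x))) := by
  have : IsFiniteMeasure (volume.restrict Ω) := ⟨by simpa using hb.measure_lt_top⟩
  refine tendsto_integral_of_dominated_convergence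
    (fun _ => (c₁ - c₀) ^ 2 * (c₁ - c₀) ^ 2) (fun n => ?_) (integrable_const _) (fun n => ?_) ?_
  · exact (continuous_doubleWell c₀ c₁).comp_aestronglyMeasurable (hs n).1.1.1
  · filter_upwards [(hs n).2] with x hx
    rw [Real.norm_of_nonneg (doubleWell_nonneg _ _ _)]
    exact doubleWell_le hx.1 hx.2
  · filter_upwards [hlim] with x hx
    exact ((continuous_doubleWell c₀ c₁).tendsto _).comp hx

theorem integral_norm_sq_eq {α F : Type*} [MeasurableSpace α] [NormedAddCommGroup F]
    {μ : Measure α} {f : α → F} (hf : MemLp f 2 μ) : ∫ x, ‖f x‖ ^ 2 ∂μ = ‖hf.toLp f‖ ^ 2 := by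
  rw [integral_eq_lintegral_of_nonneg_ae (Eventually.of_forall fun _ => sq_nonneg _)
    (hf.1.norm.pow 2), ← ENNReal.toReal_ofReal (sq_nonneg ‖hf.toLp f‖),
    ← lintegral_enorm_sq_eq_of_memLp hf]
  congr 1
  refine lintegral_congr fun x => ?_
  rw [ENNReal.ofReal_pow (norm_nonneg _), ofReal_norm]

/-- The part of the Tikhonov functional that does not involve `∇σ`. -/
noncomputable def lowerOrder (Ω : Set (EuclideanSpace ℝ (Fin d)))
    (e : Fin L → Set (EuclideanSpace ℝ (Fin d))) (z : Fin L → ℝ)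
    (I Uδ : EuclideanSpace ℝ (Fin L)) (c₀ c₁ α ε : ℝ) (σ : EuclideanSpace ℝ (Fin d) → ℝ) : ℝ :=
  1 / 2 * ‖voltage Ω e z I σ - Uδ‖ ^ 2 + α / 2 * (1 / ε * ∫ x in Ω, doubleWell c₀ c₁ (σ x))

theorem lowerOrder_nonneg (e : Fin L → Set (EuclideanSpace ℝ (Fin d))) (z : Fin L → ℝ)
    (I Uδ : EuclideanSpace ℝ (Fin L)) (c₀ c₁ : ℝ) {α ε : ℝ} (hα : 0 < α) (hε : 0 < ε)
    (σ : EuclideanSpace ℝ (Fin d) → ℝ) : 0 ≤ lowerOrder Ω e z I Uδ c₀ c₁ α ε σ := by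
  have : 0 ≤ ∫ x in Ω, doubleWell c₀ c₁ (σ x) := integral_nonneg fun _ => doubleWell_nonneg _ _ _
  unfold lowerOrder
  positivity

theorem tikhonov_eq (e : Fin L → Set (EuclideanSpace ℝ (Fin d))) (z : Fin L → ℝ)
    (I Uδ : EuclideanSpace ℝ (Fin L)) (c₀ c₁ α ε : ℝ) (σ : EuclideanSpace ℝ (Fin d) → ℝ) :
    tikhonov Ω e z I Uδ c₀ c₁ α ε σ = lowerOrder Ω e z I Uδ c₀ c₁ α ε σ +
      α / 2 * ε * ∫ x in Ω, ‖weakGrad Ω σ x‖ ^ 2 := by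
  rw [tikhonov, lowerOrder, modicaMortola]
  ring

/-- A sequence of admissible conductivities with bounded gradients has a subsequence converging
almost everywhere to an admissible conductivity, whose gradient is a weak limit. -/
theorem exists_subseq_tendsto (hΩ : IsPolyhedralDomain Ω) {c₀ c₁ : ℝ} (hc₀ : 0 < c₀)
    (hc₁ : c₀ < c₁) {s : ℕ → EuclideanSpace ℝ (Fin d) → ℝ} (hs : ∀ n, s n ∈ admissible Ω c₀ c₁)
    {M : ℝ} (hM : ∀ n, ∫ x in Ω, ‖weakGrad Ω (s n) x‖ ^ 2 ≤ M) :
    ∃ σ ∈ admissible Ω c₀ c₁, ∃ ns : ℕ → ℕ, StrictMono ns ∧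
      (∀ᵐ x ∂(volume.restrict Ω), Tendsto (fun n => s (ns n) x) atTop (𝓝 (σ x))) ∧
      ∀ q, Tendsto (fun n => ∫ x in Ω, ‖weakGrad Ω (s (ns n)) x‖ ^ 2) atTop (𝓝 q) →
        ∫ x in Ω, ‖weakGrad Ω σ x‖ ^ 2 ≤ q := by
  have hG := fun n => weakGrad_spec (hs n).1.2
  set f : ℕ → Lp ℝ 2 (volume.restrict Ω) := fun n => (hs n).1.1.toLp (s n) with hf
  set g : ℕ → Lp (EuclideanSpace ℝ (Fin d)) 2 (volume.restrict Ω) :=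
    fun n => (hG n).1.toLp _ with hg
  have hfs : ∀ n, f n =ᵐ[volume.restrict Ω] s n := fun n => (hs n).1.1.coeFn_toLp
  have hfg : ∀ n, IsWeakGradient Ω (f n) (g n) := fun n =>
    (hG n).congr (hfs n).symm (hG n).1.coeFn_toLp.symm
  have hgn : ∀ n, ∫ x in Ω, ‖weakGrad Ω (s n) x‖ ^ 2 = ‖g n‖ ^ 2 := fun n =>
    integral_norm_sq_eq (hG n).1
  have hgM : ∀ n, ‖g n‖ ≤ Real.sqrt M := fun n => Real.le_sqrt_of_sq_le (hgn n ▸ hM n)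
  have hmem : ∀ n, f n ∈ boundedH1 Ω (Real.sqrt M) c₁ := by
    refine fun n => ⟨⟨g n, hfg n, hgM n⟩, ?_⟩
    filter_upwards [hfs n, (hs n).2] with x h1 h2
    rw [h1, abs_of_nonneg (hc₀.le.trans h2.1)]
    exact h2.2
  have hK : IsCompact (closure (boundedH1 Ω (Real.sqrt M) c₁)) :=
    (totallyBounded_boundedH1 hΩ (hc₀.trans hc₁).le).closure.isCompact_of_isClosed isClosed_closure
  obtain ⟨f', -, ns, hns, hlim⟩ := hK.tendsto_subseq fun n => subset_closure (hmem n)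
  obtain ⟨ms, hms, hae⟩ := (tendstoInMeasure_of_tendsto_Lp hlim).exists_seq_tendsto_ae
  obtain ⟨g', hg'⟩ := exists_tendsto_inner_hyperfilter (g := fun n => g (ns (ms n)))
    fun n => hgM _
  have hlim' : Tendsto (fun n => f (ns (ms n))) (hyperfilter ℕ : Filter ℕ) (𝓝 f') :=
    (hlim.comp hms.tendsto_atTop).mono_left Nat.hyperfilter_le_atTop
  have hfg' : IsWeakGradient Ω f' g' := by
    obtain ⟨P, hP⟩ := exists_isWeakGradient_iff_inner Ω
    refine (hP _ _).2 fun p hp => ?_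
    have h1 := ((tendsto_const_nhds (x := p.1)).inner (𝕜 := ℝ) hlim').add (hg' p.2)
    exact tendsto_nhds_unique h1
      (tendsto_const_nhds.congr fun n => ((hP _ _).1 (hfg _) p hp).symm)
  have hae' : ∀ᵐ x ∂(volume.restrict Ω),
      Tendsto (fun n => s (ns (ms n)) x) atTop (𝓝 (f' x)) := by
    filter_upwards [hae, ae_all_iff.2 hfs] with x h1 h2
    exact h1.congr fun n => h2 _
  refine ⟨f', ⟨⟨Lp.memLp f', _, hfg'⟩, ?_⟩, ns ∘ ms, hns.comp hms, hae', fun q hq => ?_⟩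
  · filter_upwards [hae', ae_all_iff.2 fun n => (hs n).2] with x h1 h2
    exact ⟨ge_of_tendsto' h1 fun n => (h2 _).1, le_of_tendsto' h1 fun n => (h2 _).2⟩
  · have h1 : ∫ x in Ω, ‖weakGrad Ω f' x‖ ^ 2 = ‖g'‖ ^ 2 := by
      have e : g' = (Lp.memLp g').toLp g' := (Lp.toLp_coeFn _ _).symm
      rw [e, ← integral_norm_sq_eq (Lp.memLp g')]
      refine integral_congr_ae ?_
      filter_upwards [weakGrad_ae_eq hΩ (EventuallyEq.refl _ _) hfg'] with x hx
      rw [hx]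
    have h2 : Tendsto (fun n => ‖g (ns (ms n))‖ ^ 2) (hyperfilter ℕ : Filter ℕ) (𝓝 q) :=
      (hq.congr fun n => hgn _).mono_left Nat.hyperfilter_le_atTop
    have h3 : inner ℝ g' g' ≤ (‖g'‖ ^ 2 + q) / 2 := by
      refine le_of_tendsto_of_tendsto' (hg' g') ((h2.const_add (‖g'‖ ^ 2)).div_const 2) fun n => ?_
      have := real_inner_le_norm g' (g (ns (ms n)))
      nlinarith [sq_nonneg (‖g'‖ - ‖g (ns (ms n))‖)]
    rw [real_inner_self_eq_norm_sq] at h3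
    rw [h1]
    linarith

/-- The direct method: along a minimizing sequence the lower order part converges and the
gradient term is lower semicontinuous. -/
theorem exists_isMinOn_tikhonov (hd : 1 ≤ d) (hL : 1 ≤ L) (hΩ : IsPolyhedralDomain Ω)
    {e : Fin L → Set (EuclideanSpace ℝ (Fin d))} (he : IsElectrodeFamily Ω e) {z : Fin L → ℝ}
    (hz : ∀ l, 0 < z l) (I Uδ : EuclideanSpace ℝ (Fin L)) {c₀ c₁ : ℝ} (hc₀ : 0 < c₀)
    (hc₁ : c₀ < c₁) {α ε : ℝ} (hα : 0 < α) (hε : 0 < ε) :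
    ∃ σ ∈ admissible Ω c₀ c₁,
      IsMinOn (tikhonov Ω e z I Uδ c₀ c₁ α ε) (admissible Ω c₀ c₁) σ := by
  have hb := hΩ.isBounded
  have hfin : IsFiniteMeasure (volume.restrict Ω) := ⟨by simpa using hb.measure_lt_top⟩
  set J := tikhonov Ω e z I Uδ c₀ c₁ α ε with hJ
  set A := lowerOrder Ω e z I Uδ c₀ c₁ α ε with hA
  have hk : 0 < α / 2 * ε := by positivity
  have hJA : ∀ σ, J σ = A σ + α / 2 * ε * ∫ x in Ω, ‖weakGrad Ω σ x‖ ^ 2 :=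
    tikhonov_eq e z I Uδ c₀ c₁ α ε
  have hA0 : ∀ σ, 0 ≤ A σ := lowerOrder_nonneg e z I Uδ c₀ c₁ hα hε
  have hne : (fun _ => c₀) ∈ admissible Ω c₀ c₁ :=
    ⟨⟨memLp_const c₀, _, isWeakGradient_const c₀⟩, Eventually.of_forall fun _ => ⟨le_rfl, hc₁.le⟩⟩
  have hbdd : BddBelow (J '' admissible Ω c₀ c₁) := by
    refine ⟨0, ?_⟩
    rintro _ ⟨σ, -, rfl⟩
    rw [hJA]
    have : 0 ≤ ∫ x in Ω, ‖weakGrad Ω σ x‖ ^ 2 := integral_nonneg fun _ => sq_nonneg _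
    have := hA0 σ
    positivity
  obtain ⟨v, -, hv, hvmem⟩ := exists_seq_tendsto_sInf (Set.Nonempty.image J ⟨_, hne⟩) hbdd
  choose s hs hsv using hvmem
  obtain rfl : v = fun n => J (s n) := funext fun n => (hsv n).symm
  obtain ⟨B, hB⟩ := hv.bddAbove_range
  have hM : ∀ n, ∫ x in Ω, ‖weakGrad Ω (s n) x‖ ^ 2 ≤ B / (α / 2 * ε) := by
    intro n
    rw [le_div_iff₀' hk]
    have h1 : J (s n) ≤ B := hB ⟨n, rfl⟩
    rw [hJA] at h1
    linarith [hA0 (s n)]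
  obtain ⟨σ, hσ, ns, hns, hae, hlsc⟩ := exists_subseq_tendsto hΩ hc₀ hc₁ hs hM
  have hAlim : Tendsto (fun n => A (s (ns n))) atTop (𝓝 (A σ)) :=
    ((((tendsto_voltage hd hL hΩ he hz I hc₀ (fun n => hs (ns n)) hσ hae).sub_const Uδ).norm.pow
      2).const_mul (1 / 2)).add
      (((tendsto_integral_doubleWell hb (fun n => hs (ns n)) hae).const_mul (1 / ε)).const_mul
        (α / 2))
  -- along the subsequence `J` and `A` converge, so the gradient energies do as well
  have hq : Tendsto (fun n => ∫ x in Ω, ‖weakGrad Ω (s (ns n)) x‖ ^ 2) atTop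
      (𝓝 ((sInf (J '' admissible Ω c₀ c₁) - A σ) / (α / 2 * ε))) := by
    refine (((hv.comp hns.tendsto_atTop).sub hAlim).div_const _).congr fun n => ?_
    rw [Function.comp_apply, hJA, add_sub_cancel_left, mul_div_cancel_left₀ _ hk.ne']
  have h1 := hlsc _ hq
  rw [le_div_iff₀' hk] at h1
  refine ⟨σ, hσ, fun τ hτ => ?_⟩
  have h2 : J σ ≤ sInf (J '' admissible Ω c₀ c₁) := by
    rw [hJA]; linarith
  exact h2.trans (csInf_le hbdd ⟨τ, hτ, rfl⟩)

end CEM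

theorem mainTheorem4 {d L : ℕ} (hd : d = 2 ∨ d = 3) (hL : 1 ≤ L)
    (Ω : Set (EuclideanSpace ℝ (Fin d))) (hΩ : CEM.IsPolyhedralDomain Ω)
    (e : Fin L → Set (EuclideanSpace ℝ (Fin d))) (he : CEM.IsElectrodeFamily Ω e)
    (z : Fin L → ℝ) (hz : ∀ l, 0 < z l)
    (I : EuclideanSpace ℝ (Fin L)) (hI : ∑ l, I l = 0) (Uδ : EuclideanSpace ℝ (Fin L))
    (c₀ c₁ : ℝ) (hc₀ : 0 < c₀) (hc₁ : c₀ < c₁) (α : ℝ) (hα : 0 < α) :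
    (∀ σ ∈ CEM.admissible Ω c₀ c₁,
      ∃ (u : EuclideanSpace ℝ (Fin d) → ℝ) (U : EuclideanSpace ℝ (Fin L)),
        CEM.IsSolution Ω e z I σ u U ∧
        ∀ (u' : EuclideanSpace ℝ (Fin d) → ℝ) (U' : EuclideanSpace ℝ (Fin L)),
          CEM.IsSolution Ω e z I σ u' U' → u' =ᵐ[volume.restrict Ω] u ∧ U' = U) ∧
    ∀ ε : ℝ, 0 < ε → ∃ σ ∈ CEM.admissible Ω c₀ c₁,
      IsMinOn (CEM.tikhonov Ω e z I Uδ c₀ c₁ α ε) (CEM.admissible Ω c₀ c₁) σ := by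
  have hd' : 1 ≤ d := by omega
  exact ⟨fun σ hσ => CEM.existsUnique_isSolution hd' hL hΩ he hz I hc₀ hσ,
    fun ε hε => CEM.exists_isMinOn_tikhonov hd' hL hΩ he hz I Uδ hc₀ hc₁ hα hε⟩
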